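/- Let $K$ be a non-archimedean local field with ring of integers $\mathcal O_K$, finite residue field $k$ of cardinality $q$, and normalized absolute value ($|\varpi|=q^{-1}$ for a uniformizer $\varpi$). Let $X$ be a regular $\mathcal O_K$-variety of relative dimension $d$: a regular quasi-projective flat $\mathcal O_K$-scheme all of whose irreducible components have relative dimension $d$ and which is $\mathcal O_K$-smooth on an open dense subscheme. Put $X_k=X\otimes_{\mathcal O_K}k$ and let $X_{\mathrm{sm}}\subset X$ be the $\mathcal O_K$-smooth locus. Let $D$ be a $\mathbb Q$-divisor on $X$ which is simple normal crossing in the following sense. For every $k$-point $x$ of $X_{\mathrm{sm}}$: (1) the completion at $x$ of each prime component of $D$ through $x$ is irreducible; (2) there is a regular system of parameters $x_0=\varpi,x_1,\dots,x_d$ on a neighborhood of $x$, with $\varpi$ a uniformizer of $K$, such that the support of $D$ is defined there by a product of some of the $x_i$ (distinct indices). Let $K_X$ be the canonical divisor of $X$ over $\mathcal O_K$, and let $X(\mathcal O_K)^\circ\subset X(\mathcal O_K)$ be the set of $\mathcal O_K$-points whose generic point lies in $X_{\mathrm{sm}}$, a $K$-analytic manifold. For $r>0$ with $r(K_X+D)$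 Cartier, let $\mu_{X,D}$ be the measure on $X(\mathcal O_K)$ which on $X(\mathcal O_K)^\circ$ is locally $|\omega|^{1/r}$, where $\omega$ is a local generator of $\mathcal O_X(r(K_X+D))\subset(\Omega^d_{X/\mathcal O_K})^{\otimes r}\otimes K(X)$ and $|f\,(dx_1\wedge\dots\wedge dx_d)^{\otimes r}|^{1/r}=|f|^{1/r}\,d\mu_{K^d}$ in local coordinates ($\mu_{K^d}$ is the Haar measure with $\mu_{K^d}(\mathcal O_K^d)=1$), and for which the complement of $X(\mathcal O_K)^\circ$ has measure zero; it does not depend on $r$. For a constructible subset $C\subset X_k$ put $$\sharp_{\mathrm{st}}(X,D)_C=q^d\cdot\mu_{X,D}(X(\mathcal O_K)_C)\in\mathbb R_{\ge0}\cup\{\infty\},$$ where $X(\mathcal O_K)_C$ is the set of $\mathcal O_K$-points sending the closed point into $C$. Let $A_1,\dots,A_l$ be all the prime divisors of $X$ contained in $X_k$ at whose generic points $X$ is $\mathcal O_K$-smooth, and let $a_h\in\mathbb Q$ be the coefficient of $A_h$ in $D$ (possibly $a_h=0$). Let $C_1,\dots,C_n$ be the prime components of $D$ (with nonzero coefficients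 $c_1,\dots,c_n$) which dominate $\operatorname{Spec}\mathcal O_K$. Thus $D=\sum_h a_hA_h+\sum_i b_iB_i+\sum_j c_jC_j$, where the $B_i\subset X_k$ are prime divisors at whose generic points $X$ is not $\mathcal O_K$-smooth. Put $A_h^\circ=A_h\cap X_{\mathrm{sm}}$ and, for $J\subset\{1,\dots,n\}$, $C_J^\circ=\bigl(\bigcap_{j\in J}C_j\bigr)\setminus\bigl(\bigcup_{j\notin J}C_j\bigr)$ (with $\bigcap_{j\in\emptyset}C_j=X$). Then $\sharp_{\mathrm{st}}(X,D)_C$ is finite if and only if $c_j<1$ for every $j$ such that $(C_j\cap C\cap X_{\mathrm{sm}})(k)\neq\emptyset$. If these equivalent conditions hold, then $$\sharp_{\mathrm{st}}(X,D)_C=\sum_{h=1}^{l}q^{a_h}\sum_{J\subset\{1,\dots,n\}}\sharp(C\cap A_h^\circ\cap C_J^\circ)(k)\prod_{j\in J}\frac{q-1}{q^{1-c_j}-1},$$ where a term with $\sharp(C\cap A_h^\circ\cap C_J^\circ)(k)=0$ is read as $0$. -/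

import Mathlib

open AlgebraicGeometry CategoryTheory ValuativeRel MeasureTheory
open scoped ENNReal

universe u

namespace StringyCount

noncomputable section

/-! ### The local field `K` -/

section LocalField

variable (K : Type u) [Field K] [ValuativeRel K] [TopologicalSpace K]
  [IsNonarchimedeanLocalField K]

/-- The cardinality `q` of the residue field `k`. -/
def residueCard : ℕ := Nat.card 𝓀[K]

/-- `Spec 𝒪_K`. -/
abbrev base : Scheme.{u} := Spec (CommRingCat.of 𝒪[K])

/-- `Spec k → Spec 𝒪_K`. -/
def residueMap : Spec (CommRingCat.of 𝓀[K]) ⟶ base K :=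
  Spec.map (CommRingCat.ofHom (IsLocalRing.residue 𝒪[K]))

/-- The closed point of `Spec 𝒪_K`. -/
def closedPt : base K := IsLocalRing.closedPoint 𝒪[K]

variable {K} in
open Classical in
/-- The normalized absolute value of `K`: `|ϖ| = q⁻¹` for a uniformizer `ϖ`. The (unique)
isomorphism of ordered groups with zero `valueGroupWithZeroIsoInt` maps the class of `ϖ` to
`exp (-1)`. -/
def normAbs (x : K) : ℝ :=
  if x = 0 then 0 else
    (residueCard K : ℝ) ^
      WithZero.log (IsNonarchimedeanLocalField.valueGroupWithZeroIsoInt K (valuation K x))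

theorem isOpen_integer : IsOpen (𝒪[K] : Set K) := by
  let := IsTopologicalAddGroup.rightUniformSpace K
  have := isUniformAddGroup_of_addCommGroup (G := K)
  exact Valued.isOpen_integer K

/-- The compact subset `𝒪_K ^ d` of `K ^ d`. -/
def unitPolydisc (d : ℕ) : TopologicalSpace.PositiveCompacts (Fin d → K) where
  carrier := Set.univ.pi fun _ => (𝒪[K] : Set K)
  isCompact' := isCompact_univ_pi fun _ => isCompact_iff_compactSpace.mpr
    (inferInstanceAs (CompactSpace 𝒪[K]))
  interior_nonempty' := by
    rw [(isOpen_set_pi Set.finite_univ fun _ _ => isOpen_integer K).interior_eq]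
    exact ⟨0, fun _ _ => zero_mem 𝒪[K]⟩

/-- The Haar measure of `K ^ d` (on Borel sets) normalized so that `𝒪_K ^ d` has measure `1`. -/
def haar (d : ℕ) : @Measure (Fin d → K) (borel (Fin d → K)) :=
  letI : MeasurableSpace (Fin d → K) := borel (Fin d → K)
  haveI : BorelSpace (Fin d → K) := ⟨rfl⟩
  Measure.addHaarMeasure (unitPolydisc K d)

end LocalField

variable {K : Type u} [Field K] [ValuativeRel K] [TopologicalSpace K]
  [IsNonarchimedeanLocalField K] {X : Scheme.{u}}

/-! ### Varieties over `𝒪_K` -/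

attribute [local instance] MvPolynomial.gradedAlgebra in
/-- `X → Spec 𝒪_K` is quasi-projective: `X` has an immersion over `𝒪_K` into some projective space
`ℙⁿ = Proj 𝒪_K[T₀, …, T_n]`. -/
def IsQuasiProjective (f : X ⟶ base K) : Prop :=
  ∃ (n : ℕ) (i : X ⟶ Proj (MvPolynomial.homogeneousSubmodule (Fin (n + 1)) 𝒪[K])),
    IsImmersion i ∧
      i ≫ Proj.toSpecZero (MvPolynomial.homogeneousSubmodule (Fin (n + 1)) 𝒪[K]) ≫
        Spec.map (CommRingCat.ofHom (algebraMap 𝒪[K]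
          (MvPolynomial.homogeneousSubmodule (Fin (n + 1)) 𝒪[K] 0))) = f

/-- `X` is an `𝒪_K`-variety of (relative) dimension `d`: a reduced quasi-projective scheme, flat and
of finite type over `𝒪_K`, which is smooth over `𝒪_K` on an open dense subscheme and all of whose
irreducible components have relative dimension `d` (equivalently, the smooth open dense subscheme
has relative dimension `d`). -/
structure IsVariety (f : X ⟶ base K) (d : ℕ) : Prop where
  reduced : IsReduced X
  quasiProjective : IsQuasiProjective f
  flat : Flat f
  locallyOfFiniteType : LocallyOfFiniteType f
  quasiCompact : QuasiCompact f
  smooth_dense : ∃ V : X.Opens, Dense (V : Set X) ∧ SmoothOfRelativeDimension d (V.ι ≫ f)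

/-- All local rings of `X` are regular. -/
def IsRegularScheme (X : Scheme.{u}) : Prop :=
  ∀ x : X, IsRegularLocalRing (X.presheaf.stalk x)

/-- Prime divisors of `X`, represented by their generic points, the points of codimension one. -/
abbrev PrimeDivisor (X : Scheme.{u}) : Type u := {y : X // Order.coheight y = 1}

/-- The closed subset of `X` underlying a prime divisor. -/
def PrimeDivisor.support (y : PrimeDivisor X) : Set X := closure {y.1}

/-- Weil divisors with rational coefficients. -/
abbrev QDivisor (X : Scheme.{u}) : Type u := PrimeDivisor X →₀ ℚ

/-- The structure homomorphism `𝒪_K → Γ(X, U)`. -/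
def structMap (f : X ⟶ base K) (U : X.Opens) : 𝒪[K] →+* Γ(X, U) :=
  (f.appLE ⊤ U le_top).hom.comp (Scheme.ΓSpecIso (CommRingCat.of 𝒪[K])).inv.hom

/-! ### `𝒪_K`-points and `k`-points -/

/-- `X(𝒪_K)`, the set of sections of `X → Spec 𝒪_K`. -/
def IntegralPoint (f : X ⟶ base K) : Type u := {p : base K ⟶ X // p ≫ f = 𝟙 (base K)}

namespace IntegralPoint

variable {f : X ⟶ base K}

/-- The point of `X` to which the closed point of `Spec 𝒪_K` is sent. -/
def special (p : IntegralPoint f) : X := p.1 (closedPt K)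

/-- `p : Spec 𝒪_K → X` factors through `U` (equivalently, `p.special ∈ U`). -/
def FactorsThrough (p : IntegralPoint f) (U : X.Opens) : Prop := ⊤ ≤ p.1 ⁻¹ᵁ U

/-- The value `g(p) ∈ 𝒪_K` of a regular function `g` on `U` at `p ∈ U(𝒪_K)`. -/
def eval (p : IntegralPoint f) {U : X.Opens} (h : p.FactorsThrough U) : Γ(X, U) →+* 𝒪[K] :=
  (Scheme.ΓSpecIso (CommRingCat.of 𝒪[K])).hom.hom.comp (p.1.appLE U ⊤ h).hom

/-- The topology of `X(𝒪_K)`: the subsets `U(𝒪_K)` are open and regular functions on `U` define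
continuous functions `U(𝒪_K) → 𝒪_K`. -/
instance : TopologicalSpace (IntegralPoint f) :=
  TopologicalSpace.generateFrom
    {S | ∃ (U : X.Opens) (g : Γ(X, U)) (V : Set 𝒪[K]), IsOpen V ∧
      S = {p | ∃ h : p.FactorsThrough U, p.eval h g ∈ V}}

instance : MeasurableSpace (IntegralPoint f) := borel _

end IntegralPoint

/-- `X(k)`. -/
def ResiduePoint (f : X ⟶ base K) : Type u :=
  {x : Spec (CommRingCat.of 𝓀[K]) ⟶ X // x ≫ f = residueMap K}

/-- The point of the scheme `X` underlying a `k`-point. -/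
def ResiduePoint.pt {f : X ⟶ base K} (x : ResiduePoint f) : X :=
  x.1 (IsLocalRing.closedPoint 𝓀[K])

/-- `S(k)` for a subset `S` of `X`: the `k`-points of `X` lying in `S`. -/
def residuePoints (f : X ⟶ base K) (S : Set X) : Set (ResiduePoint f) := {x | x.pt ∈ S}

/-! ### The canonical sheaf and the measure `μ_{X,D}` -/

/-- The order along the prime divisor `y` (meeting `U`) of the rational `d`-form
`dx₁ ∧ ⋯ ∧ dx_d`, as a rational section of the canonical sheaf `ω_X = ω_{X/𝒪_K}`.

Here `Γ(X, U) = P / I` with `P = 𝒪_K[Y₁, …, Y_c, X₁, …, X_d]`, the class of `Y_i` being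
`gen (inl i)` and the class of `X_i` being `x_i = gen (inr i)`. By definition (adjunction)
`ω_X` is, in codimension one, `ω_{P/𝒪_K} ⊗ det (I / I²)⁻¹` restricted to `U`: if `F₁, …, F_c ∈ I`
generate `I` locally at `y`, a local generator of `ω_X` is the rational form `η` such that
`dF₁ ∧ ⋯ ∧ dF_c ∧ η = dY₁ ∧ ⋯ ∧ dY_c ∧ dX₁ ∧ ⋯ ∧ dX_d`, and hence
`dx₁ ∧ ⋯ ∧ dx_d = det (∂F_i / ∂Y_j) • η`. For an arbitrary family of elements of `I` the
determinant is a multiple of this one in the local ring at `y`, so that the order of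
`dx₁ ∧ ⋯ ∧ dx_d` is the least order of such a determinant. -/
def orderForm (f : X ⟶ base K) {U : X.Opens} {c d : ℕ} (gen : Fin c ⊕ Fin d → Γ(X, U))
    (y : X) (hy : y ∈ U) : ℕ∞ :=
  ⨅ F : Fin c → RingHom.ker (MvPolynomial.eval₂Hom (structMap f U) gen),
    Ring.ord (X.presheaf.stalk y) ((X.presheaf.germ U y hy).hom
      (MvPolynomial.eval₂Hom (structMap f U) gen
        (Matrix.det (Matrix.of fun i j : Fin c =>
          MvPolynomial.pderiv (Sum.inl j) (F i : MvPolynomial (Fin c ⊕ Fin d) 𝒪[K])))))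

/-- Local data for the `r`-fold form attached to the pair `(X, D)`:

* an affine open `U`, with `Γ(X, U)` a domain, and regular functions `x₁, …, x_d` on `U`
  (the last `d` members of a finite system of generators of `Γ(X, U)` over `𝒪_K`);
* a generator `ω = (num / den) • (dx₁ ∧ ⋯ ∧ dx_d)^{⊗ r}` on `U` of the subsheaf
  `𝒪_X(r(K_X + D))` of the sheaf of rational `r`-fold `d`-forms: the divisor of `ω`, as
  a rational section of `ω_X^{⊗ r}`, is `-r D` on `U`;
* an open subset `W` of `U(𝒪_K)` on which `x₁, …, x_d` are local coordinates of the `K`-analytic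
  manifold `X(𝒪_K)°`: the points of `W` send the generic point of `Spec 𝒪_K` into an open subset
  (the locus `s ≠ 0`) of `U` on which `(x₁, …, x_d)` is étale, in particular `X` is smooth
  over `𝒪_K`, and `(x₁, …, x_d)` maps `W` homeomorphically onto an open subset of `K ^ d`. -/
structure Chart (f : X ⟶ base K) (D : QDivisor X) (d : ℕ) where
  U : X.Opens
  affine : IsAffineOpen U
  domain : IsDomain Γ(X, U)
  c : ℕ
  gen : Fin c ⊕ Fin d → Γ(X, U)
  gen_surjective : Function.Surjective (MvPolynomial.eval₂Hom (structMap f U) gen)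
  r : ℕ
  r_pos : 0 < r
  num : Γ(X, U)
  den : Γ(X, U)
  num_ne_zero : num ≠ 0
  den_ne_zero : den ≠ 0
  div_eq : ∀ (y : PrimeDivisor X) (hy : y.1 ∈ U),
    ((Ring.ord (X.presheaf.stalk y.1) ((X.presheaf.germ U y.1 hy).hom num)).toNat : ℚ)
      - ((Ring.ord (X.presheaf.stalk y.1) ((X.presheaf.germ U y.1 hy).hom den)).toNat : ℚ)
      + r * ((orderForm f gen y.1 hy).toNat : ℚ) = - (r * D y)
  s : Γ(X, U)
  etale : RingHom.Etale ((algebraMap Γ(X, U) (Localization.Away s)).comp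
    (MvPolynomial.eval₂Hom (structMap f U) fun i : Fin d => gen (Sum.inr i)))
  W : Set (IntegralPoint f)
  isOpen_W : IsOpen W
  factors : ∀ p ∈ W, p.FactorsThrough U
  eval_s_ne_zero : ∀ (p : IntegralPoint f) (hp : p ∈ W), p.eval (factors p hp) s ≠ 0
  isOpenEmbedding : Topology.IsOpenEmbedding
    fun (p : W) (i : Fin d) => (p.1.eval (factors p.1 p.2) (gen (Sum.inr i)) : K)

namespace Chart

variable {f : X ⟶ base K} {D : QDivisor X} {d : ℕ}

/-- The coordinates `(x₁, …, x_d) : W → K ^ d`. -/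
def coord (c : Chart f D d) (p : c.W) (i : Fin d) : K :=
  (p.1.eval (c.factors p.1 p.2) (c.gen (Sum.inr i)) : K)

/-- The function `|num / den|^{1/r}` on `W`. The value at a zero of `den` plays no role: these
zeros form a null set. -/
def density (c : Chart f D d) (p : c.W) : ℝ≥0∞ :=
  ENNReal.ofReal (normAbs ((p.1.eval (c.factors p.1 p.2) c.num : K) /
    (p.1.eval (c.factors p.1 p.2) c.den : K)) ^ (1 / (c.r : ℝ)))

/-- The measure `|ω|^{1/r} = |num / den|^{1/r} dx₁ ⋯ dx_d` on `W`, as a measure on `X(𝒪_K)`. -/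
def measure (c : Chart f D d) : Measure (IntegralPoint f) :=
  letI : MeasurableSpace (Fin d → K) := borel (Fin d → K)
  ((Measure.comap c.coord (haar K d)).withDensity c.density).map Subtype.val

end Chart

/-- The measure `μ_{X,D}` on `X(𝒪_K)` (on Borel sets): the measure obtained by gluing the measures
`|ω|^{1/r}` on the coordinate patches, i.e. the smallest measure which is on every
patch at least the one given there. The patches cover `X(𝒪_K)°`; the complement of `X(𝒪_K)°`
gets measure zero. -/
def logMeasure (f : X ⟶ base K) (D : QDivisor X) (d : ℕ) : Measure (IntegralPoint f) :=
  ⨆ c : Chart f D d, c.measure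

/-- The stringy point count `♯_st(X, D)_C = q^d μ_{X,D}(X(𝒪_K)_C)`, where `X(𝒪_K)_C` is the set of
the `𝒪_K`-points sending the closed point of `Spec 𝒪_K` into `C`. -/
def stringyCount (f : X ⟶ base K) (D : QDivisor X) (d : ℕ) (C : Set X) : ℝ≥0∞ :=
  (residueCard K : ℝ≥0∞) ^ d * logMeasure f D d {p | p.special ∈ C}

/-! ### Simple normal crossing divisors and their components -/

/-- The ideal of a prime divisor `y` in the local ring at a point `x` of its support. -/
def primeIdealAt (y : PrimeDivisor X) (x : X) (h : x ∈ y.support) : Ideal (X.presheaf.stalk x) :=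
  (IsLocalRing.maximalIdeal (X.presheaf.stalk y.1)).comap
    (X.presheaf.stalkSpecializes (specializes_iff_mem_closure.mpr h)).hom

/-- The completion of `D_i` at `x` is irreducible, for the prime divisor `D_i` given by `y`: the
spectrum of the completion of the local ring `𝒪_{D_i,x}` is irreducible. -/
def CompletionIrreducibleAt (y : PrimeDivisor X) (x : X) (h : x ∈ y.support) : Prop :=
  IrreducibleSpace (PrimeSpectrum (AdicCompletion
    ((IsLocalRing.maximalIdeal (X.presheaf.stalk x)).map (Ideal.Quotient.mk (primeIdealAt y x h)))
    (X.presheaf.stalk x ⧸ primeIdealAt y x h)))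

/-- The support of a `ℚ`-divisor. -/
def divisorSupport (D : QDivisor X) : Set X := ⋃ y ∈ D.support, PrimeDivisor.support y

/-- `D` is simple normal crossing (a condition at the `k`-points at which `X` is smooth):
the components of `D` are irreducible in the completion, and there is a regular
system of parameters `x₀ = ϖ, x₁, …, x_d` on a neighborhood on which the support of `D` is defined
by the product of some of the `x_i`. -/
structure IsSNC (f : X ⟶ base K) [LocallyOfFinitePresentation f] (d : ℕ) (D : QDivisor X) :
    Prop where
  completion_irreducible : ∀ y ∈ D.support, ∀ x : ResiduePoint f, x.pt ∈ f.smoothLocus →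
    ∀ h : x.pt ∈ y.support, CompletionIrreducibleAt y x.pt h
  exists_parameters : ∀ x : ResiduePoint f, x.pt ∈ f.smoothLocus →
    ∃ (U : X.Opens) (hx : x.pt ∈ U) (ϖ : 𝒪[K]) (t : Fin (d + 1) → Γ(X, U))
      (S : Finset (Fin (d + 1))),
      Irreducible ϖ ∧ t 0 = structMap f U ϖ ∧
      Ideal.span (Set.range fun i => (X.presheaf.germ U x.pt hx).hom (t i)) =
        IsLocalRing.maximalIdeal (X.presheaf.stalk x.pt) ∧
      (U : Set X) ∩ divisorSupport D = (U : Set X) \ (X.basicOpen (∏ i ∈ S, t i) : Set X)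

/-- The prime divisor is contained in `X_k`. -/
def IsVertical (f : X ⟶ base K) (y : PrimeDivisor X) : Prop := f y.1 = closedPt K

/-- The prime divisors `A_h`: those contained in `X_k` at whose generic point `X` is smooth. -/
abbrev SmoothVertical (f : X ⟶ base K) [LocallyOfFinitePresentation f] : Type u :=
  {y : PrimeDivisor X // IsVertical f y ∧ y.1 ∈ f.smoothLocus}

open Classical in
/-- The components `C_j` of `D`: those which dominate `Spec 𝒪_K`. -/
def horizontal (f : X ⟶ base K) (D : QDivisor X) : Finset (PrimeDivisor X) :=
  D.support.filter fun y => ¬ IsVertical f y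

/-- `C_J° = (⋂_{j ∈ J} C_j) \ ⋃_{j ∉ J} C_j`. -/
def stratum (f : X ⟶ base K) (D : QDivisor X) (J : Finset (PrimeDivisor X)) : Set X :=
  (⋂ j ∈ J, PrimeDivisor.support j) \ ⋃ j ∈ (horizontal f D : Set (PrimeDivisor X)) \ J,
    PrimeDivisor.support j

end

end StringyCount

open StringyCount

/-! The count is a sum of local volumes over the finitely many `k`-points at which `X` is smooth. An
`𝒪_K`-point gives a section of the local ring of `X` at its reduction, and a regular local algebra
with a section is formally smooth (`formallySmooth_of_section`). So only smooth `k`-points `x`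
matter, and `X(𝒪_K)` is the disjoint union of the open discs of points reducing to such `x`.

At such an `x` take the parameters `ϖ, t₁, …, t_d` of the normal crossing condition. The
differentials `dt₁, …, dt_d` form a basis, so the `t_i` are étale coordinates and Hensel's lemma
identifies the disc with `𝔪^d` (`range_coord`). After shrinking, `D` is a combination of the
hyperplanes `t_i = 0` and `ϖ = 0`, the form `dt₁ ∧ ⋯ ∧ dt_d` generates the canonical sheaf, and the
density of the measure is `q^a ∏ |t_i|^{-c_i}`, where `a` is the coefficient of the component of the
special fibre through `x`. By Tonelli, `q^d` times the volume of the disc is `q^a ∏ (q ∫_𝔪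
|t|^{-c_i})` (`measure_chart_univ`). Each factor is a geometric series of ratio `q^{c-1}`: it is
finite exactly when `c < 1`, it then equals `(q-1)/(q^{1-c}-1)`, and it is `1` for `c = 0`
(`lintegral_pole`).

The measure is a supremum over all charts, so it remains to see that no chart gives more than the
disc charts (`exists_nhd_measure_le`). Let `J` be the Jacobian matrix of the coordinates of another
chart with respect to the `t_i`. For volumes, a first order Taylor expansion writes the change of
coordinates near a point as a linear map followed by nothing worse than a distance-nonincreasing
perturbation, so volume grows by at most `|det J|` (`haar_image_values_le`). For densities,
adjunction shows that the order of the coordinate form of the chart along a prime divisor is the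
order of `det J` (`orderForm_eq`). The prescribed divisors of the two generators then give a
divisibility in codimension one. It extends to the whole regular local ring
(`dvd_of_forall_height_one`), and evaluating at a point gives `|det J|` times one density at most
the other (`mul_density_le`). Inequalities suffice because the disc charts are themselves members of
the supremum.

Finally, exactly one `A_h` passes through each smooth `k`-point. Grouping the points by this `A_h`
and by the set of `C_j` through them gives the formula. -/

namespace StringyCount

set_option linter.unusedSectionVars false

/-! ### Regular local rings are domains; divisibility is tested in codimension one. -/

section RegularLocal

open IsLocalRing

variable {R : Type*} [CommRing R]

/-- Exchange argument: since `x ∉ 𝔪²`, some coefficient of `x` on a minimal generating set is a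
unit, and that generator can be traded for `x`. -/
theorem exists_generators_mem [IsLocalRing R] [IsNoetherianRing R] {x : R}
    (hx : x ∈ maximalIdeal R) (hx2 : x ∉ maximalIdeal R ^ 2) :
    ∃ s : Finset R, x ∈ s ∧ Ideal.span (s : Set R) = maximalIdeal R ∧
      s.card ≤ (maximalIdeal R).spanFinrank := by
  classical
  obtain ⟨s, hs, hsm⟩ := Submodule.FG.exists_span_finset_card_eq_spanFinrank
    (maximalIdeal R).fg_of_isNoetherianRing
  change Ideal.span (s : Set R) = _ at hsm
  have hsub : ∀ g ∈ s, g ∈ maximalIdeal R := fun g hg => hsm ▸ Ideal.subset_span hg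
  obtain ⟨a, -, ha⟩ := Submodule.mem_span_finset.mp (hsm.symm ▸ hx : x ∈ Ideal.span (s : Set R))
  have : ∃ g ∈ s, IsUnit (a g) := by
    by_contra! h
    refine hx2 (ha ▸ Ideal.sum_mem _ fun g hg => ?_)
    rw [smul_eq_mul, pow_two]
    exact Ideal.mul_mem_mul ((mem_maximalIdeal _).mpr (h g hg)) (hsub g hg)
  obtain ⟨g, hg, hu⟩ := this
  refine ⟨insert x (s.erase g), Finset.mem_insert_self _ _, ?_, ?_⟩
  · apply le_antisymm
    · rw [Ideal.span_le]
      intro y hy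
      rcases Finset.mem_insert.mp hy with rfl | hy
      · exact hx
      · exact hsub _ (Finset.mem_of_mem_erase hy)
    · rw [← hsm, Ideal.span_le]
      intro y hy
      by_cases hyg : y = g
      · subst hyg
        set I := Ideal.span ((insert x (s.erase y) : Finset R) : Set R)
        have h1 : a y • y = x - ∑ z ∈ s.erase y, a z • z := by
          rw [← ha, ← Finset.add_sum_erase s _ hg]; ring
        have h2 : a y • y ∈ I := by
          rw [h1]
          refine I.sub_mem (Ideal.subset_span (by simp)) (I.sum_mem fun z hz => ?_)
          exact I.mul_mem_left _ (Ideal.subset_span (by simp at hz; simp [hz]))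
        exact (I.unit_mul_mem_iff_mem hu).mp h2
      · exact Ideal.subset_span (by simp [hyg]; right; exact hy)
  · refine (Finset.card_insert_le _ _).trans ?_
    rw [Finset.card_erase_of_mem hg, hs]
    have := Finset.card_pos.mpr ⟨g, hg⟩
    omega

theorem isRegularLocalRing_of_generators [IsLocalRing R] [IsNoetherianRing R] (s : Finset R)
    (hs : Ideal.span (s : Set R) = maximalIdeal R) (hd : (s.card : WithBot ℕ∞) ≤ ringKrullDim R) :
    IsRegularLocalRing R := by
  refine IsRegularLocalRing.of_spanFinrank_maximalIdeal_le R (le_trans ?_ hd)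
  have := Submodule.spanFinrank_span_le_ncard_of_finite (R := R) s.finite_toSet
  rw [Set.ncard_coe_finset] at this
  change (Ideal.span (s : Set R)).spanFinrank ≤ _ at this
  rw [hs] at this
  exact_mod_cast this

theorem isLocalRing_quotient [IsLocalRing R] {I : Ideal R} (h : I ≤ maximalIdeal R) :
    IsLocalRing (R ⧸ I) :=
  have : Nontrivial (R ⧸ I) := Ideal.Quotient.nontrivial_iff.mpr fun h' =>
    (maximalIdeal.isMaximal R).ne_top (top_le_iff.mp (h' ▸ h))
  .of_surjective' (Ideal.Quotient.mk _) Ideal.Quotient.mk_surjective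

/-- Killing `x` removes one generator of `𝔪` and lowers the dimension by at most one, so the number
of generators still does not exceed the dimension. -/
theorem isRegularLocalRing_quotient [IsRegularLocalRing R] {x : R}
    (hx : x ∈ maximalIdeal R) (hx2 : x ∉ maximalIdeal R ^ 2) :
    ∃ _ : IsRegularLocalRing (R ⧸ Ideal.span {x}),
      (maximalIdeal (R ⧸ Ideal.span {x})).spanFinrank + 1 ≤ (maximalIdeal R).spanFinrank := by
  classical
  have := isLocalRing_quotient ((Ideal.span_singleton_le_iff_mem (maximalIdeal R)).mpr hx)
  obtain ⟨s, hxs, hsm, hc⟩ := exists_generators_mem hx hx2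
  have hmap : maximalIdeal (R ⧸ Ideal.span {x}) =
      Ideal.span ((s.erase x).image (Ideal.Quotient.mk (Ideal.span {x})) : Set _) := by
    rw [← IsLocalRing.map_maximalIdeal_of_surjective _
      (Ideal.Quotient.mk_surjective (I := Ideal.span {x})), ← hsm, Ideal.map_span]
    apply le_antisymm <;> rw [Ideal.span_le]
    · rintro _ ⟨y, hy, rfl⟩
      by_cases h : y = x
      · subst h
        rw [Ideal.Quotient.eq_zero_iff_mem.mpr (Ideal.mem_span_singleton_self y)]
        exact zero_mem _
      · exact Ideal.subset_span (Finset.mem_image_of_mem _ (Finset.mem_erase.mpr ⟨h, hy⟩))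
    · intro y hy
      obtain ⟨z, hz, rfl⟩ := Finset.mem_image.mp hy
      exact Ideal.subset_span ⟨z, Finset.mem_of_mem_erase hz, rfl⟩
  have hdim : ringKrullDim R ≤ ringKrullDim (R ⧸ Ideal.span {x}) + 1 := by
    have := ringKrullDim_le_ringKrullDim_quotient_add_card ({x} : Finset R) (by
      rw [IsLocalRing.ringJacobson_eq_maximalIdeal]; simpa using hx)
    rw [Finset.coe_singleton] at this
    simpa using this
  have hcard : ((s.erase x).image (Ideal.Quotient.mk (Ideal.span {x}))).card + 1 ≤
      (maximalIdeal R).spanFinrank := by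
    have h1 := Finset.card_image_le (s := s.erase x) (f := Ideal.Quotient.mk (Ideal.span {x}))
    have h2 := Finset.card_erase_add_one hxs
    omega
  refine ⟨isRegularLocalRing_of_generators _ hmap.symm ?_, ?_⟩
  · have h3 := IsRegularLocalRing.spanFinrank_maximalIdeal (R := R)
    rw [← h3] at hdim
    have h4 : (((s.erase x).image (Ideal.Quotient.mk (Ideal.span {x}))).card + 1 :
      WithBot ℕ∞) ≤ ringKrullDim (R ⧸ Ideal.span {x}) + 1 :=
      le_trans (by exact_mod_cast hcard) hdim
    generalize ringKrullDim (R ⧸ Ideal.span {x}) = D at h4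
    induction D with
    | bot => simp at h4
    | coe D =>
      have h5 : (((s.erase x).image (Ideal.Quotient.mk (Ideal.span {x}))).card + 1 : ℕ∞) ≤
        D + 1 := by exact_mod_cast h4
      have h6 := (ENat.add_le_add_iff_right (by simp)).mp h5
      exact_mod_cast h6
  · refine le_trans (Nat.add_le_add_right ?_ 1) hcard
    rw [hmap, ← Set.ncard_coe_finset]
    exact Submodule.spanFinrank_span_le_ncard_of_finite (Finset.finite_toSet _)

/-- Induction on the number of generators of `𝔪`. Prime avoidance gives `x ∈ 𝔪` outside `𝔪²` and
outside all minimal primes. By induction `(x)` is prime, so it contains a minimal prime `p`; as `x ∉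
p`, every element of `p` is `x` times an element of `p`, and Nakayama gives `p = 0`. -/
theorem isDomain_of_isRegularLocalRing (R : Type*) [CommRing R] [IsRegularLocalRing R] :
    IsDomain R := by
  obtain ⟨n, hn⟩ : ∃ n, (maximalIdeal R).spanFinrank = n := ⟨_, rfl⟩
  induction n using Nat.strong_induction_on generalizing R with
  | _ n ih =>
  by_cases hf : maximalIdeal R = ⊥
  · exact (isField_iff_maximalIdeal_eq.mpr hf).isDomain
  have hsq : ¬ maximalIdeal R ≤ maximalIdeal R ^ 2 := by
    intro h
    refine hf (Submodule.eq_bot_of_le_smul_of_le_jacobson_bot (maximalIdeal R) _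
      (maximalIdeal R).fg_of_isNoetherianRing ?_ (by rw [jacobson_eq_maximalIdeal _ bot_ne_top]))
    rwa [smul_eq_mul, ← pow_two]
  have hex : ∃ x ∈ maximalIdeal R, x ∉ maximalIdeal R ^ 2 ∧ ∀ p ∈ minimalPrimes R, x ∉ p := by
    by_contra! h
    have hmin : ¬ ∃ p ∈ minimalPrimes R, maximalIdeal R ≤ p := by
      rintro ⟨p, hp, hle⟩
      have := Ideal.IsMinimalPrime.isPrime hp
      have hpm : p = maximalIdeal R := le_antisymm (le_maximalIdeal this.ne_top) hle
      have h0 : ringKrullDim R = 0 := by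
        rw [← maximalIdeal_height_eq_ringKrullDim, ← hpm, Ideal.height_eq_zero_iff.mpr hp]; rfl
      have h1 := IsRegularLocalRing.spanFinrank_maximalIdeal (R := R)
      rw [h0] at h1
      have h2 : (maximalIdeal R).spanFinrank = 0 := by exact_mod_cast h1
      exact hf ((Submodule.spanFinrank_eq_zero_iff_eq_bot
        (maximalIdeal R).fg_of_isNoetherianRing).mp h2)
    -- Prime avoidance tolerates the one ideal `𝔪²` of the family that need not be prime.
    have key := (Ideal.subset_union_prime_finite (R := R)
      (s := insert (maximalIdeal R ^ 2) (minimalPrimes R))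
      ((minimalPrimes.finite_of_isNoetherianRing R).insert _) (f := id)
      (maximalIdeal R ^ 2) (maximalIdeal R ^ 2) (fun i hi h1 _ => by
        rcases hi with h | h
        · exact absurd h h1
        · exact Ideal.IsMinimalPrime.isPrime h) (I := maximalIdeal R)).mp (by
        intro x hx
        by_cases h2 : x ∈ maximalIdeal R ^ 2
        · exact Set.mem_biUnion (Set.mem_insert _ _) h2
        · obtain ⟨p, hp, hxp⟩ := h x hx h2
          exact Set.mem_biUnion (Set.mem_insert_of_mem _ hp) hxp)
    obtain ⟨i, hi, hle⟩ := key
    rcases hi with rfl | h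
    · exact hsq hle
    · exact hmin ⟨i, h, hle⟩
  obtain ⟨x, hx, hx2, hxp⟩ := hex
  obtain ⟨hreg, hlt⟩ := isRegularLocalRing_quotient hx hx2
  have hdom : IsDomain (R ⧸ Ideal.span {x}) := ih _ (by omega) _ rfl
  have hpr : (Ideal.span {x}).IsPrime := (Ideal.Quotient.isDomain_iff_prime _).mp hdom
  obtain ⟨p, hp, hple⟩ := Ideal.exists_minimalPrimes_le (I := ⊥) (J := Ideal.span {x}) bot_le
  have hpp := Ideal.IsMinimalPrime.isPrime hp
  have hp0 : p = ⊥ := by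
    refine Submodule.eq_bot_of_le_smul_of_le_jacobson_bot (maximalIdeal R) _
      p.fg_of_isNoetherianRing ?_ (by rw [jacobson_eq_maximalIdeal _ bot_ne_top])
    intro y hy
    obtain ⟨a, rfl⟩ := Ideal.mem_span_singleton'.mp (hple hy)
    have ha : a ∈ p := (hpp.mem_or_mem hy).resolve_right (hxp p hp)
    rw [mul_comm]
    exact Submodule.smul_mem_smul hx ha
  rw [hp0] at hpp
  exact IsDomain.of_bot_isPrime R

theorem isPrime_span_singleton [IsRegularLocalRing R] {x : R}
    (hx : x ∈ maximalIdeal R) (hx2 : x ∉ maximalIdeal R ^ 2) : (Ideal.span {x}).IsPrime :=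
  have := (isRegularLocalRing_quotient hx hx2).fst
  (Ideal.Quotient.isDomain_iff_prime _).mp (isDomain_of_isRegularLocalRing _)

/-- In a regular local ring of dimension at least two, no principal ideal has the maximal ideal as
an associated prime. -/
theorem dvd_of_forall_mul_dvd [IsRegularLocalRing R] (h : 1 < ringKrullDim R) {a b : R}
    (hb : b ≠ 0) (hab : ∀ m ∈ maximalIdeal R, b ∣ m * a) : b ∣ a := by
  have := isDomain_of_isRegularLocalRing R
  have hfr := IsRegularLocalRing.spanFinrank_maximalIdeal (R := R)
  have hne : ¬ maximalIdeal R ≤ maximalIdeal R ^ 2 := by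
    intro hle
    have : maximalIdeal R = ⊥ :=
      Submodule.eq_bot_of_le_smul_of_le_jacobson_bot (maximalIdeal R) _
        (maximalIdeal R).fg_of_isNoetherianRing (by rwa [smul_eq_mul, ← pow_two])
        (by rw [jacobson_eq_maximalIdeal _ bot_ne_top])
    rw [(Submodule.spanFinrank_eq_zero_iff_eq_bot
        (maximalIdeal R).fg_of_isNoetherianRing).mpr this] at hfr
    rw [← hfr] at h
    exact absurd h (by decide)
  obtain ⟨x, hx, hx2⟩ := Set.not_subset.mp hne
  have hp := isPrime_span_singleton hx hx2
  -- Otherwise `𝔪` is principal, against dimension greater than one.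
  have hne2 : ¬ maximalIdeal R ≤ Ideal.span {x} := by
    intro hle
    have : maximalIdeal R = Ideal.span {x} :=
      le_antisymm hle ((Ideal.span_singleton_le_iff_mem _).mpr hx)
    have h1 := Submodule.spanFinrank_span_le_ncard_of_finite (R := R) (Set.finite_singleton x)
    change (Ideal.span {x}).spanFinrank ≤ _ at h1
    rw [← this, Set.ncard_singleton] at h1
    rw [← hfr] at h
    exact absurd h1 (not_le.mpr (by exact_mod_cast h))
  obtain ⟨y, hy, hyx⟩ := Set.not_subset.mp hne2
  obtain ⟨c, hc⟩ := hab x hx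
  obtain ⟨c', hc'⟩ := hab y hy
  -- The quotients `c`, `c'` of `x * a` and `y * a` by `b` are proportional; as `(x)` is prime and
  -- `y ∉ (x)`, this forces `x ∣ c`.
  have h1 : y * c = x * c' := by
    apply mul_left_cancel₀ hb
    linear_combination y * (-hc) + x * hc'
  have h2 : c ∈ Ideal.span {x} := by
    have : y * c ∈ Ideal.span {x} := h1 ▸ Ideal.mul_mem_right _ _ (Ideal.mem_span_singleton_self x)
    exact (hp.mem_or_mem this).resolve_left hyx
  obtain ⟨e, rfl⟩ := Ideal.mem_span_singleton.mp h2
  have hx0 : x ≠ 0 := fun h => hx2 (h ▸ zero_mem _)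
  exact ⟨e, mul_left_cancel₀ hx0 (by linear_combination hc)⟩

/-- Divisibility in a Noetherian domain with regular local rings can be tested in codimension
one. -/
theorem dvd_of_forall_height_one [IsNoetherianRing R] [IsDomain R]
    (hreg : ∀ (P : Ideal R) [P.IsPrime], IsRegularLocalRing (Localization.AtPrime P))
    {a b : R} (hb : b ≠ 0)
    (h : ∀ (P : Ideal R) [P.IsPrime], P.height = 1 →
      algebraMap R (Localization.AtPrime P) b ∣ algebraMap R (Localization.AtPrime P) a) :
    b ∣ a := by
  rw [← Ideal.mem_span_singleton, ← Ideal.Quotient.eq_zero_iff_mem]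
  by_contra hne
  -- If `b ∤ a`, the annihilator of `a` in `R/(b)` lies in an associated prime `P`, the annihilator
  -- of a class `c`. Height one contradicts the hypothesis on `a`; larger height contradicts
  -- `dvd_of_forall_mul_dvd` applied to `c` in the localization at `P`.
  obtain ⟨P, hP, hle⟩ := exists_le_isAssociatedPrime_of_isNoetherianRing R
    (Ideal.Quotient.mk (Ideal.span {b}) a) hne
  obtain ⟨hPp, z, hz⟩ := isAssociatedPrime_iff.mp hP
  obtain ⟨c, rfl⟩ := Ideal.Quotient.mk_surjective z
  have memc : ∀ r c, r ∈ Submodule.colon (⊥ : Submodule R (R ⧸ Ideal.span {b}))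
      {Ideal.Quotient.mk (Ideal.span {b}) c} ↔ b ∣ r * c := by
    intro r c
    rw [Submodule.mem_colon_singleton, Submodule.mem_bot, ← Ideal.mem_span_singleton,
      ← Ideal.Quotient.eq_zero_iff_mem]
    rfl
  have memP : ∀ r, r ∈ P ↔ b ∣ r * c := fun r => by rw [← memc, hz]
  have hle' : ∀ r, b ∣ r * a → r ∈ P := fun r hr => hle ((memc r a).mpr hr)
  have clear : ∀ e, algebraMap R (Localization.AtPrime P) b ∣ algebraMap R (Localization.AtPrime P) e →
      ∃ s ∉ P, b ∣ s * e := by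
    rintro e ⟨w, hw⟩
    obtain ⟨⟨w', s⟩, rfl⟩ := IsLocalization.mk'_surjective P.primeCompl w
    refine ⟨s, s.2, w', ?_⟩
    apply IsLocalization.injective (Localization.AtPrime P) P.primeCompl_le_nonZeroDivisors
    have := IsLocalization.mk'_spec (Localization.AtPrime P) w' s
    rw [map_mul, map_mul, hw, ← this]
    ring
  have hbP : b ∈ P := (memP b).mpr (dvd_mul_right _ _)
  by_cases h1 : P.height = 1
  · obtain ⟨s, hs, hs'⟩ := clear a (h P h1)
    exact hs (hle' s hs')
  have h0 : P.height ≠ 0 := fun h0 => by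
    have := Ideal.height_eq_zero_iff_eq_bot.mp h0
    exact hb (by simpa [this] using hbP)
  have := hreg P
  have hdim : 1 < ringKrullDim (Localization.AtPrime P) := by
    rw [IsLocalization.AtPrime.ringKrullDim_eq_height P]
    have : 1 < P.height := lt_of_le_of_ne (Order.one_le_iff_ne_zero.mpr h0) (Ne.symm h1)
    exact_mod_cast this
  have hb' : algebraMap R (Localization.AtPrime P) b ≠ 0 := fun h =>
    hb (IsLocalization.injective (Localization.AtPrime P) P.primeCompl_le_nonZeroDivisors
      (h.trans (map_zero _).symm))
  obtain ⟨s, hs, hs'⟩ := clear c (dvd_of_forall_mul_dvd hdim hb' fun m hm => by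
    obtain ⟨⟨m', s⟩, rfl⟩ := IsLocalization.mk'_surjective P.primeCompl m
    have hm' : m' ∈ P := (IsLocalization.AtPrime.mk'_mem_maximal_iff _ P m' s).mp hm
    obtain ⟨e, he⟩ := (memP m').mp hm'
    refine ⟨IsLocalization.mk' _ e s, ?_⟩
    dsimp only
    rw [IsLocalization.mk'_eq_mul_mk'_one, IsLocalization.mk'_eq_mul_mk'_one e, ← mul_assoc,
      ← map_mul, ← he, map_mul]
    ring)
  exact hs ((memP s).mpr hs')

end RegularLocal

/-! ### A regular local algebra with a section is formally smooth. -/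

section SmoothOfSection

open IsLocalRing

/-- Steinitz exchange modulo `𝔪N`. Among the generating families of `N` independent modulo `𝔪N`,
take one with as many members in `I` as possible, indexed by `S`. An element of `I` with a unit
coefficient outside `S` could replace that member, so by maximality there is none. -/
theorem exists_maximal_exchange {P : Type*} [CommRing P] [IsLocalRing P] {N I : Ideal P}
    (hIN : I ≤ N) {n : ℕ} (X : Fin n → P) (hX : Ideal.span (Set.range X) = N)
    (hind : ∀ c : Fin n → P, ∑ i, c i * X i ∈ maximalIdeal P * N → ∀ i, c i ∈ maximalIdeal P) :
    ∃ (g : Fin n → P) (S : Finset (Fin n)), Ideal.span (Set.range g) = N ∧ (∀ i ∈ S, g i ∈ I) ∧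
      (∀ c : Fin n → P, ∑ i, c i * g i ∈ maximalIdeal P * N → ∀ i, c i ∈ maximalIdeal P) ∧
      I ≤ Ideal.span (g '' S) ⊔ maximalIdeal P * N := by
  classical
  let Q : ℕ → Prop := fun m => ∃ (g : Fin n → P) (S : Finset (Fin n)),
    Ideal.span (Set.range g) = N ∧ (∀ i ∈ S, g i ∈ I) ∧
      (∀ c : Fin n → P, ∑ i, c i * g i ∈ maximalIdeal P * N → ∀ i, c i ∈ maximalIdeal P) ∧
      S.card = m
  have hQ0 : Q 0 := ⟨X, ∅, hX, by simp, hind, rfl⟩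
  obtain ⟨g, S, hg, hS, hgi, hc⟩ := Nat.findGreatest_spec (P := Q) (Nat.zero_le n) hQ0
  refine ⟨g, S, hg, hS, hgi, fun x hx => ?_⟩
  obtain ⟨b, hb⟩ := (Submodule.mem_span_range_iff_exists_fun P).mp
    (hg.symm ▸ hIN hx : x ∈ Ideal.span (Set.range g))
  simp only [smul_eq_mul] at hb
  by_cases h : ∃ j ∉ S, IsUnit (b j)
  · exfalso
    obtain ⟨j, hjS, hj⟩ := h
    -- A combination of the exchanged family, rewritten in the old family so that its independence
    -- can be used.
    have hsplit : ∀ (e : Fin n → P), ∑ i, e i * Function.update g j x i =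
        ∑ i, (if i = j then e j * b j else e i + e j * b i) * g i := by
      intro e
      rw [← Finset.add_sum_erase _ _ (Finset.mem_univ j),
        ← Finset.add_sum_erase _ (fun i => _ * g i) (Finset.mem_univ j)]
      rw [← Finset.add_sum_erase _ _ (Finset.mem_univ j)] at hb
      have h1 : ∑ i ∈ Finset.univ.erase j, e i * Function.update g j x i =
          ∑ i ∈ Finset.univ.erase j, e i * g i := Finset.sum_congr rfl fun i hi => by
        rw [Function.update_of_ne (Finset.ne_of_mem_erase hi)]
      have h2 : ∑ i ∈ Finset.univ.erase j, (if i = j then e j * b j else e i + e j * b i) * g i =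
          ∑ i ∈ Finset.univ.erase j, e i * g i +
            e j * ∑ i ∈ Finset.univ.erase j, b i * g i := by
        rw [Finset.mul_sum, ← Finset.sum_add_distrib]
        refine Finset.sum_congr rfl fun i hi => ?_
        rw [if_neg (Finset.ne_of_mem_erase hi)]; ring
      rw [h1, h2, Function.update_self, if_pos rfl, ← hb]; ring
    have hQ : Q (S.card + 1) := by
      refine ⟨Function.update g j x, insert j S, ?_, ?_, ?_, Finset.card_insert_of_notMem hjS⟩
      · apply le_antisymm
        · rw [Ideal.span_le]
          rintro _ ⟨i, rfl⟩
          by_cases hij : i = j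
          · subst hij; rw [Function.update_self]; exact hIN hx
          · rw [Function.update_of_ne hij, ← hg]; exact Ideal.subset_span ⟨i, rfl⟩
        · set L := Ideal.span (Set.range (Function.update g j x))
          have hL : ∀ i, i ≠ j → g i ∈ L := fun i hi =>
            Ideal.subset_span ⟨i, Function.update_of_ne hi _ _⟩
          rw [← hg, Ideal.span_le]
          rintro _ ⟨i, rfl⟩
          by_cases hij : i = j
          · subst hij
            rw [SetLike.mem_coe, ← L.unit_mul_mem_iff_mem hj]
            have : b i * g i = x - ∑ l ∈ Finset.univ.erase i, b l * g l := by
              rw [← hb, ← Finset.add_sum_erase _ _ (Finset.mem_univ i)]; ring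
            rw [this]
            exact L.sub_mem (Ideal.subset_span ⟨i, Function.update_self _ _ _⟩)
              (L.sum_mem fun l hl => L.mul_mem_left _ (hL l (Finset.ne_of_mem_erase hl)))
          · exact hL i hij
      · intro i hi
        by_cases hij : i = j
        · subst hij; rwa [Function.update_self]
        · rw [Function.update_of_ne hij]
          exact hS i ((Finset.mem_insert.mp hi).resolve_left hij)
      · intro e he
        rw [hsplit] at he
        have h3 := hgi _ he
        have hej : e j ∈ maximalIdeal P := by
          have := h3 j
          rw [if_pos rfl] at this
          exact (Ideal.mul_unit_mem_iff_mem _ hj).mp this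
        intro i
        by_cases hij : i = j
        · subst hij; exact hej
        · have := h3 i
          rw [if_neg hij] at this
          exact (Ideal.add_mem_iff_left _ (Ideal.mul_mem_right _ _ hej)).mp this
    have hle : S.card + 1 ≤ n := by
      have := Finset.card_le_univ (insert j S)
      rwa [Finset.card_insert_of_notMem hjS, Fintype.card_fin] at this
    exact absurd (Nat.le_findGreatest hle hQ) (by rw [← hc]; omega)
  · push Not at h
    rw [← hb, ← Finset.sum_add_sum_compl S]
    refine Ideal.add_mem _ (Ideal.mem_sup_left ?_) (Ideal.mem_sup_right ?_)
    · exact Ideal.sum_mem _ fun i hi => Ideal.mul_mem_left _ _ (Ideal.subset_span ⟨i, hi, rfl⟩)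
    · refine Ideal.sum_mem _ fun i hi => Ideal.mul_mem_mul ?_ (hg ▸ Ideal.subset_span ⟨i, rfl⟩)
      exact (mem_maximalIdeal _).mpr (h i (Finset.mem_compl.mp hi))

/-- As the kernel lies in `𝔪²`, lifts of minimal generators of the maximal ideal of `A` generate
that of `A'` by Nakayama. Their number is `dim A ≤ dim A'`, so `A'` is regular, hence a domain, of
the same dimension as `A`; a nonzero kernel element would lower the dimension. -/
theorem injective_of_ker_le_sq {A' A : Type*} [CommRing A'] [IsLocalRing A'] [IsNoetherianRing A']
    [CommRing A] [IsRegularLocalRing A] (φ : A' →+* A) (hφ : Function.Surjective φ)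
    (hk : RingHom.ker φ ≤ maximalIdeal A' ^ 2) : Function.Injective φ := by
  classical
  obtain ⟨s, hs, hsm⟩ := Submodule.FG.exists_span_finset_card_eq_spanFinrank
    (maximalIdeal A).fg_of_isNoetherianRing
  change Ideal.span (s : Set A) = _ at hsm
  have hmm : (maximalIdeal A').map φ = maximalIdeal A :=
    IsLocalRing.map_maximalIdeal_of_surjective φ hφ
  have : IsLocalHom φ := IsLocalHom.of_surjective φ hφ
  have hmem : ∀ z, φ z ∈ maximalIdeal A ↔ z ∈ maximalIdeal A' := fun z => by
    simp [mem_maximalIdeal, mem_nonunits_iff]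
  set s' : Finset A' := s.image (Function.surjInv hφ)
  have hs' : Ideal.span (s' : Set A') = maximalIdeal A' := by
    apply le_antisymm
    · rw [Ideal.span_le]
      intro z hz
      obtain ⟨w, hw, rfl⟩ := Finset.mem_image.mp hz
      rw [SetLike.mem_coe, ← hmem, Function.surjInv_eq hφ, ← hsm]
      exact Ideal.subset_span hw
    · refine Submodule.le_of_le_smul_of_le_jacobson_bot (I := maximalIdeal A')
        (maximalIdeal A').fg_of_isNoetherianRing (by rw [jacobson_eq_maximalIdeal _ bot_ne_top]) ?_
      intro z hz
      have hz' : φ z ∈ (Ideal.span (s' : Set A')).map φ := by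
        rw [Ideal.map_span]
        have : (φ '' (s' : Set A')) = s := by
          ext w; simp only [s', Finset.coe_image, Set.mem_image]
          constructor
          · rintro ⟨_, ⟨v, hv, rfl⟩, rfl⟩; rwa [Function.surjInv_eq hφ]
          · intro hw; exact ⟨_, ⟨w, hw, rfl⟩, Function.surjInv_eq hφ w⟩
        rw [this, hsm]
        exact (hmem z).mpr hz
      obtain ⟨w, hw, hwz⟩ := (Ideal.mem_map_iff_of_surjective φ hφ).mp hz'
      have : z - w ∈ maximalIdeal A' ^ 2 := hk (by rw [RingHom.mem_ker, map_sub, hwz, sub_self])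
      rw [smul_eq_mul, ← pow_two]
      have e : z = w + (z - w) := by ring
      rw [e]
      exact Submodule.add_mem_sup hw this
  have hd : ringKrullDim A ≤ ringKrullDim A' := ringKrullDim_le_of_surjective φ hφ
  have hA := IsRegularLocalRing.spanFinrank_maximalIdeal (R := A)
  have hcard : s'.card ≤ (maximalIdeal A).spanFinrank := hs ▸ Finset.card_image_le
  have hreg : IsRegularLocalRing A' := isRegularLocalRing_of_generators s' hs' (by
    refine le_trans ?_ hd; rw [← hA]; exact_mod_cast hcard)
  have hdom := isDomain_of_isRegularLocalRing A'
  have hA' := IsRegularLocalRing.spanFinrank_maximalIdeal (R := A')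
  have hle : (maximalIdeal A').spanFinrank ≤ (maximalIdeal A).spanFinrank := by
    refine le_trans ?_ hcard
    rw [← hs', ← Set.ncard_coe_finset]
    exact Submodule.spanFinrank_span_le_ncard_of_finite (Finset.finite_toSet _)
  rw [injective_iff_map_eq_zero]
  by_contra! h
  obtain ⟨r, hr, hr0⟩ := h
  have h1 := ringKrullDim_quotient_succ_le_of_nonZeroDivisor (mem_nonZeroDivisors_of_ne_zero hr0)
  have h2 : ringKrullDim A ≤ ringKrullDim (A' ⧸ Ideal.span {r}) :=
    ringKrullDim_le_of_surjective (Ideal.Quotient.lift (Ideal.span {r}) φ (by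
      intro a ha
      exact (Ideal.span_singleton_le_iff_mem (RingHom.ker φ)).mpr hr ha))
      (Ideal.Quotient.lift_surjective_of_surjective _ _ hφ)
  have h3 : ((maximalIdeal A).spanFinrank + 1 : WithBot ℕ∞) ≤ (maximalIdeal A').spanFinrank := by
    rw [hA, hA']
    exact (add_le_add_left h2 1).trans h1
  have h4 : (maximalIdeal A).spanFinrank + 1 ≤ (maximalIdeal A').spanFinrank := by
    exact_mod_cast h3
  omega

/-- Injectivity of `I/𝔪I → N/𝔪N` for the kernel `I`. Let `J ⊆ I` be generated by the exchanged
members `g '' S`. The kernel of `P/J → A` lies in the square of the maximal ideal, so it vanishes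
and `I = J`; independence of `g` puts the coefficients in `𝔪`. -/
theorem mem_mul_ker_of_mem_mul {P A : Type*} [CommRing P] [IsLocalRing P] [IsNoetherianRing P]
    [CommRing A] [IsRegularLocalRing A] (π : P →+* A) (hπ : Function.Surjective π)
    {N : Ideal P} (hN : N ≤ maximalIdeal P) (hIN : RingHom.ker π ≤ N)
    {n : ℕ} (X : Fin n → P) (hX : Ideal.span (Set.range X) = N)
    (hind : ∀ c : Fin n → P, ∑ i, c i * X i ∈ maximalIdeal P * N → ∀ i, c i ∈ maximalIdeal P)
    {x : P} (hx : x ∈ RingHom.ker π) (hxN : x ∈ maximalIdeal P * N) :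
    x ∈ maximalIdeal P * RingHom.ker π := by
  classical
  obtain ⟨g, S, hg, hS, hgi, hle⟩ := exists_maximal_exchange hIN X hX hind
  set J := Ideal.span (g '' S)
  have hJ : J ≤ RingHom.ker π := by
    rw [Ideal.span_le]; rintro _ ⟨i, hi, rfl⟩; exact hS i hi
  have hJ0 : ∀ a ∈ J, π a = 0 := fun a ha => RingHom.mem_ker.mp (hJ ha)
  have hloc : IsLocalRing (P ⧸ J) := isLocalRing_quotient (hJ.trans (hIN.trans hN))
  have hmm : (maximalIdeal P).map (Ideal.Quotient.mk J) = maximalIdeal (P ⧸ J) :=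
    IsLocalRing.map_maximalIdeal_of_surjective _ Ideal.Quotient.mk_surjective
  have hinj := injective_of_ker_le_sq (Ideal.Quotient.lift J π hJ0)
    (Ideal.Quotient.lift_surjective_of_surjective _ _ hπ) (by
      intro z hz
      obtain ⟨y, rfl⟩ := Ideal.Quotient.mk_surjective z
      have hy : y ∈ RingHom.ker π := by
        rwa [RingHom.mem_ker, Ideal.Quotient.lift_mk] at hz
      obtain ⟨a, ha, b, hb, rfl⟩ := Submodule.mem_sup.mp (hle hy)
      rw [map_add, Ideal.Quotient.eq_zero_iff_mem.mpr ha, zero_add, ← hmm, ← Ideal.map_pow, pow_two]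
      exact Ideal.mem_map_of_mem _ (Ideal.mul_mono_right hN hb))
  have hxJ : x ∈ J := by
    rw [← Ideal.Quotient.eq_zero_iff_mem]
    apply hinj
    rw [Ideal.Quotient.lift_mk, map_zero]
    exact hx
  obtain ⟨c, hc⟩ : ∃ c : Fin n → P, (∀ i ∉ S, c i = 0) ∧ ∑ i, c i * g i = x := by
    have : (g '' (S : Set (Fin n))) = (S.image g : Set P) := by simp
    refine Submodule.span_induction (p := fun x _ => ∃ c : Fin n → P, (∀ i ∉ S, c i = 0) ∧
      ∑ i, c i * g i = x) ?_ ⟨0, by simp⟩ ?_ ?_ hxJ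
    · rintro _ ⟨i, hi, rfl⟩
      refine ⟨Pi.single i 1, fun j hj => Pi.single_eq_of_ne (fun h : j = i => hj (h.symm ▸ hi)) _, ?_⟩
      simp [Pi.single_apply]
    · rintro _ _ _ _ ⟨c, hc, rfl⟩ ⟨c', hc', rfl⟩
      exact ⟨c + c', fun i hi => by simp [hc i hi, hc' i hi], by
        simp [add_mul, Finset.sum_add_distrib]⟩
    · rintro a _ _ ⟨c, hc, rfl⟩
      exact ⟨a • c, fun i hi => by simp [hc i hi], by simp [Finset.mul_sum, mul_assoc]⟩
  have hcm := hgi c (hc.2 ▸ hxN)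
  rw [← hc.2]
  refine Ideal.sum_mem _ fun i _ => ?_
  by_cases hi : i ∈ S
  · exact Ideal.mul_mem_mul (hcm i) (hS i hi)
  · rw [hc.1 i hi, zero_mul]; exact zero_mem _

open KaehlerDifferential TensorProduct in
-- Jacobian criterion over the residue field `κ`: the map from `I ⊗ κ` to `Ω ⊗ κ` has to be
-- injective. The derivations dual to `dX_i` read off, modulo `𝔪`, the coefficients of an element of
-- `I` on the `X_i`; if its differential vanishes these lie in `𝔪`, and `mem_mul_ker_of_mem_mul`
-- applies.
theorem formallySmooth_of_parameters {O P A : Type*} [CommRing O] [CommRing P] [IsLocalRing P]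
    [IsNoetherianRing P] [CommRing A] [IsRegularLocalRing A] [Algebra O P] [Algebra O A]
    [Algebra P A] [IsScalarTower O P A] [Algebra.FormallySmooth O P]
    (hπ : Function.Surjective (algebraMap P A)) {n : ℕ} (X : Fin n → P)
    (b : Module.Basis (Fin n) P Ω[P⁄O]) (hb : ∀ i, b i = D O P (X i))
    (hN : Ideal.span (Set.range X) ≤ maximalIdeal P)
    (hIN : RingHom.ker (algebraMap P A) ≤ Ideal.span (Set.range X)) :
    Algebra.FormallySmooth O A := by
  let der : Fin n → Derivation O P P := fun i => (b.coord i).compDer (D O P)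
  have der_X : ∀ i j, der i (X j) = if j = i then 1 else 0 := fun i j => by
    simp [der, ← hb, Finsupp.single_apply]
  have der_sum : ∀ i (c : Fin n → P), der i (∑ j, c j * X j) =
      c i + ∑ j, X j * der i (c j) := fun i c => by
    simp [map_sum, Derivation.leibniz, der_X, Finset.sum_add_distrib]
  have hXm : ∀ j, X j ∈ maximalIdeal P := fun j => hN (Ideal.subset_span ⟨j, rfl⟩)
  have der_mem : ∀ i (c : Fin n → P), der i (∑ j, c j * X j) - c i ∈ maximalIdeal P := by
    intro i c
    rw [der_sum, add_sub_cancel_left]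
    exact Ideal.sum_mem _ fun j _ => Ideal.mul_mem_right _ _ (hXm j)
  have hind : ∀ c : Fin n → P, ∑ i, c i * X i ∈ maximalIdeal P * Ideal.span (Set.range X) →
      ∀ i, c i ∈ maximalIdeal P := by
    intro c hc i
    have h1 : der i (∑ i, c i * X i) ∈ maximalIdeal P := by
      refine Submodule.mul_induction_on hc (fun m hm x hx => ?_) (fun x y hx hy => ?_)
      · rw [Derivation.leibniz]
        exact Ideal.add_mem _ (Ideal.mul_mem_right _ _ hm) (Ideal.mul_mem_right _ _ (hN hx))
      · rw [map_add]; exact Ideal.add_mem _ hx hy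
    simpa using Ideal.sub_mem _ h1 (der_mem i c)
  have : Module.Free P Ω[P⁄O] := .of_basis b
  have : Module.Finite P Ω[P⁄O] := .of_basis b
  have hπl : IsLocalHom (algebraMap P A) := IsLocalHom.of_surjective _ hπ
  rw [Algebra.FormallySmooth.iff_injective_cotangentComplexBaseChange (R := O) (S := A) P
    (ResidueField A) hπ (IsNoetherian.noetherian _) (by
      intro x hx
      rw [RingHom.mem_ker, ResidueField.algebraMap_eq]
      exact (residue_eq_zero_iff x).mpr hx)]
  have hsurj : Function.Surjective (algebraMap P (ResidueField A)) := by
    rw [IsScalarTower.algebraMap_eq P A]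
    exact (residue_surjective).comp hπ
  have hres : ∀ x : P, algebraMap P (ResidueField A) x = 0 ↔ x ∈ maximalIdeal P := fun x => by
    rw [IsScalarTower.algebraMap_apply P A, ResidueField.algebraMap_eq, residue_eq_zero_iff,
      mem_maximalIdeal, mem_maximalIdeal, mem_nonunits_iff, mem_nonunits_iff,
      isUnit_map_iff]
  rw [injective_iff_map_eq_zero]
  intro z hz
  obtain ⟨x, rfl⟩ : ∃ x : RingHom.ker (algebraMap P A), z = 1 ⊗ₜ x := by
    clear hz
    induction z with
    | zero => exact ⟨0, by simp⟩
    | tmul a x =>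
      obtain ⟨p, rfl⟩ := hsurj a
      exact ⟨p • x, by rw [Algebra.algebraMap_eq_smul_one, smul_tmul]⟩
    | add x y hx hy =>
      obtain ⟨x, rfl⟩ := hx
      obtain ⟨y, rfl⟩ := hy
      exact ⟨x + y, by rw [tmul_add]⟩
  have hx : 1 ⊗ₜ[P] D O P x.1 = (0 : ResidueField A ⊗[P] Ω[P⁄O]) := by
    simpa [cotangentComplexBaseChange_tmul] using hz
  have hcoord : ∀ i, der i x.1 ∈ maximalIdeal P := by
    intro i
    rw [← hres]
    have := congrArg (fun w => (b.baseChange (ResidueField A)).repr w i) hx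
    simpa [Algebra.smul_def, der] using this
  obtain ⟨c, hc⟩ := (Submodule.mem_span_range_iff_exists_fun P).mp (hIN x.2)
  simp only [smul_eq_mul] at hc
  have hcm : ∀ i, c i ∈ maximalIdeal P := fun i =>
    by simpa using Ideal.sub_mem _ (hc.symm ▸ hcoord i : der i (∑ j, c j * X j) ∈ _) (der_mem i c)
  have key := mem_mul_ker_of_mem_mul (algebraMap P A) hπ hN hIN X rfl hind x.2 (by
    rw [← hc]
    exact Ideal.sum_mem _ fun i _ => Ideal.mul_mem_mul (hcm i) (Ideal.subset_span ⟨i, rfl⟩))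
  obtain ⟨_, h0⟩ : ∃ h : x.1 ∈ RingHom.ker (algebraMap P A),
      (1 : ResidueField A) ⊗ₜ[P] (⟨x.1, h⟩ : RingHom.ker (algebraMap P A)) = 0 := by
    refine Submodule.mul_induction_on key (fun r hr y hy => ⟨Ideal.mul_mem_left _ _ hy, ?_⟩)
      (fun y z ⟨hy, hy'⟩ ⟨hz, hz'⟩ => ⟨Ideal.add_mem _ hy hz, ?_⟩)
    · change (1 : ResidueField A) ⊗ₜ[P] (r • (⟨y, hy⟩ : RingHom.ker (algebraMap P A))) = 0
      rw [← smul_tmul, ← Algebra.algebraMap_eq_smul_one, (hres r).mpr hr, zero_tmul]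
    · have : (⟨y + z, Ideal.add_mem _ hy hz⟩ : RingHom.ker (algebraMap P A)) =
        ⟨y, hy⟩ + ⟨z, hz⟩ := rfl
      rw [this, tmul_add, hy', hz', add_zero]
  exact h0

open KaehlerDifferential in
/-- A regular local algebra, essentially of finite type over `O` and having an `O`-rational point, is
formally smooth over `O`. -/
theorem formallySmooth_of_section {O B A : Type*} [CommRing O] [IsNoetherianRing O] [IsLocalRing O]
    [CommRing B] [CommRing A] [Algebra O B] [Algebra.FiniteType O B] [Algebra O A] [Algebra B A]
    [IsScalarTower O B A] [IsRegularLocalRing A] (q : Ideal B) [q.IsPrime]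
    [IsLocalization.AtPrime A q] (σ : A →ₐ[O] O) : Algebra.FormallySmooth O A := by
  obtain ⟨n, g, hg⟩ := Algebra.FiniteType.iff_quotient_mvPolynomial''.mp ‹Algebra.FiniteType O B›
  -- The generators are translated by their values at the rational point, so that the section
  -- becomes evaluation at the origin of affine space.
  let w : Fin n → B := fun i => g (.X i) - algebraMap O B (σ (algebraMap B A (g (.X i))))
  let h : MvPolynomial (Fin n) O →ₐ[O] B := MvPolynomial.aeval w
  have hh : Function.Surjective h := by
    intro y
    obtain ⟨p, rfl⟩ := hg y
    have : g = h.comp (MvPolynomial.aeval fun i =>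
        .X i + .C (σ (algebraMap B A (g (.X i))))) := by
      ext i
      simp [h, w]
    rw [this]
    exact ⟨_, rfl⟩
  have hσX : ∀ p, σ (algebraMap B A (h p)) = MvPolynomial.constantCoeff p := by
    intro p
    have : (σ.comp ((IsScalarTower.toAlgHom O B A).comp h)) =
      (MvPolynomial.aeval (fun _ => (0 : O))) := by
      ext i
      simp only [AlgHom.comp_apply, IsScalarTower.coe_toAlgHom', h, w, MvPolynomial.aeval_X,
        map_sub, AlgHom.commutes, Algebra.algebraMap_self_apply,
        sub_self]
    have h2 := DFunLike.congr_fun this p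
    simp only [AlgHom.comp_apply, IsScalarTower.coe_toAlgHom'] at h2
    rw [h2, MvPolynomial.aeval_def, Algebra.algebraMap_self]
    exact DFunLike.congr_fun (MvPolynomial.eval₂Hom_zero' (RingHom.id O)) p
  let p := q.comap (h : MvPolynomial (Fin n) O →+* B)
  let P := Localization.AtPrime p
  have hunit : ∀ y : p.primeCompl,
      IsUnit (((algebraMap B A).comp (h : MvPolynomial (Fin n) O →+* B)) y.1) := fun y =>
    IsLocalization.map_units A (⟨h y, y.2⟩ : q.primeCompl)
  let π : P →+* A := IsLocalization.lift hunit
  have hπ' : ∀ x, π (algebraMap _ P x) = algebraMap B A (h x) := fun x =>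
    IsLocalization.lift_eq hunit x
  let _ : Algebra P A := π.toAlgebra
  have : IsScalarTower O P A := .of_algebraMap_eq fun x => by
    rw [IsScalarTower.algebraMap_apply O (MvPolynomial (Fin n) O) P]
    change _ = π _
    rw [hπ', AlgHom.commutes, ← IsScalarTower.algebraMap_apply]
  have hsurj : Function.Surjective (algebraMap P A) := by
    intro a
    obtain ⟨⟨x, s⟩, rfl⟩ := IsLocalization.mk'_surjective q.primeCompl a
    obtain ⟨x, rfl⟩ := hh x
    obtain ⟨s', hs'⟩ := hh s
    refine ⟨IsLocalization.mk' P x (⟨s', fun h' => s.2 (hs' ▸ h')⟩ : p.primeCompl), ?_⟩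
    change π _ = _
    rw [IsLocalization.lift_mk'_spec, RingHom.comp_apply, RingHom.comp_apply]
    change algebraMap B A (h x) = algebraMap B A (h s') * _
    rw [hs', mul_comm, IsLocalization.mk'_spec]
  have : Algebra.FormallySmooth (MvPolynomial (Fin n) O) P := .of_isLocalization p.primeCompl
  have : Algebra.FormallySmooth O P := .comp O (MvPolynomial (Fin n) O) P
  let X : Fin n → P := fun i => algebraMap (MvPolynomial (Fin n) O) P (MvPolynomial.X i)
  let b := (mvPolynomialBasis O (Fin n)).ofIsLocalizedModule P p.primeCompl
    (map O O (MvPolynomial (Fin n) O) P)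
  have hσπ : ∀ y, σ (π (algebraMap _ P y)) = MvPolynomial.constantCoeff y := fun y => by
    rw [hπ', hσX]
  have hσl : IsLocalHom (σ : A →+* O) := .of_surjective _ fun x => ⟨algebraMap O A x, σ.commutes x⟩
  -- A numerator of `y` has zero constant term, so it lies in the ideal of the variables.
  have hX : ∀ y, σ (π y) = 0 → y ∈ Ideal.span (Set.range X) := by
    intro y hy
    obtain ⟨⟨y, s⟩, rfl⟩ := IsLocalization.mk'_surjective p.primeCompl y
    have h1 : MvPolynomial.constantCoeff y = 0 := by
      rw [← hσπ, ← IsLocalization.mk'_spec P y s, map_mul, map_mul, hy, zero_mul]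
    have h2 : y ∈ Ideal.span (Set.range (MvPolynomial.X : Fin n → MvPolynomial (Fin n) O)) := by
      rw [← Set.image_univ, MvPolynomial.mem_ideal_span_X_image]
      intro m hm
      by_contra! hcon
      have : m = 0 := by ext i; exact hcon i (Set.mem_univ i)
      rw [this, MvPolynomial.mem_support_iff] at hm
      exact hm h1
    dsimp only
    rw [IsLocalization.mk'_eq_mul_mk'_one]
    refine Ideal.mul_mem_right _ _ ?_
    have h3 := Ideal.mem_map_of_mem (algebraMap _ P) h2
    rwa [Ideal.map_span, ← Set.range_comp] at h3
  refine formallySmooth_of_parameters hsurj X b (fun i => ?_) ?_ ?_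
  · rw [Module.Basis.ofIsLocalizedModule_apply, mvPolynomialBasis_apply, map_D]
  · rw [Ideal.span_le]
    rintro _ ⟨i, rfl⟩
    rw [SetLike.mem_coe, mem_maximalIdeal, mem_nonunits_iff]
    intro hu
    have := (hu.map π).map σ
    rw [hσπ, MvPolynomial.constantCoeff_X] at this
    exact not_isUnit_zero this
  · intro y hy
    refine hX y ?_
    rw [show π y = 0 from hy, map_zero]

end SmoothOfSection

/-! ### Étale coordinates and bases of the module of differentials. -/

section Kaehler

open IsLocalRing KaehlerDifferential TensorProduct

/-- The basis makes `A ⊗ Ω_{O[T]/O} → Ω_{A/O}` an isomorphism. In the Jacobi–Zariski sequence its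
surjectivity kills `Ω_{A/O[T]}`; its injectivity, with the vanishing of `H₁` for the smooth algebra
`A` over `O`, kills `H₁` over `O[T]`. -/
theorem formallyEtale_of_kaehler_basis {O A ι : Type*} [CommRing O] [CommRing A] [Algebra O A]
    [Algebra.FormallySmooth O A] (τ : ι → A) (b : Module.Basis ι A Ω[A⁄O])
    (hb : ∀ i, b i = D O A (τ i)) :
    (MvPolynomial.aeval τ : MvPolynomial ι O →ₐ[O] A).toRingHom.FormallyEtale := by
  algebraize [(MvPolynomial.aeval τ : MvPolynomial ι O →ₐ[O] A).toRingHom]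
  have : IsScalarTower O (MvPolynomial ι O) A := .of_algebraMap_eq fun x =>
    ((MvPolynomial.aeval τ : MvPolynomial ι O →ₐ[O] A).commutes x).symm
  change Algebra.FormallyEtale _ _
  have hbij : Function.Bijective (mapBaseChange O (MvPolynomial ι O) A) := by
    let e := ((mvPolynomialBasis O ι).baseChange A).equiv b (Equiv.refl ι)
    have he : (e : A ⊗[MvPolynomial ι O] Ω[MvPolynomial ι O⁄O] →ₗ[A] Ω[A⁄O]) =
        mapBaseChange O (MvPolynomial ι O) A := by
      refine ((mvPolynomialBasis O ι).baseChange A).ext fun i => ?_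
      rw [LinearEquiv.coe_coe, Module.Basis.equiv_apply, Module.Basis.baseChange_apply,
        mapBaseChange_tmul, one_smul, mvPolynomialBasis_apply, map_D, Equiv.refl_apply, hb]
      congr 1
      exact (MvPolynomial.aeval_X τ i).symm
    rw [← he]
    exact e.bijective
  rw [Algebra.formallyEtale_iff]
  constructor
  · refine ⟨fun x y => ?_⟩
    have : ∀ x : Ω[A⁄MvPolynomial ι O], x = 0 := fun x => by
      obtain ⟨y, rfl⟩ := KaehlerDifferential.map_surjective O (MvPolynomial ι O) A x
      obtain ⟨z, rfl⟩ := hbij.2 y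
      exact (exact_mapBaseChange_map O (MvPolynomial ι O) A _).mpr ⟨z, rfl⟩
    rw [this x, this y]
  · refine ⟨fun x y => ?_⟩
    have : ∀ x : Algebra.H1Cotangent (MvPolynomial ι O) A, x = 0 := fun x => by
      have h1 : Algebra.H1Cotangent.δ O (MvPolynomial ι O) A x = 0 := hbij.1 (by
        rw [map_zero]
        exact (Algebra.H1Cotangent.exact_δ_mapBaseChange O (MvPolynomial ι O) A _).mpr ⟨x, rfl⟩)
      obtain ⟨y, rfl⟩ := (Algebra.H1Cotangent.exact_map_δ O (MvPolynomial ι O) A x).mp h1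
      rw [Subsingleton.elim y 0, map_zero]
    rw [this x, this y]

theorem exists_kaehler_basis_of_formallyEtale {O A ι : Type*} [CommRing O] [CommRing A]
    [Algebra O A] (τ : ι → A)
    (h : (MvPolynomial.aeval τ : MvPolynomial ι O →ₐ[O] A).toRingHom.FormallyEtale) :
    ∃ b : Module.Basis ι A Ω[A⁄O], ∀ i, b i = D O A (τ i) := by
  algebraize [(MvPolynomial.aeval τ : MvPolynomial ι O →ₐ[O] A).toRingHom]
  have : IsScalarTower O (MvPolynomial ι O) A := .of_algebraMap_eq fun x =>
    ((MvPolynomial.aeval τ : MvPolynomial ι O →ₐ[O] A).commutes x).symm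
  have : Algebra.FormallyEtale (MvPolynomial ι O) A := h
  refine ⟨((mvPolynomialBasis O ι).baseChange A).map
    (tensorKaehlerEquivOfFormallyEtale O (MvPolynomial ι O) A), fun i => ?_⟩
  rw [Module.Basis.map_apply, Module.Basis.baseChange_apply,
    tensorKaehlerEquivOfFormallyEtale_apply, mapBaseChange_tmul, one_smul,
    mvPolynomialBasis_apply, map_D]
  congr 1
  exact MvPolynomial.aeval_X τ i

/-- By `hk` every element is a constant plus a combination of the `t i`, so modulo `𝔪Ω` its
differential is a combination of the `D (t i)`. The term `D (t 0)` vanishes since `t 0` is a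
constant. Nakayama concludes. -/
theorem span_kaehler_eq_top {O A : Type*} [CommRing O] [CommRing A] [IsLocalRing A] [Algebra O A]
    [Module.Finite A Ω[A⁄O]] (hk : ∀ a : A, ∃ o : O, a - algebraMap O A o ∈ maximalIdeal A)
    {d : ℕ} (t : Fin (d + 1) → A) {ϖ : O} (h0 : t 0 = algebraMap O A ϖ)
    (ht : Ideal.span (Set.range t) = maximalIdeal A) :
    Submodule.span A (Set.range fun i : Fin d => D O A (t i.succ)) = ⊤ := by
  set N := Submodule.span A (Set.range fun i : Fin d => D O A (t i.succ))
  have hDt : ∀ i, D O A (t i) ∈ N := by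
    refine Fin.cases ?_ fun i => Submodule.subset_span ⟨i, rfl⟩
    rw [h0, Derivation.map_algebraMap]; exact zero_mem _
  have hD : ∀ a, D O A a ∈ N ⊔ maximalIdeal A • (⊤ : Submodule A Ω[A⁄O]) := by
    intro a
    obtain ⟨o, ho⟩ := hk a
    rw [← sub_add_cancel a (algebraMap O A o), map_add, Derivation.map_algebraMap, add_zero]
    obtain ⟨c, hc⟩ := (Submodule.mem_span_range_iff_exists_fun A).mp (ht.symm ▸ ho)
    rw [← hc, map_sum]
    refine Submodule.sum_mem _ fun i _ => ?_
    rw [smul_eq_mul, Derivation.leibniz]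
    refine Submodule.add_mem _ (Submodule.mem_sup_left (Submodule.smul_mem _ _ (hDt i)))
      (Submodule.mem_sup_right (Submodule.smul_mem_smul ?_ trivial))
    exact ht ▸ Ideal.subset_span ⟨i, rfl⟩
  refine top_le_iff.mp (Submodule.le_of_le_smul_of_le_jacobson_bot (I := maximalIdeal A)
    Module.Finite.fg_top (by rw [jacobson_eq_maximalIdeal _ bot_ne_top]) ?_)
  rw [← span_range_derivation O A, Submodule.span_le]
  rintro _ ⟨a, rfl⟩
  rw [span_range_derivation]
  exact hD a

end Kaehler

/-! ### Sections of étale-coordinatized algebras: congruence, Hensel lifting, Taylor expansion. -/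

section Lifting

open IsLocalRing KaehlerDifferential

variable {O A : Type*} [CommRing O] [IsLocalRing O] [CommRing A] [IsLocalRing A] [Algebra O A]

/-- If `σ a` were a unit, it would be the image of a unit `o` of `O`, and `a - o` would be a unit
killed by `σ`. -/
theorem algHom_mem_maximalIdeal {R : Type*} [CommRing R] [IsLocalRing R] [Algebra O R]
    (hR : Function.Surjective (algebraMap O R)) (σ : A →ₐ[O] R) {a : A}
    (ha : a ∈ maximalIdeal A) : σ a ∈ maximalIdeal R := by
  by_contra h
  have hu : IsUnit (σ a) := by simpa [mem_maximalIdeal] using h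
  obtain ⟨o, ho⟩ := hR (σ a)
  have hou : IsUnit o := by
    have : IsLocalHom (algebraMap O R) := .of_surjective _ hR
    rw [← ho] at hu
    exact isUnit_of_map_unit _ _ hu
  have h1 : a - algebraMap O A o ∉ maximalIdeal A := fun h' => by
    have := Ideal.sub_mem _ ha h'
    rw [sub_sub_cancel] at this
    exact this (hou.map _)
  have h2 : IsUnit (a - algebraMap O A o) := by simpa [mem_maximalIdeal] using h1
  have h3 := h2.map σ
  rw [map_sub, AlgHom.commutes, ho, sub_self] at h3
  exact not_isUnit_zero h3

theorem sub_algebraMap_mem_of_algHom (σ : A →ₐ[O] O) (a : A) :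
    a - algebraMap O A (σ a) ∈ maximalIdeal A := by
  by_contra h
  have h2 : IsUnit (a - algebraMap O A (σ a)) := by simpa [mem_maximalIdeal] using h
  have h3 := h2.map σ
  rw [map_sub, AlgHom.commutes, Algebra.algebraMap_self_apply, sub_self] at h3
  exact not_isUnit_zero h3

theorem algHom_mem {σ : A →ₐ[O] O} {a : A} (ha : a ∈ maximalIdeal A) : σ a ∈ maximalIdeal O :=
  algHom_mem_maximalIdeal Function.surjective_id σ ha

theorem algHom_sub_mem (σ σ' : A →ₐ[O] O) (a : A) : σ a - σ' a ∈ maximalIdeal O := by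
  have := algHom_mem (σ := σ) (sub_algebraMap_mem_of_algHom σ' a)
  rwa [map_sub, AlgHom.commutes] at this

variable {ι : Type*} {τ : ι → A}

/-- Two sections always agree modulo `𝔪`, which is nilpotent modulo `𝔪ⁿ`. If they also agree on the
coordinates modulo `𝔪ⁿ`, unramifiedness over the polynomial ring makes the reductions modulo `𝔪ⁿ`
equal. -/
theorem algHom_sub_mem_pow
    (h : (MvPolynomial.aeval τ : MvPolynomial ι O →ₐ[O] A).toRingHom.FormallyEtale)
    (σ σ' : A →ₐ[O] O) (n : ℕ) (hn : ∀ i, σ (τ i) - σ' (τ i) ∈ maximalIdeal O ^ n) (a : A) :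
    σ a - σ' a ∈ maximalIdeal O ^ n := by
  rcases Nat.eq_zero_or_pos n with rfl | hpos
  · simp
  algebraize [(MvPolynomial.aeval τ : MvPolynomial ι O →ₐ[O] A).toRingHom]
  have : Algebra.FormallyEtale (MvPolynomial ι O) A := h
  let mk := Ideal.Quotient.mkₐ O (maximalIdeal O ^ n)
  let _ : Algebra (MvPolynomial ι O) (O ⧸ maximalIdeal O ^ n) :=
    (MvPolynomial.aeval (fun i => mk (σ (τ i)))).toRingHom.toAlgebra
  have hcomm : ∀ ρ : A →ₐ[O] O, (∀ i, mk (ρ (τ i)) = mk (σ (τ i))) → ∀ p : MvPolynomial ι O,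
      mk (ρ (MvPolynomial.aeval τ p)) = MvPolynomial.aeval (fun i => mk (σ (τ i))) p := by
    intro ρ hρ p
    have : (mk.comp ρ).comp (MvPolynomial.aeval τ) = MvPolynomial.aeval (fun i => mk (σ (τ i))) := by
      ext i; simp [hρ]
    exact DFunLike.congr_fun this p
  let g₁ : A →ₐ[MvPolynomial ι O] O ⧸ maximalIdeal O ^ n :=
    { (mk.comp σ).toRingHom with commutes' := hcomm σ fun _ => rfl }
  let g₂ : A →ₐ[MvPolynomial ι O] O ⧸ maximalIdeal O ^ n :=
    { (mk.comp σ').toRingHom with commutes' := hcomm σ' fun i =>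
        (Ideal.Quotient.eq.mpr (hn i)).symm }
  have hI : IsNilpotent ((maximalIdeal O).map (Ideal.Quotient.mk (maximalIdeal O ^ n))) :=
    ⟨n, by rw [← Ideal.map_pow, Ideal.map_quotient_self]; rfl⟩
  have heq : g₁ = g₂ := Algebra.FormallyUnramified.ext _ hI fun x => by
    rw [Ideal.Quotient.eq]
    change mk (σ x) - mk (σ' x) ∈ _
    rw [← map_sub]
    exact Ideal.mem_map_of_mem _ (algHom_sub_mem σ σ' x)
  exact Ideal.Quotient.eq.mp (DFunLike.congr_fun heq a)

/-- Krull's intersection theorem turns congruence modulo every `𝔪ⁿ` into equality. -/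
theorem algHom_eq_of_eq [IsNoetherianRing O]
    (h : (MvPolynomial.aeval τ : MvPolynomial ι O →ₐ[O] A).toRingHom.FormallyEtale)
    {σ σ' : A →ₐ[O] O} (hσ : ∀ i, σ (τ i) = σ' (τ i)) : σ = σ' := by
  ext a
  rw [← sub_eq_zero, ← Ideal.mem_bot, ← Ideal.iInf_pow_eq_bot_of_isLocalRing (maximalIdeal O)
    (maximalIdeal.isMaximal O).ne_top, Ideal.mem_iInf]
  exact fun n => algHom_sub_mem_pow h σ σ' n (fun i => by rw [hσ, sub_self]; exact zero_mem _) a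

/-- Hensel's lemma as infinitesimal lifting. Let `O[T]` act on `O` through `T ↦ a`. As `τ` and `a`
both reduce to zero, `ρ` is linear over `O[T]`, and formal smoothness over `O[T]` lifts it along the
complete ring `O`. -/
theorem exists_algHom_eq [IsAdicComplete (maximalIdeal O) O]
    (h : (MvPolynomial.aeval τ : MvPolynomial ι O →ₐ[O] A).toRingHom.FormallyEtale)
    (ρ : A →ₐ[O] ResidueField O) (hτ : ∀ i, τ i ∈ maximalIdeal A)
    (a : ι → O) (ha : ∀ i, a i ∈ maximalIdeal O) : ∃ σ : A →ₐ[O] O, ∀ i, σ (τ i) = a i := by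
  algebraize [(MvPolynomial.aeval τ : MvPolynomial ι O →ₐ[O] A).toRingHom,
    (MvPolynomial.aeval a : MvPolynomial ι O →ₐ[O] O).toRingHom]
  have : Algebra.FormallyEtale (MvPolynomial ι O) A := h
  let ρ' : A →ₐ[O] O ⧸ maximalIdeal O := ρ
  have hρ : ∀ i, ρ' (τ i) = 0 := fun i => by
    have := algHom_mem_maximalIdeal (Ideal.Quotient.mk_surjective) ρ (hτ i)
    rwa [maximalIdeal_eq_bot, Ideal.mem_bot] at this
  have hcomm : ∀ p : MvPolynomial ι O, ρ' (MvPolynomial.aeval τ p) =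
      Ideal.Quotient.mk (maximalIdeal O) (MvPolynomial.aeval a p) := by
    intro p
    have : ρ'.comp (MvPolynomial.aeval τ) =
        (Ideal.Quotient.mkₐ O (maximalIdeal O)).comp (MvPolynomial.aeval a) := by
      ext i
      simp only [AlgHom.comp_apply, MvPolynomial.aeval_X, hρ]
      exact (Ideal.Quotient.eq_zero_iff_mem.mpr (ha i)).symm
    exact DFunLike.congr_fun this p
  let g : A →ₐ[MvPolynomial ι O] O ⧸ maximalIdeal O :=
    { ρ'.toRingHom with commutes' := hcomm }
  obtain ⟨σ, -⟩ := Algebra.FormallySmooth.exists_mkₐ_comp_eq_of_isAdicComplete g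
  have hσ : ∀ p : MvPolynomial ι O, σ (MvPolynomial.aeval τ p) = MvPolynomial.aeval a p :=
    fun p => σ.commutes p
  refine ⟨{ σ.toRingHom with commutes' := fun r => ?_ }, fun i => ?_⟩
  · have := hσ (.C r)
    rwa [MvPolynomial.aeval_C, MvPolynomial.aeval_C] at this
  · have := hσ (.X i)
    rwa [MvPolynomial.aeval_X, MvPolynomial.aeval_X] at this

/-- First order Taylor expansion. -/
theorem algHom_taylor [Fintype ι] (σ σ' : A →ₐ[O] O) (n : ℕ)
    (hn : ∀ a, σ a - σ' a ∈ maximalIdeal O ^ n) {g : A} {J : ι → A}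
    (hg : D O A g = ∑ j, J j • D O A (τ j)) :
    σ g - σ' g - ∑ j, σ' (J j) * (σ (τ j) - σ' (τ j)) ∈ maximalIdeal O ^ (2 * n) := by
  set B := O ⧸ maximalIdeal O ^ (2 * n)
  let mk := Ideal.Quotient.mkₐ O (maximalIdeal O ^ (2 * n))
  let I : Ideal B := (maximalIdeal O ^ n).map (Ideal.Quotient.mk (maximalIdeal O ^ (2 * n)))
  have hI : I ^ 2 = ⊥ := by
    rw [← Ideal.map_pow, ← pow_mul, mul_comm n 2, Ideal.map_quotient_self]
  algebraize [(mk.comp σ').toRingHom]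
  have : IsScalarTower O A B := .of_algebraMap_eq fun x => ((mk.comp σ').commutes x).symm
  -- Modulo `𝔪²ⁿ` the two sections differ by values in the square-zero ideal `𝔪ⁿ`, so the difference
  -- is a derivation and factors through `Ω`.
  let δ : Derivation O A I := derivationToSquareZeroOfLift I hI (mk.comp σ) (by
    ext a
    refine Ideal.Quotient.eq.mpr ?_
    change mk (σ a) - mk (σ' a) ∈ _
    rw [← map_sub]
    exact Ideal.mem_map_of_mem _ (hn a))
  have hδ : ∀ a, (δ a : B) = mk (σ a) - mk (σ' a) := fun a => rfl
  have h1 : δ g = ∑ j, J j • δ (τ j) := by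
    have := congrArg δ.liftKaehlerDifferential hg
    simpa using this
  have h2 := congrArg (Subtype.val) h1
  rw [hδ, Submodule.coe_sum] at h2
  apply Ideal.Quotient.eq_zero_iff_mem.mp
  change mk _ = 0
  rw [map_sub, map_sub, h2, map_sum, sub_eq_zero]
  refine Finset.sum_congr rfl fun j _ => ?_
  rw [map_mul, map_sub]
  rfl

end Lifting

/-! ### Independence of the parameters modulo the square of the maximal ideal. -/

section RegularParameters

open IsLocalRing KaehlerDifferential

variable {O A : Type*} [CommRing O] [IsDomain O] [IsLocalRing O] [CommRing A]
  [IsRegularLocalRing A] [Algebra O A]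

/-- The derivations dual to `b` map `𝔪²` into `𝔪` and detect the coefficients of `t₁, …, t_d`. For
the coefficient of `t 0 = ϖ`, which they do not see, the section `σ` is used: `ϖ ∈ 𝔪_A²` would give
`ϖ ∈ 𝔪_O²`. -/
theorem coeff_mem_of_sum_mem_sq {d : ℕ} (t : Fin (d + 1) → A) {ϖ : O}
    (hϖ : maximalIdeal O = Ideal.span {ϖ}) (hϖ0 : ϖ ≠ 0) (h0 : t 0 = algebraMap O A ϖ)
    (ht : Ideal.span (Set.range t) = maximalIdeal A)
    (b : Module.Basis (Fin d) A Ω[A⁄O]) (hb : ∀ i, b i = D O A (t i.succ))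
    (σ : A →ₐ[O] O) (c : Fin (d + 1) → A) (hc : ∑ i, c i * t i ∈ maximalIdeal A ^ 2) (i) :
    c i ∈ maximalIdeal A := by
  have htm : ∀ i, t i ∈ maximalIdeal A := fun i => ht ▸ Ideal.subset_span ⟨i, rfl⟩
  have hsucc : ∀ i : Fin d, c i.succ ∈ maximalIdeal A := by
    intro i
    let der : Derivation O A A := (b.coord i).compDer (D O A)
    have hder : ∀ j : Fin d, der (t j.succ) = if j = i then 1 else 0 := fun j => by
      simp [der, ← hb, Finsupp.single_apply]
    have hder0 : der (t 0) = 0 := by rw [h0, Derivation.map_algebraMap]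
    have h1 : der (∑ i, c i * t i) ∈ maximalIdeal A := by
      rw [pow_two] at hc
      refine Submodule.mul_induction_on hc (fun m hm x hx => ?_) (fun x y hx hy => ?_)
      · rw [Derivation.leibniz]
        exact Ideal.add_mem _ (Ideal.mul_mem_right _ _ hm) (Ideal.mul_mem_right _ _ hx)
      · rw [map_add]; exact Ideal.add_mem _ hx hy
    have h2 : der (∑ i, c i * t i) = c i.succ + ∑ j, t j * der (c j) := by
      rw [map_sum]
      simp only [Derivation.leibniz, smul_eq_mul, Finset.sum_add_distrib]
      rw [Fin.sum_univ_succ]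
      simp [hder, hder0]
    rw [h2] at h1
    exact (Ideal.add_mem_iff_left _
      (Ideal.sum_mem _ fun j _ => Ideal.mul_mem_right _ _ (htm j))).mp h1
  refine Fin.cases ?_ hsucc i
  by_contra hn
  have hu : IsUnit (c 0) := by simpa [mem_maximalIdeal] using hn
  have h3 : t 0 ∈ maximalIdeal A ^ 2 := by
    rw [← Ideal.unit_mul_mem_iff_mem _ hu]
    rw [Fin.sum_univ_succ] at hc
    refine (Ideal.add_mem_iff_left _ (Ideal.sum_mem _ fun j _ => ?_)).mp hc
    rw [pow_two]
    exact Ideal.mul_mem_mul (hsucc j) (htm _)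
  have h4 : σ (t 0) ∈ maximalIdeal O ^ 2 := by
    rw [pow_two] at h3 ⊢
    refine Submodule.mul_induction_on h3 (fun m hm x hx => ?_) (fun x y hx hy => ?_)
    · rw [map_mul]; exact Ideal.mul_mem_mul (algHom_mem hm) (algHom_mem hx)
    · rw [map_add]; exact Ideal.add_mem _ hx hy
  rw [h0, AlgHom.commutes, Algebra.algebraMap_self_apply, hϖ, Ideal.span_singleton_pow,
    Ideal.mem_span_singleton] at h4
  obtain ⟨e, he⟩ := h4
  have h5 : 1 = ϖ * e := mul_left_cancel₀ hϖ0 (by linear_combination he)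
  have h6 : ϖ ∈ maximalIdeal O := hϖ ▸ Ideal.mem_span_singleton_self ϖ
  exact (maximalIdeal.isMaximal O).ne_top
    ((Ideal.eq_top_iff_one _).mpr (h5 ▸ Ideal.mul_mem_right _ _ h6))

variable {d : ℕ} {t : Fin (d + 1) → A}

theorem notMem_sq_of_independent
    (hind : ∀ c : Fin (d + 1) → A, ∑ i, c i * t i ∈ maximalIdeal A ^ 2 →
      ∀ i, c i ∈ maximalIdeal A) (i) : t i ∉ maximalIdeal A ^ 2 := by
  intro h
  have := hind (Pi.single i 1) (by simpa [Pi.single_apply] using h) i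
  rw [Pi.single_eq_same] at this
  exact (maximalIdeal.isMaximal A).ne_top ((Ideal.eq_top_iff_one _).mpr this)

theorem notMem_span_of_independent
    (hind : ∀ c : Fin (d + 1) → A, ∑ i, c i * t i ∈ maximalIdeal A ^ 2 →
      ∀ i, c i ∈ maximalIdeal A) {i j : Fin (d + 1)} (hij : i ≠ j) : t j ∉ Ideal.span {t i} := by
  intro h
  obtain ⟨a, ha⟩ := Ideal.mem_span_singleton'.mp h
  have := hind (Pi.single j 1 + Pi.single i (-a)) (by
    have : ∑ l, (Pi.single j 1 + Pi.single i (-a) : Fin (d + 1) → A) l * t l = 0 := by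
      simp [Pi.single_apply, add_mul, Finset.sum_add_distrib, ha]
    rw [this]; exact zero_mem _) j
  rw [Pi.add_apply, Pi.single_eq_same, Pi.single_eq_of_ne hij.symm, add_zero] at this
  exact (maximalIdeal.isMaximal A).ne_top ((Ideal.eq_top_iff_one _).mpr this)

theorem ne_zero_of_independent
    (hind : ∀ c : Fin (d + 1) → A, ∑ i, c i * t i ∈ maximalIdeal A ^ 2 →
      ∀ i, c i ∈ maximalIdeal A) (i) : t i ≠ 0 :=
  fun h => notMem_sq_of_independent hind i (h ▸ zero_mem _)

end RegularParameters

/-! ### Adjunction: minors of the equations against the Jacobian of the coordinates. -/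

section Jacobian

open IsLocalRing KaehlerDifferential MvPolynomial TensorProduct

variable {O B A : Type*} [CommRing O] [CommRing B] [Algebra O B] [CommRing A] [Algebra O A]
  [Algebra B A] [IsScalarTower O B A]

/-- The differential of `F` at the point `A` of affine space, as a vector. -/
noncomputable def gradAt (A : Type*) [CommRing A] [Algebra B A] {ι : Type*} (gen : ι → B)
    (F : MvPolynomial ι O) (i : ι) : A :=
  algebraMap B A (aeval gen (pderiv i F))

variable {ι : Type*} [Fintype ι] {gen : ι → B}

theorem D_aeval_eq_sum (gen : ι → B) (F : MvPolynomial ι O) :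
    D O A (algebraMap B A (aeval gen F)) =
      ∑ i, gradAt A gen F i • D O A (algebraMap B A (gen i)) := by
  classical
  let g : MvPolynomial ι O →ₐ[O] A := (IsScalarTower.toAlgHom O B A).comp (aeval gen)
  algebraize [g.toRingHom]
  have : IsScalarTower O (MvPolynomial ι O) A := .of_algebraMap_eq fun x => (g.commutes x).symm
  have hg : ∀ p, algebraMap (MvPolynomial ι O) A p = algebraMap B A (aeval gen p) := fun _ => rfl
  have h1 := congrArg (KaehlerDifferential.map O O (MvPolynomial ι O) A)
    ((mvPolynomialBasis O ι).sum_repr (D O _ F))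
  rw [map_D, hg, _root_.map_sum] at h1
  rw [← h1]
  refine Finset.sum_congr rfl fun i _ => ?_
  rw [LinearMap.map_smul, mvPolynomialBasis_apply, map_D, mvPolynomialBasis_repr_apply, hg,
    aeval_X, ← algebraMap_smul A, hg]
  rfl

/-- Exactness of `I/I² → B ⊗ Ω_{O[T]} → Ω_B` for the kernel `I`. Denominators are cleared twice: by
`s` for the entries of `w`, by `s'` for the relation, which holds only in the localized
differentials. -/
theorem mem_span_gradAt (hgen : Function.Surjective (aeval gen : MvPolynomial ι O →ₐ[O] B))
    (M : Submonoid B) [IsLocalization M A] (w : ι → A)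
    (hw : ∑ i, w i • D O A (algebraMap B A (gen i)) = 0) :
    w ∈ Submodule.span A (Set.range fun F : RingHom.ker (aeval gen : MvPolynomial ι O →ₐ[O] B) =>
      gradAt A gen F.1) := by
  classical
  algebraize [(aeval gen : MvPolynomial ι O →ₐ[O] B).toRingHom]
  have : IsScalarTower O (MvPolynomial ι O) B := .of_algebraMap_eq fun x =>
    ((aeval gen : MvPolynomial ι O →ₐ[O] B).commutes x).symm
  -- clear denominators
  obtain ⟨s, hs⟩ := IsLocalization.exist_integer_multiples_of_finset M (Finset.univ.image w)
  have hs' : ∀ i, ∃ v : B, algebraMap B A v = algebraMap B A s * w i := fun i => by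
    obtain ⟨v, hv⟩ := hs (w i) (Finset.mem_image_of_mem _ (Finset.mem_univ i))
    exact ⟨v, by rw [hv, Algebra.smul_def]⟩
  choose v hv using hs'
  have h0 : KaehlerDifferential.map O O B A (∑ i, v i • D O B (gen i)) = 0 := by
    rw [_root_.map_sum]
    have : ∀ i, KaehlerDifferential.map O O B A (v i • D O B (gen i)) =
        algebraMap B A s • (w i • D O A (algebraMap B A (gen i))) := fun i => by
      rw [LinearMap.map_smul, map_D, ← smul_assoc, smul_eq_mul, ← hv, algebraMap_smul]
    simp_rw [this, ← Finset.smul_sum, hw, smul_zero]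
  obtain ⟨s', hs'⟩ := (IsLocalizedModule.eq_zero_iff M (KaehlerDifferential.map O O B A)).mp h0
  have h1 : mapBaseChange O (MvPolynomial ι O) B
      (∑ i, (s' * v i : B) ⊗ₜ D O (MvPolynomial ι O) (X i)) = 0 := by
    rw [_root_.map_sum, ← hs', Finset.smul_sum]
    refine Finset.sum_congr rfl fun i _ => ?_
    rw [mapBaseChange_tmul, map_D, mul_smul]
    have : algebraMap (MvPolynomial ι O) B (X i) = gen i := aeval_X gen i
    rw [this]; rfl
  obtain ⟨z, hz⟩ := (exact_kerCotangentToTensor_mapBaseChange O (MvPolynomial ι O) B hgen _).mp h1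
  obtain ⟨F, rfl⟩ := Ideal.toCotangent_surjective _ z
  have h2 : (1 : B) ⊗ₜ[MvPolynomial ι O] D O (MvPolynomial ι O) F.1 =
    ∑ i, (s' * v i : B) ⊗ₜ D O (MvPolynomial ι O) (X i) := hz
  have h3 : ∀ i, aeval gen (pderiv i F.1) = s' * v i := fun i => by
    have := congrArg (fun y => ((mvPolynomialBasis O ι).baseChange B).repr y i) h2
    have h5 : algebraMap (MvPolynomial ι O) B (pderiv i F.1) = s' * v i := by
      simpa [mvPolynomialBasis_repr_apply, Algebra.smul_def, Finsupp.single_apply] using this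
    exact h5
  have hF : F.1 ∈ RingHom.ker (aeval gen : MvPolynomial ι O →ₐ[O] B) := F.2
  have hu : IsUnit (algebraMap B A (s' * s)) := IsLocalization.map_units A (s' * s)
  have h4 : algebraMap B A (s' * s) • w = gradAt A gen F.1 := by
    ext i
    rw [gradAt, h3, Pi.smul_apply, map_mul, map_mul, hv, smul_eq_mul, mul_assoc]
  rw [← Submodule.smul_mem_iff_of_isUnit _ hu, h4]
  exact Submodule.subset_span ⟨⟨F.1, hF⟩, rfl⟩

open Matrix in
-- Multiply the square matrix with row blocks `G` and `T` by `E = (Z | R)`, where `Z` is an identity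
-- block above a zero block. Since `G R = 0` and `T R = 1`, the product is block triangular with
-- determinant that of the minor `G Z`, while `det E` is the Jacobian of the last `d` coordinates.
theorem det_gradAt {c d : ℕ} {gen : Fin c ⊕ Fin d → B} (τ : Fin d → A)
    (b : Module.Basis (Fin d) A Ω[A⁄O]) (hb : ∀ i, b i = D O A (τ i))
    (R : Matrix (Fin c ⊕ Fin d) (Fin d) A)
    (hR : ∀ i, D O A (algebraMap B A (gen i)) = ∑ j, R i j • D O A (τ j))
    (T : Matrix (Fin d) (Fin c ⊕ Fin d) A) (hT : T * R = 1)
    (F : Fin c → RingHom.ker (aeval gen : MvPolynomial (Fin c ⊕ Fin d) O →ₐ[O] B)) :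
    (of fun i j : Fin c => gradAt A gen (F i).1 (.inl j)).det =
      (fromRows (of fun i => gradAt A gen (F i).1) T).det *
        (of fun i j : Fin d => R (.inr i) j).det := by
  have hF : ∀ i, gradAt A gen (F i).1 ᵥ* R = 0 := by
    intro i
    have h1 := D_aeval_eq_sum (A := A) gen (F i).1
    rw [(RingHom.mem_ker).mp (F i).2, map_zero, map_zero] at h1
    simp_rw [hR, Finset.smul_sum] at h1
    rw [Finset.sum_comm] at h1
    simp_rw [← mul_smul, ← Finset.sum_smul, ← hb] at h1
    ext j
    have := (Fintype.linearIndependent_iff.mp b.linearIndependent) _ h1.symm j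
    simpa [Matrix.vecMul, dotProduct] using this
  let E : Matrix (Fin c ⊕ Fin d) (Fin c ⊕ Fin d) A :=
    fromBlocks 1 (of fun i j => R (.inl i) j) 0 (of fun i j => R (.inr i) j)
  have hE : E.det = (of fun i j : Fin d => R (.inr i) j).det := by
    rw [det_fromBlocks_zero₂₁, det_one, one_mul]
  let G : Matrix (Fin c) (Fin c ⊕ Fin d) A := of fun i => gradAt A gen (F i).1
  let Z : Matrix (Fin c ⊕ Fin d) (Fin c) A :=
    fromRows (1 : Matrix (Fin c) (Fin c) A) (0 : Matrix (Fin d) (Fin c) A)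
  have hE2 : E = fromCols Z R := by
    ext i j; rcases i with i | i <;> rcases j with j | j <;> rfl
  have hG : G * R = 0 := by
    ext i j; exact congrFun (hF i) j
  change _ = (fromRows G T).det * _
  rw [← hE, ← det_mul, hE2, mul_fromCols, fromRows_mul, fromRows_mul, hT, hG]
  have h2 : fromCols (fromRows (G * Z) (T * Z)) (fromRows (0 : Matrix (Fin c) (Fin d) A) 1) =
      fromBlocks (G * Z) 0 (T * Z) 1 := by
    ext i j; rcases i with i | i <;> rcases j with j | j <;> rfl
  rw [h2, det_fromBlocks_zero₁₂, det_one, mul_one]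
  congr 1
  ext i j
  simp [Matrix.mul_apply, Fintype.sum_sum_type, Matrix.one_apply, G, Z]

open Matrix in
/-- The adjunction formula: minors of the Jacobian matrix of the equations against the Jacobian of
the coordinates. -/
theorem exists_associated_det {c d : ℕ} {gen : Fin c ⊕ Fin d → B} [IsLocalRing A] [IsDomain A]
    (hgen : Function.Surjective (aeval gen : MvPolynomial (Fin c ⊕ Fin d) O →ₐ[O] B))
    (M : Submonoid B) [IsLocalization M A] (τ : Fin d → A)
    (b : Module.Basis (Fin d) A Ω[A⁄O]) (hb : ∀ i, b i = D O A (τ i))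
    (J : Matrix (Fin d) (Fin d) A)
    (hJ : ∀ i, D O A (algebraMap B A (gen (.inr i))) = ∑ j, J i j • D O A (τ j)) :
    (∀ F : Fin c → RingHom.ker (aeval gen : MvPolynomial (Fin c ⊕ Fin d) O →ₐ[O] B),
      J.det ∣ (of fun i j : Fin c => gradAt A gen (F i).1 (.inl j)).det) ∧
    ∃ F : Fin c → RingHom.ker (aeval gen : MvPolynomial (Fin c ⊕ Fin d) O →ₐ[O] B),
      Associated J.det (of fun i j : Fin c => gradAt A gen (F i).1 (.inl j)).det := by
  classical
  let R : Matrix (Fin c ⊕ Fin d) (Fin d) A :=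
    of fun i j => b.repr (D O A (algebraMap B A (gen i))) j
  have hR : ∀ i, D O A (algebraMap B A (gen i)) = ∑ j, R i j • D O A (τ j) := fun i => by
    simp_rw [← hb]; exact (b.sum_repr _).symm
  have hRJ : (of fun i j : Fin d => R (.inr i) j) = J := by
    ext i j
    have h := hJ i
    simp_rw [← hb] at h
    simp only [R, of_apply, h, map_sum, map_smul, Module.Basis.repr_self]
    simp [Finsupp.single_apply]
  let φ : (Fin c ⊕ Fin d → A) →ₗ[A] (Fin d → A) := R.vecMulLinear
  have hφ : ∀ w, (b.equivFun.symm (φ w)) = ∑ i, w i • D O A (algebraMap B A (gen i)) := by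
    intro w
    rw [Module.Basis.equivFun_symm_apply]
    simp_rw [hR, Finset.smul_sum, ← hb]
    rw [Finset.sum_comm]
    simp_rw [← mul_smul, ← Finset.sum_smul]
    rfl
  have hspan : Submodule.span A (Set.range fun i => D O A (algebraMap B A (gen i))) = ⊤ := by
    rw [_root_.eq_top_iff, ← span_range_map_derivation_of_isLocalization O B A M, Submodule.span_le]
    rintro _ ⟨y, rfl⟩
    obtain ⟨F, rfl⟩ := hgen y
    rw [Function.comp_apply, map_D, D_aeval_eq_sum]
    exact Submodule.sum_mem _ fun i _ => Submodule.smul_mem _ _ (Submodule.subset_span ⟨i, rfl⟩)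
  have hsurj : Function.Surjective φ := by
    intro y
    have : b.equivFun.symm y ∈ (⊤ : Submodule A Ω[A⁄O]) := trivial
    rw [← hspan, Submodule.mem_span_range_iff_exists_fun] at this
    obtain ⟨w, hw⟩ := this
    exact ⟨w, b.equivFun.symm.injective (by rw [hφ, hw])⟩
  choose T hT using fun i : Fin d => hsurj (Pi.single i 1)
  have hTR : (of T) * R = 1 := by
    ext i j
    have := congrFun (hT i) j
    rw [Matrix.one_apply]
    simpa [φ, Matrix.vecMul, dotProduct, Matrix.mul_apply, Pi.single_apply, eq_comm] using this
  have hdet := fun F => det_gradAt τ b hb R hR (of T) hTR F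
  rw [hRJ] at hdet
  refine ⟨fun F => hdet F ▸ dvd_mul_left _ _, ?_⟩
  let W := LinearMap.ker φ
  have hWF : ∀ F : RingHom.ker (aeval gen : MvPolynomial (Fin c ⊕ Fin d) O →ₐ[O] B),
      gradAt A gen F.1 ∈ W := by
    intro F
    refine b.equivFun.symm.injective ?_
    rw [hφ, map_zero, ← D_aeval_eq_sum, (RingHom.mem_ker).mp F.2, map_zero, map_zero]
  have hW : W ≤ Submodule.span A (Set.range fun F : RingHom.ker
      (aeval gen : MvPolynomial (Fin c ⊕ Fin d) O →ₐ[O] B) => gradAt A gen F.1) := fun w hw =>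
    mem_span_gradAt hgen M w (by rw [← hφ, LinearMap.mem_ker.mp hw, map_zero])
  -- As `φ` splits, its kernel `W` is finite projective. Over a local ring a basis can be extracted
  -- from the generating set of gradients, and comparison of ranks gives it `c` elements.
  obtain ⟨s, hs⟩ := Module.projective_lifting_property φ LinearMap.id hsurj
  have hsφ : ∀ y, φ (s y) = y := fun y => LinearMap.congr_fun hs y
  let π : (Fin c ⊕ Fin d → A) →ₗ[A] W := LinearMap.codRestrict W (LinearMap.id - s ∘ₗ φ) fun w => by
    simp [W, hsφ]
  have hπ : ∀ w : W, π w = w := fun w => by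
    ext1
    simp [π, LinearMap.mem_ker.mp w.2]
  have : Module.Projective A W := .of_split W.subtype π (by ext1 w; exact hπ w)
  have : Module.Finite A W := .of_surjective π fun w => ⟨w, hπ w⟩
  have : Module.FinitePresentation A W := Module.finitePresentation_of_projective A W
  let v : RingHom.ker (aeval gen : MvPolynomial (Fin c ⊕ Fin d) O →ₐ[O] B) → W :=
    fun F => ⟨_, hWF F⟩
  have hv : Submodule.span A (Set.range v) = ⊤ := by
    refine Submodule.map_injective_of_injective W.injective_subtype ?_
    rw [Submodule.map_span, Submodule.map_subtype_top, ← Set.range_comp]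
    exact le_antisymm (Submodule.span_le.mpr (by rintro _ ⟨F, rfl⟩; exact hWF F)) hW
  obtain ⟨κ, a, β, hβ⟩ := Module.exists_basis_of_span_of_flat v hv
  have := Module.Finite.finite_basis β
  have := Fintype.ofFinite κ
  have hcard : Fintype.card κ = c := by
    have h1 := Submodule.finrank_quotient_add_finrank W
    rw [(φ.quotKerEquivOfSurjective hsurj).finrank_eq, Module.finrank_fintype_fun_eq_card,
      Module.finrank_fintype_fun_eq_card, Fintype.card_sum, Fintype.card_fin, Fintype.card_fin,
      Module.finrank_eq_card_basis β] at h1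
    omega
  let e : Fin c ≃ κ := (Fintype.equivFinOfCardEq hcard).symm
  refine ⟨fun i => a (e i), ?_⟩
  rw [hdet]
  -- The rows of `Q` are this basis of `W` followed by the lifts `T` of the standard basis of the
  -- quotient. They span everything, so `det Q` is a unit.
  let Q := fromRows (of fun i => gradAt A gen (a (e i)).1) (of T)
  suffices hu : IsUnit Q.det from ⟨hu.unit, mul_comm _ _⟩
  have hQ : ∀ w : Fin c ⊕ Fin d → A, ∃ y, y ᵥ* Q = w := by
    intro w
    have h1 : w - φ w ᵥ* (of T) ∈ W := by
      refine LinearMap.mem_ker.mpr ?_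
      rw [map_sub, sub_eq_zero]
      change _ = (φ w ᵥ* of T) ᵥ* R
      rw [vecMul_vecMul, hTR, vecMul_one]
    have h2 := β.sum_repr ⟨_, h1⟩
    refine ⟨Sum.elim (fun i => β.repr ⟨_, h1⟩ (e i)) (φ w), ?_⟩
    rw [sumElim_vecMul_fromRows]
    have h3 := congrArg Subtype.val h2
    rw [Submodule.coe_sum, ← e.sum_comp] at h3
    refine Eq.trans (congrArg (· + _) (Eq.trans ?_ h3)) (sub_add_cancel w (φ w ᵥ* of T))
    ext j
    simp only [Matrix.vecMul, dotProduct, of_apply, Finset.sum_apply, hβ, SetLike.val_smul,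
      Pi.smul_apply, smul_eq_mul, v]
  choose N hN using fun i => hQ (Pi.single i 1)
  refine isUnit_det_of_left_inverse (B := of N) ?_
  ext i j
  have := congrFun (hN i) j
  rw [Matrix.one_apply]
  simpa [Matrix.vecMul, dotProduct, Matrix.mul_apply, Pi.single_apply, eq_comm] using this

end Jacobian

/-! ### The normalized absolute value. -/

section NormAbs

open IsNonarchimedeanLocalField

variable {K : Type u} [Field K] [ValuativeRel K] [TopologicalSpace K]
  [IsNonarchimedeanLocalField K]

theorem one_lt_residueCard : 1 < residueCard K :=
  Finite.one_lt_card

theorem one_lt_residueCard' : (1 : ℝ) < residueCard K := by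
  exact_mod_cast one_lt_residueCard

theorem normAbs_zero : normAbs (0 : K) = 0 := if_pos rfl

theorem normAbs_of_ne_zero {x : K} (hx : x ≠ 0) : normAbs x = (residueCard K : ℝ) ^
    WithZero.log (valueGroupWithZeroIsoInt K (valuation K x)) := if_neg hx

theorem normAbs_pos {x : K} (hx : x ≠ 0) : 0 < normAbs x := by
  rw [normAbs_of_ne_zero hx]
  exact zpow_pos (by linarith [one_lt_residueCard' (K := K)]) _

theorem normAbs_nonneg (x : K) : 0 ≤ normAbs x := by
  rcases eq_or_ne x 0 with rfl | hx
  · exact normAbs_zero.ge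
  · exact (normAbs_pos hx).le

theorem valueIso_ne_zero {x : K} (hx : x ≠ 0) :
    valueGroupWithZeroIsoInt K (valuation K x) ≠ 0 := by
  simpa using hx

variable (K) in
/-- The normalized absolute value as a homomorphism. -/
noncomputable def normAbsHom : K →*₀ ℝ where
  toFun := normAbs
  map_zero' := normAbs_zero
  map_one' := by simp [normAbs_of_ne_zero (one_ne_zero (α := K))]
  map_mul' x y := by
    rcases eq_or_ne x 0 with rfl | hx
    · simp [normAbs_zero]
    rcases eq_or_ne y 0 with rfl | hy
    · simp [normAbs_zero]
    rw [normAbs_of_ne_zero hx, normAbs_of_ne_zero hy, normAbs_of_ne_zero (mul_ne_zero hx hy),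
      map_mul, map_mul, WithZero.log_mul (valueIso_ne_zero hx) (valueIso_ne_zero hy),
      zpow_add₀ (by linarith [one_lt_residueCard' (K := K)])]

theorem normAbs_mul (x y : K) : normAbs (x * y) = normAbs x * normAbs y :=
  map_mul (normAbsHom K) x y

theorem normAbs_div (x y : K) : normAbs (x / y) = normAbs x / normAbs y :=
  map_div₀ (normAbsHom K) x y

theorem normAbs_pow (x : K) (n : ℕ) : normAbs (x ^ n) = normAbs x ^ n :=
  map_pow (normAbsHom K) x n

theorem normAbs_one : normAbs (1 : K) = 1 := map_one (normAbsHom K)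

theorem normAbs_prod {ι : Type*} (s : Finset ι) (g : ι → K) :
    normAbs (∏ i ∈ s, g i) = ∏ i ∈ s, normAbs (g i) :=
  map_prod (normAbsHom K) g s

theorem normAbs_le_normAbs_iff {x y : K} :
    normAbs x ≤ normAbs y ↔ valuation K x ≤ valuation K y := by
  rcases eq_or_ne x 0 with rfl | hx
  · simp [normAbs_zero, normAbs_nonneg]
  rcases eq_or_ne y 0 with rfl | hy
  · simp [normAbs_zero, (normAbs_pos hx).not_ge, hx]
  rw [normAbs_of_ne_zero hx, normAbs_of_ne_zero hy,
    zpow_le_zpow_iff_right₀ one_lt_residueCard',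
    WithZero.log_le_log (valueIso_ne_zero hx) (valueIso_ne_zero hy)]
  exact (valueGroupWithZeroIsoInt K).toOrderIso.le_iff_le

theorem normAbs_le_one_iff {x : K} : normAbs x ≤ 1 ↔ x ∈ 𝒪[K] := by
  rw [← normAbs_one (K := K), normAbs_le_normAbs_iff, map_one]
  rfl

theorem normAbs_coe_le_one (x : 𝒪[K]) : normAbs (x : K) ≤ 1 := normAbs_le_one_iff.mpr x.2

theorem normAbs_eq_one_of_isUnit {x : 𝒪[K]} (hx : IsUnit x) : normAbs (x : K) = 1 := by
  obtain ⟨y, hy⟩ := hx.exists_right_inv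
  refine le_antisymm (normAbs_coe_le_one x) ?_
  have h1 := congrArg (fun z : 𝒪[K] => normAbs (z : K)) hy
  simp only [MulMemClass.coe_mul, normAbs_mul, OneMemClass.coe_one, normAbs_one] at h1
  nlinarith [normAbs_coe_le_one y, normAbs_nonneg (x : K), normAbs_nonneg (y : K)]

theorem dvd_iff_normAbs_le {x y : 𝒪[K]} : x ∣ y ↔ normAbs (y : K) ≤ normAbs (x : K) := by
  constructor
  · rintro ⟨z, rfl⟩
    simp only [MulMemClass.coe_mul, normAbs_mul]
    nlinarith [normAbs_coe_le_one z, normAbs_nonneg (x : K)]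
  · intro h
    rcases eq_or_ne x 0 with rfl | hx
    · have : (y : K) = 0 := by
        by_contra h0
        have := normAbs_pos h0
        simp [normAbs_zero] at h
        linarith
      rw [ZeroMemClass.coe_eq_zero] at this
      rw [this]
    have hx' : (x : K) ≠ 0 := by simpa using hx
    refine ⟨⟨y / x, normAbs_le_one_iff.mp ?_⟩, ?_⟩
    · rw [normAbs_div]
      exact div_le_one_of_le₀ h (normAbs_nonneg _)
    · ext
      simp [mul_div_cancel₀ _ hx']

theorem isUnit_iff_normAbs_eq_one {x : 𝒪[K]} : IsUnit x ↔ normAbs (x : K) = 1 := by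
  refine ⟨normAbs_eq_one_of_isUnit, fun h => ?_⟩
  rw [isUnit_iff_dvd_one, dvd_iff_normAbs_le, h]
  simp [normAbs_one]

/-- The isomorphism defining `normAbs` does not mention `ϖ`, so the value is bounded from both
sides: some nonunit has absolute value `q⁻¹` and is divisible by `ϖ`, while `|ϖ| < 1` is an integral
power of `q`. -/
theorem normAbs_irreducible {ϖ : 𝒪[K]} (hϖ : Irreducible ϖ) :
    normAbs (ϖ : K) = (residueCard K : ℝ)⁻¹ := by
  have h0 : (ϖ : K) ≠ 0 := by simpa using hϖ.ne_zero
  have hq := one_lt_residueCard' (K := K)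
  obtain ⟨v, hv⟩ := (valueGroupWithZeroIsoInt K).surjective (WithZero.exp (-1))
  obtain ⟨x, rfl⟩ := valuation_surjective v
  change valueGroupWithZeroIsoInt K (valuation K x) = _ at hv
  have hx0 : x ≠ 0 := by
    rintro rfl
    rw [map_zero, map_zero] at hv
    exact WithZero.exp_ne_zero hv.symm
  have hx : normAbs x = (residueCard K : ℝ)⁻¹ := by
    rw [normAbs_of_ne_zero hx0, hv, WithZero.log_exp, zpow_neg_one]
  have hx1 : normAbs x < 1 := hx ▸ inv_lt_one_of_one_lt₀ hq
  have hxm : ¬ IsUnit (⟨x, normAbs_le_one_iff.mp hx1.le⟩ : 𝒪[K]) := by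
    rw [isUnit_iff_normAbs_eq_one]
    exact hx1.ne
  have h1 : ϖ ∣ (⟨x, normAbs_le_one_iff.mp hx1.le⟩ : 𝒪[K]) := by
    rw [← Ideal.mem_span_singleton, ← hϖ.maximalIdeal_eq]
    exact hxm
  rw [dvd_iff_normAbs_le] at h1
  refine le_antisymm ?_ (hx ▸ h1)
  have h2 : normAbs (ϖ : K) < 1 := (normAbs_coe_le_one ϖ).lt_of_ne fun h =>
    hϖ.not_isUnit (isUnit_iff_normAbs_eq_one.mpr h)
  rw [normAbs_of_ne_zero h0] at h2 ⊢
  rw [← zpow_neg_one]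
  refine zpow_le_zpow_right₀ hq.le ?_
  by_contra! h3
  exact h2.not_ge (one_le_zpow₀ hq.le (by omega))

theorem mem_maximalIdeal_pow_iff {ϖ : 𝒪[K]} (hϖ : Irreducible ϖ) {n : ℕ} {x : 𝒪[K]} :
    x ∈ 𝓂[K] ^ n ↔ normAbs (x : K) ≤ (residueCard K : ℝ)⁻¹ ^ n := by
  rw [hϖ.maximalIdeal_eq, Ideal.span_singleton_pow, Ideal.mem_span_singleton, dvd_iff_normAbs_le]
  simp [normAbs_pow, normAbs_irreducible hϖ]

/-- A rank one form of the valuation makes `K` a proper metric space. Second countability is what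
identifies the Borel structure of `K ^ d` with the product one and makes open covers of patches
countable. -/
instance : SecondCountableTopology K := by
  let := IsTopologicalAddGroup.rightUniformSpace K
  have := isUniformAddGroup_of_addCommGroup (G := K)
  let : (Valued.v (R := K)).RankOne :=
  { hom' := IsRankLeOne.nonempty.some.emb (R := K).comp MonoidWithZeroHom.ValueGroup₀.embedding
    strictMono' := IsRankLeOne.nonempty.some.strictMono.comp
        MonoidWithZeroHom.ValueGroup₀.embedding_strictMono }
  open scoped Valued in
  have : ProperSpace K := .of_nontriviallyNormedField_of_weaklyLocallyCompactSpace K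
  infer_instance

instance : T2Space K := by
  let := IsTopologicalAddGroup.rightUniformSpace K
  have := isUniformAddGroup_of_addCommGroup (G := K)
  infer_instance

end NormAbs

/-! ### Haar measure of `K ^ d` and the linear change of variables. -/

section HaarMeasure

variable {K : Type u} [Field K] [ValuativeRel K] [TopologicalSpace K]
  [IsNonarchimedeanLocalField K]

theorem lintegral_fin_prod {n : ℕ} {E : Type*} [MeasurableSpace E] (μ : Measure E) [SigmaFinite μ]
    (g : Fin n → E → ℝ≥0∞) (hg : ∀ i, Measurable (g i)) :
    ∫⁻ x, ∏ i, g i (x i) ∂(Measure.pi fun _ => μ) = ∏ i, ∫⁻ x, g i x ∂μ := by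
  induction n with
  | zero => simp
  | succ n ih =>
    rw [← ((measurePreserving_piFinSuccAbove (fun _ => μ) 0).symm).lintegral_comp_emb
      (MeasurableEquiv.measurableEmbedding _)]
    simp_rw [MeasurableEquiv.piFinSuccAbove_symm_apply, Fin.insertNthEquiv,
      Fin.prod_univ_succ, Equiv.coe_fn_mk, Fin.insertNth_zero, Fin.cons_succ, Fin.cons_zero]
    rw [← ih _ fun i : Fin n => hg i.succ, ← lintegral_prod_mul (hg 0).aemeasurable]
    · rfl
    exact (Finset.measurable_prod _ fun (i : Fin n) _ =>
      (hg i.succ).comp (measurable_pi_apply i)).aemeasurable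

/-- The Borel sets of `K`. -/
@[reducible] def borelField (K : Type u) [TopologicalSpace K] : MeasurableSpace K := borel K

theorem borelField_borelSpace (K : Type u) [TopologicalSpace K] :
    @BorelSpace K _ (borelField K) := @BorelSpace.mk K _ (borelField K) rfl

attribute [local instance] borelField borelField_borelSpace

variable (K) in
/-- The ring of integers as a compact set. -/
def unitDisc : TopologicalSpace.PositiveCompacts K where
  carrier := (𝒪[K] : Set K)
  isCompact' := isCompact_iff_compactSpace.mpr (inferInstanceAs (CompactSpace 𝒪[K]))
  interior_nonempty' := by
    rw [(isOpen_integer K).interior_eq]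
    exact ⟨0, zero_mem 𝒪[K]⟩

variable (K) in
/-- The normalized Haar measure of `K`. -/
noncomputable def haarOne : Measure K := Measure.addHaarMeasure (unitDisc K)

noncomputable instance : (haarOne K).IsAddHaarMeasure :=
  inferInstanceAs (Measure.addHaarMeasure _).IsAddHaarMeasure

theorem haarOne_integer : haarOne K (𝒪[K] : Set K) = 1 := Measure.addHaarMeasure_self

/-- By uniqueness of Haar measure. The Borel and the product `σ`-algebras are equal but not by
definition, so the statement is transported through a predicate `P` on both the `σ`-algebra and the
measure. -/
theorem haar_eq_pi (d : ℕ) (P : (m : MeasurableSpace (Fin d → K)) → Measure (Fin d → K) → Prop)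
    (h : P MeasurableSpace.pi (Measure.pi fun _ => haarOne K)) :
    P (borel (Fin d → K)) (haar K d) := by
  have key : ∀ (m : MeasurableSpace (Fin d → K)) (hm : BorelSpace (Fin d → K)),
      P m (Measure.addHaarMeasure (unitPolydisc K d)) := by
    intro m hm
    obtain rfl : m = MeasurableSpace.pi := hm.measurable_eq.trans
      (Pi.borelSpace (X := fun _ : Fin d => K)).measurable_eq.symm
    have h1 := Measure.addHaarMeasure_unique (Measure.pi fun _ : Fin d => haarOne K)
      (unitPolydisc K d)
    have h2 : (Measure.pi fun _ : Fin d => haarOne K) (unitPolydisc K d) = 1 := by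
      change (Measure.pi fun _ : Fin d => haarOne K) (Set.univ.pi fun _ => (𝒪[K] : Set K)) = 1
      rw [Measure.pi_pi]
      simp [haarOne_integer]
    rw [h2, one_smul] at h1
    rwa [← h1]
  exact key _ _

theorem haar_pi (d : ℕ) (S : Fin d → Set K) :
    haar K d (Set.univ.pi S) = ∏ i, haarOne K (S i) :=
  haar_eq_pi d (fun _ μ => μ (Set.univ.pi S) = ∏ i, haarOne K (S i)) (Measure.pi_pi _ _)


section Scaling

variable {G : Type*} [AddCommGroup G] [TopologicalSpace G] [MeasurableSpace G] [BorelSpace G]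
  [IsTopologicalAddGroup G] [LocallyCompactSpace G]

/-- By uniqueness of Haar measure an automorphism scales all sets by one factor, which is read off
on the normalizing compact set. -/
theorem measure_image_addEquiv (K₀ : TopologicalSpace.PositiveCompacts G) (φ : G ≃ₜ+ G)
    (S : Set G) : Measure.addHaarMeasure K₀ (φ '' S) =
      Measure.addHaarMeasure K₀ (φ '' K₀) * Measure.addHaarMeasure K₀ S := by
  have h : ∀ S, Measure.addHaarMeasure K₀ (φ '' S) =
      (addEquivAddHaarChar φ.symm : ℝ≥0∞)⁻¹ * Measure.addHaarMeasure K₀ S := by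
    intro S
    have h1 := addEquivAddHaarChar_smul_preimage (Measure.addHaarMeasure K₀) φ.symm (X := S)
    have h0 : (addEquivAddHaarChar φ.symm : ℝ≥0∞) ≠ 0 := by
      exact_mod_cast (addEquivAddHaarChar_pos φ.symm).ne'
    rw [← h1, ENNReal.smul_def, smul_eq_mul, ← mul_assoc,
      ENNReal.inv_mul_cancel h0 ENNReal.coe_ne_top, one_mul]
    congr 1
    exact φ.toEquiv.image_eq_preimage_symm S
  rw [h, h K₀, Measure.addHaarMeasure_self, mul_one]

end Scaling

/-- Multiplication by a nonzero element. -/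
noncomputable def mulAddEquiv (a : K) (ha : a ≠ 0) : K ≃ₜ+ K :=
  { Homeomorph.mulLeft₀ a ha with
    map_add' := fun x y => mul_add a x y }

theorem haarOne_image_mul_eq (a : K) (ha : a ≠ 0) (S : Set K) :
    haarOne K ((fun x => a * x) '' S) =
      haarOne K ((fun x => a * x) '' (𝒪[K] : Set K)) * haarOne K S :=
  measure_image_addEquiv (unitDisc K) (mulAddEquiv a ha) S

theorem mem_image_mul_integer {a : K} (ha : a ≠ 0) {x : K} :
    x ∈ (fun x => a * x) '' (𝒪[K] : Set K) ↔ normAbs x ≤ normAbs a := by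
  constructor
  · rintro ⟨y, hy, rfl⟩
    have := normAbs_le_one_iff.mpr hy
    simp only [normAbs_mul]
    nlinarith [normAbs_nonneg a]
  · intro h
    refine ⟨x / a, normAbs_le_one_iff.mp ?_, mul_div_cancel₀ _ ha⟩
    rw [normAbs_div]
    exact div_le_one_of_le₀ h (normAbs_nonneg _)

/-- The ring `𝒪` is the disjoint union of its `q` residue classes, all translates of `ϖ𝒪`. -/
theorem haarOne_image_irreducible {ϖ : 𝒪[K]} (hϖ : Irreducible ϖ) :
    haarOne K ((fun x => (ϖ : K) * x) '' (𝒪[K] : Set K)) = (residueCard K : ℝ≥0∞)⁻¹ := by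
  have h0 : (ϖ : K) ≠ 0 := by simpa using hϖ.ne_zero
  have hm : (fun x => (ϖ : K) * x) '' (𝒪[K] : Set K) = ((↑) : 𝒪[K] → K) '' (𝓂[K] : Set 𝒪[K]) := by
    ext x
    rw [hϖ.maximalIdeal_eq]
    constructor
    · rintro ⟨y, hy, rfl⟩
      exact ⟨ϖ * ⟨y, hy⟩, Ideal.mem_span_singleton.mpr ⟨_, rfl⟩, rfl⟩
    · rintro ⟨y, hy, rfl⟩
      obtain ⟨z, rfl⟩ := Ideal.mem_span_singleton.mp hy
      exact ⟨z, z.2, rfl⟩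
  have hopen : IsOpen ((fun x => (ϖ : K) * x) '' (𝒪[K] : Set K)) :=
    (mulAddEquiv (ϖ : K) h0).toHomeomorph.isOpenMap _ (isOpen_integer K)
  have hfib : ∀ r : 𝒪[K], ((↑) : 𝒪[K] → K) '' (IsLocalRing.residue 𝒪[K] ⁻¹' {IsLocalRing.residue _ r})
      = (fun x => (-r : K) + x) ⁻¹' ((fun x => (ϖ : K) * x) '' (𝒪[K] : Set K)) := by
    intro r
    rw [hm]
    ext x
    constructor
    · rintro ⟨y, hy, rfl⟩
      refine ⟨-r + y, ?_, rfl⟩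
      rw [SetLike.mem_coe, ← IsLocalRing.residue_eq_zero_iff, map_add, map_neg]
      rw [Set.mem_preimage, Set.mem_singleton_iff] at hy
      rw [hy, neg_add_cancel]
    · rintro ⟨y, hy, hxy⟩
      refine ⟨r + y, ?_, by rw [Subring.coe_add, hxy]; ring⟩
      rw [SetLike.mem_coe, ← IsLocalRing.residue_eq_zero_iff] at hy
      rw [Set.mem_preimage, Set.mem_singleton_iff, map_add, hy, add_zero]
  have : Fintype 𝓀[K] := Fintype.ofFinite _
  have hsum : haarOne K (𝒪[K] : Set K) = ∑ k : 𝓀[K],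
      haarOne K (((↑) : 𝒪[K] → K) '' (IsLocalRing.residue 𝒪[K] ⁻¹' {k})) := by
    rw [← tsum_fintype (L := .unconditional _), ← measure_iUnion]
    · congr 1
      rw [← Set.image_iUnion, ← Set.preimage_iUnion, Set.iUnion_singleton_eq_range]
      simp
    · intro i j hij
      refine Set.disjoint_image_of_injective Subtype.val_injective ?_
      exact Disjoint.preimage _ (Set.disjoint_singleton.mpr hij)
    · intro k
      obtain ⟨r, rfl⟩ := IsLocalRing.residue_surjective k
      rw [hfib]
      exact (measurable_const_add _) hopen.measurableSet
  have heq : ∀ k : 𝓀[K], haarOne K (((↑) : 𝒪[K] → K) '' (IsLocalRing.residue 𝒪[K] ⁻¹' {k})) =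
      haarOne K ((fun x => (ϖ : K) * x) '' (𝒪[K] : Set K)) := by
    intro k
    obtain ⟨r, rfl⟩ := IsLocalRing.residue_surjective k
    rw [hfib, measure_preimage_add]
  rw [haarOne_integer, Finset.sum_congr rfl fun k _ => heq k, Finset.sum_const, Finset.card_univ,
    nsmul_eq_mul, ← Nat.card_eq_fintype_card] at hsum
  exact ENNReal.eq_inv_of_mul_eq_one_left (by rw [mul_comm]; exact hsum.symm)

theorem exists_irreducible : ∃ ϖ : 𝒪[K], Irreducible ϖ :=
  IsDiscreteValuationRing.exists_irreducible _

/-- The scaling factor is multiplicative: it is known for `ϖ`, hence for its powers. A nonzero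
integer is a unit times such a power and spans the same disc, and fractions follow by division. -/
theorem haarOne_image_integer (a : K) (ha : a ≠ 0) :
    haarOne K ((fun x => a * x) '' (𝒪[K] : Set K)) = ENNReal.ofReal (normAbs a) := by
  obtain ⟨ϖ, hϖ⟩ := exists_irreducible (K := K)
  have hϖ0 : (ϖ : K) ≠ 0 := by simpa using hϖ.ne_zero
  have hpow : ∀ n : ℕ, haarOne K ((fun x => (ϖ : K) ^ n * x) '' (𝒪[K] : Set K)) =
      ENNReal.ofReal (normAbs ((ϖ : K) ^ n)) := by
    intro n
    induction n with
    | zero => simp [haarOne_integer, normAbs_one]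
    | succ n ih =>
      have : (fun x => (ϖ : K) ^ (n + 1) * x) = (fun x => (ϖ : K) * x) ∘ fun x => (ϖ : K) ^ n * x := by
        ext x; simp only [Function.comp_apply]; ring
      rw [this, Set.image_comp, haarOne_image_mul_eq _ hϖ0, ih, haarOne_image_irreducible hϖ,
        pow_succ', normAbs_mul, ENNReal.ofReal_mul (normAbs_nonneg _), normAbs_irreducible hϖ,
        ENNReal.ofReal_inv_of_pos (by linarith [one_lt_residueCard' (K := K)]),
        ENNReal.ofReal_natCast]
  have hint : ∀ b : 𝒪[K], b ≠ 0 → haarOne K ((fun x => (b : K) * x) '' (𝒪[K] : Set K)) =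
      ENNReal.ofReal (normAbs (b : K)) := by
    intro b hb
    obtain ⟨n, u, hu⟩ := IsDiscreteValuationRing.eq_unit_mul_pow_irreducible hb hϖ
    have hb' : (b : K) ≠ 0 := by simpa using hb
    have hbn : normAbs (b : K) = normAbs ((ϖ : K) ^ n) := by
      rw [hu]
      simp [normAbs_mul, normAbs_eq_one_of_isUnit u.isUnit]
    have : (fun x => (b : K) * x) '' (𝒪[K] : Set K) =
        (fun x => (ϖ : K) ^ n * x) '' (𝒪[K] : Set K) := by
      ext x
      rw [mem_image_mul_integer hb', mem_image_mul_integer (pow_ne_zero _ hϖ0), hbn]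
    rw [this, hpow, hbn]
  obtain ⟨x, y, hy, rfl⟩ := IsFractionRing.div_surjective (A := 𝒪[K]) a
  have hy0 : (y : K) ≠ 0 := by simpa using nonZeroDivisors.ne_zero hy
  have hx0 : x ≠ 0 := by rintro rfl; simp at ha
  have h1 : (fun t => (x : K) * t) = (fun t => (x / y : K) * t) ∘ fun t => (y : K) * t := by
    ext t
    simp only [Function.comp_apply]
    field_simp
  have h2 := hint x hx0
  rw [h1, Set.image_comp, haarOne_image_mul_eq (x / y : K) ha, hint y (nonZeroDivisors.ne_zero hy)] at h2
  have h3 : normAbs (x : K) = normAbs (x / y : K) * normAbs (y : K) := by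
    rw [← normAbs_mul, div_mul_cancel₀ _ hy0]
  rw [h3, ENNReal.ofReal_mul (normAbs_nonneg _)] at h2
  exact (ENNReal.mul_left_inj (by simpa using normAbs_pos hy0) ENNReal.ofReal_ne_top).mp h2

open Matrix

/-- An invertible matrix as a homeomorphic automorphism. -/
noncomputable def mulVecEquiv {d : ℕ} (M : Matrix (Fin d) (Fin d) K) (hM : M.det ≠ 0) :
    (Fin d → K) ≃ₜ+ (Fin d → K) where
  toFun x := M *ᵥ x
  invFun x := M⁻¹ *ᵥ x
  left_inv x := by simp only []; rw [mulVec_mulVec, nonsing_inv_mul _ hM.isUnit, one_mulVec]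
  right_inv x := by simp only []; rw [mulVec_mulVec, mul_nonsing_inv _ hM.isUnit, one_mulVec]
  map_add' := mulVec_add M
  continuous_toFun := by fun_prop
  continuous_invFun := by fun_prop

theorem haar_image_eq {d : ℕ} (M : Matrix (Fin d) (Fin d) K) (hM : M.det ≠ 0)
    (S : Set (Fin d → K)) : haar K d ((M *ᵥ ·) '' S) =
      haar K d ((M *ᵥ ·) '' (Set.univ.pi fun _ => (𝒪[K] : Set K))) * haar K d S := by
  let : MeasurableSpace (Fin d → K) := borel (Fin d → K)
  have : BorelSpace (Fin d → K) := ⟨rfl⟩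
  exact measure_image_addEquiv (unitPolydisc K d) (mulVecEquiv M hM) S

theorem haar_polydisc (d : ℕ) : haar K d (Set.univ.pi fun _ => (𝒪[K] : Set K)) = 1 := by
  rw [haar_pi]; simp [haarOne_integer]

theorem haar_image_diagonal {d : ℕ} (v : Fin d → K) (hv : (diagonal v).det ≠ 0)
    (S : Set (Fin d → K)) : haar K d ((diagonal v *ᵥ ·) '' S) =
      ENNReal.ofReal (normAbs (diagonal v).det) * haar K d S := by
  rw [haar_image_eq _ hv]
  congr 1
  have hv' : ∀ i, v i ≠ 0 := by
    rw [det_diagonal, Finset.prod_ne_zero_iff] at hv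
    exact fun i => hv i (Finset.mem_univ i)
  have : (diagonal v *ᵥ ·) '' (Set.univ.pi fun _ => (𝒪[K] : Set K)) =
      Set.univ.pi fun i => (fun x => v i * x) '' (𝒪[K] : Set K) := by
    ext y
    simp only [Set.mem_image, Set.mem_univ_pi]
    constructor
    · rintro ⟨x, hx, rfl⟩ i
      exact ⟨x i, hx i, (mulVec_diagonal v x i).symm⟩
    · intro h
      choose x hx hxy using h
      exact ⟨x, hx, funext fun i => (mulVec_diagonal v x i).trans (hxy i)⟩
  rw [this, haar_pi, Finset.prod_congr rfl fun i _ => haarOne_image_integer _ (hv' i),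
    det_diagonal, normAbs_prod, ENNReal.ofReal_prod_of_nonneg fun i _ => normAbs_nonneg _]

/-- The change of variables formula for linear maps. -/
theorem haar_image_mulVec {d : ℕ} (M : Matrix (Fin d) (Fin d) K) (hM : M.det ≠ 0)
    (S : Set (Fin d → K)) : haar K d ((M *ᵥ ·) '' S) =
      ENNReal.ofReal (normAbs M.det) * haar K d S := by
  have hmul : ∀ A B : Matrix (Fin d) (Fin d) K,
      (∀ S, haar K d ((A *ᵥ ·) '' S) = ENNReal.ofReal (normAbs A.det) * haar K d S) →
      (∀ S, haar K d ((B *ᵥ ·) '' S) = ENNReal.ofReal (normAbs B.det) * haar K d S) →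
      ∀ S, haar K d (((A * B) *ᵥ ·) '' S) = ENNReal.ofReal (normAbs (A * B).det) * haar K d S := by
    intro A B hA hB S
    have : ((A * B) *ᵥ ·) = (A *ᵥ ·) ∘ (B *ᵥ ·) := by
      ext x : 1; simp [mulVec_mulVec]
    rw [this, Set.image_comp, hA, hB, det_mul, normAbs_mul, ENNReal.ofReal_mul (normAbs_nonneg _),
      mul_assoc]
  revert S
  refine diagonal_transvection_induction_of_det_ne_zero
    (fun M => ∀ S, haar K d ((M *ᵥ ·) '' S) = ENNReal.ofReal (normAbs M.det) * haar K d S) M hM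
    (fun v hv => haar_image_diagonal v hv) ?_ fun A B _ _ hA hB => hmul A B hA hB
  rintro ⟨i, j, hij, a⟩
  simp only [TransvectionStruct.toMatrix_mk]
  -- the elementary matrix with entry `1` preserves the unit polydisc
  have hone : ∀ S, haar K d ((transvection i j (1 : K) *ᵥ ·) '' S) =
      ENNReal.ofReal (normAbs (transvection i j (1 : K)).det) * haar K d S := by
    intro S
    have hdet := det_transvection_of_ne i j hij (1 : K)
    rw [haar_image_eq _ (by rw [hdet]; exact one_ne_zero), hdet, normAbs_one]
    congr 1
    have hsub : ∀ (b : K), b ∈ 𝒪[K] → ∀ x ∈ Set.univ.pi fun _ : Fin d => (𝒪[K] : Set K),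
        transvection i j b *ᵥ x ∈ Set.univ.pi fun _ : Fin d => (𝒪[K] : Set K) := by
      intro b hb x hx k _
      rw [transvection, add_mulVec, one_mulVec, single_mulVec]
      refine add_mem (hx k trivial) ?_
      by_cases hk : k = i
      · subst hk
        simpa using mul_mem hb (hx j trivial)
      · simp [hk, zero_mem]
    have : (transvection i j (1 : K) *ᵥ ·) '' (Set.univ.pi fun _ => (𝒪[K] : Set K)) =
        Set.univ.pi fun _ => (𝒪[K] : Set K) := by
      refine Set.Subset.antisymm ?_ fun x hx => ?_
      · rintro _ ⟨x, hx, rfl⟩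
        exact hsub 1 (one_mem _) x hx
      · refine ⟨transvection i j (-1 : K) *ᵥ x, hsub _ (neg_mem (one_mem _)) x hx, ?_⟩
        simp only [mulVec_mulVec]
        rw [transvection_mul_transvection_same _ _ hij, add_neg_cancel, transvection_zero,
          one_mulVec]
    rw [this, haar_polydisc, ENNReal.ofReal_one]
  rcases eq_or_ne a 0 with rfl | ha
  · intro S
    simp [normAbs_one]
  -- A transvection with parameter `a ≠ 0` is conjugate, by a diagonal matrix, to the one with
  -- parameter `1`.
  · have hconj : transvection i j a = diagonal (Function.update 1 i a) * transvection i j 1 *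
        diagonal (Function.update 1 i a⁻¹) := by
      ext k l
      rw [mul_diagonal, diagonal_mul]
      by_cases hk : k = i
      · subst hk
        by_cases hl : l = k
        · subst hl
          simp [transvection, hij.symm, ha]
        · by_cases hl' : l = j
          · subst hl'
            simp [transvection, hl, Ne.symm hl]
          · simp [transvection, Ne.symm hl, Ne.symm hl']
      · by_cases hl : l = i
        · subst hl
          simp [transvection, hk, Ne.symm hk]
        · simp [transvection, hk, Ne.symm hk, hl]
    have hdet : ∀ b : K, b ≠ 0 → (diagonal (Function.update (1 : Fin d → K) i b)).det ≠ 0 := by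
      intro b hb
      rw [det_diagonal, Finset.prod_update_of_mem (Finset.mem_univ i)]
      simpa using hb
    rw [hconj]
    refine hmul _ _ (hmul _ _ ?_ hone) ?_
    · exact haar_image_diagonal _ (hdet a ha)
    · exact haar_image_diagonal _ (hdet _ (inv_ne_zero ha))

end HaarMeasure

/-! ### Ultrametric polydiscs and distance-nonincreasing maps. -/

section Balls

variable {K : Type u} [Field K] [ValuativeRel K] [TopologicalSpace K]
  [IsNonarchimedeanLocalField K]

variable (K) in
/-- The polydisc `(𝓂 ^ k) ^ d` of `K ^ d`. -/
def polyball (d k : ℕ) : AddSubgroup (Fin d → K) where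
  carrier := {y | ∀ i, ∃ z ∈ 𝓂[K] ^ k, (z : K) = y i}
  zero_mem' _ := ⟨0, zero_mem _, rfl⟩
  add_mem' {x y} hx hy i := by
    obtain ⟨a, ha, ha'⟩ := hx i
    obtain ⟨b, hb, hb'⟩ := hy i
    exact ⟨a + b, add_mem ha hb, by simp [ha', hb']⟩
  neg_mem' {x} hx i := by
    obtain ⟨a, ha, ha'⟩ := hx i
    exact ⟨-a, neg_mem ha, by simp [ha']⟩

theorem mem_polyball {d k : ℕ} {y : Fin d → K} :
    y ∈ polyball K d k ↔ ∀ i, ∃ z ∈ 𝓂[K] ^ k, (z : K) = y i := Iff.rfl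

theorem exists_mem_maximalIdeal_pow_iff {k : ℕ} {x : K} :
    (∃ z ∈ 𝓂[K] ^ k, (z : K) = x) ↔ normAbs x ≤ (residueCard K : ℝ)⁻¹ ^ k := by
  obtain ⟨ϖ, hϖ⟩ := exists_irreducible (K := K)
  constructor
  · rintro ⟨z, hz, rfl⟩
    exact (mem_maximalIdeal_pow_iff hϖ).mp hz
  · intro h
    have hq := one_lt_residueCard' (K := K)
    have : x ∈ 𝒪[K] := normAbs_le_one_iff.mp
      (h.trans (pow_le_one₀ (by positivity) (inv_le_one_of_one_le₀ hq.le)))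
    exact ⟨⟨x, this⟩, (mem_maximalIdeal_pow_iff hϖ).mpr h, rfl⟩

theorem normAbs_lt_normAbs_iff {x y : K} :
    normAbs x < normAbs y ↔ valuation K x < valuation K y := by
  rw [← not_le, ← not_le, normAbs_le_normAbs_iff]

theorem exists_pow_lt {ε : ℝ} (hε : 0 < ε) : ∃ k : ℕ, (residueCard K : ℝ)⁻¹ ^ k < ε :=
  exists_pow_lt_of_lt_one hε (inv_lt_one_of_one_lt₀ one_lt_residueCard')

theorem polyball_mono (d : ℕ) {k l : ℕ} (h : k ≤ l) : polyball K d l ≤ polyball K d k := by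
  intro y hy i
  obtain ⟨z, hz, hzy⟩ := hy i
  exact ⟨z, Ideal.pow_le_pow_right h hz, hzy⟩

theorem exists_ball_subset {U : Set K} (hU : U ∈ nhds (0 : K)) :
    ∃ k : ℕ, ∀ x : K, normAbs x ≤ (residueCard K : ℝ)⁻¹ ^ k → x ∈ U := by
  obtain ⟨γ, hγ, h⟩ := (IsValuativeTopology.hasBasis_nhds_zero' K).mem_iff.mp hU
  obtain ⟨a, rfl⟩ := valuation_surjective γ
  obtain ⟨k, hk⟩ := exists_pow_lt (K := K) (normAbs_pos (x := a) (by simpa using hγ))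
  exact ⟨k, fun x hx => h (normAbs_lt_normAbs_iff.mp (hx.trans_lt hk))⟩

theorem isOpen_ball {ε : ℝ} (hε : 0 < ε) : IsOpen {x : K | normAbs x ≤ ε} := by
  rw [isOpen_iff_mem_nhds]
  intro x hx
  obtain ⟨ϖ, hϖ⟩ := exists_irreducible (K := K)
  obtain ⟨k, hk⟩ := exists_pow_lt (K := K) hε
  have h0 : (ϖ : K) ^ k ≠ 0 := pow_ne_zero _ (by simpa using hϖ.ne_zero)
  have h1 : ∀ᶠ y in nhds (0 : K), valuation K y < valuation K ((ϖ : K) ^ k) :=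
    (IsValuativeTopology.hasBasis_nhds_zero' K).mem_of_mem (by simpa using h0)
  have h2 : Filter.Tendsto (fun y => y - x) (nhds x) (nhds 0) := by
    have : Continuous fun y : K => y - x := by fun_prop
    simpa using this.tendsto x
  filter_upwards [h2.eventually h1] with y hy
  rw [← normAbs_lt_normAbs_iff, normAbs_pow, normAbs_irreducible hϖ] at hy
  have hm := le_max_iff.mpr ((le_max_iff.mp ((valuation K).map_add (y - x) x)).imp
    normAbs_le_normAbs_iff.mpr normAbs_le_normAbs_iff.mpr)
  rw [sub_add_cancel] at hm
  exact hm.trans (max_le (hy.le.trans hk.le) hx)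

theorem isOpen_polyball (d k : ℕ) : IsOpen (polyball K d k : Set (Fin d → K)) := by
  have hq := one_lt_residueCard' (K := K)
  have : (polyball K d k : Set (Fin d → K)) =
      Set.univ.pi fun _ => {x : K | normAbs x ≤ (residueCard K : ℝ)⁻¹ ^ k} := by
    ext y
    simp only [SetLike.mem_coe, mem_polyball, exists_mem_maximalIdeal_pow_iff, Set.mem_univ_pi,
      Set.mem_ofPred_eq]
  rw [this]
  exact isOpen_set_pi Set.finite_univ fun _ _ => isOpen_ball (by positivity)

theorem exists_polyball_subset {d : ℕ} {U : Set (Fin d → K)} (hU : IsOpen U) {y : Fin d → K}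
    (hy : y ∈ U) : ∃ k, ∀ z ∈ polyball K d k, y + z ∈ U := by
  have h1 : (fun z => y + z) ⁻¹' U ∈ nhds (0 : Fin d → K) :=
    (hU.preimage (continuous_const_add y)).mem_nhds (by simpa using hy)
  rw [nhds_pi, Filter.mem_pi] at h1
  obtain ⟨I, -, s, hs, hsU⟩ := h1
  choose k hk using fun i => exists_ball_subset (hs i)
  refine ⟨Finset.univ.sup k, fun z hz => hsU fun i _ => hk i _ ?_⟩
  exact exists_mem_maximalIdeal_pow_iff.mp (polyball_mono d (Finset.le_sup (Finset.mem_univ i)) hz i)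

/-- Cosets of `polyball` are open, so a dense sequence meets each of them. -/
instance countable_quotient_polyball (d k : ℕ) : Countable ((Fin d → K) ⧸ polyball K d k) := by
  refine Function.Surjective.countable (α := ℕ)
    (f := fun n => (TopologicalSpace.denseSeq (Fin d → K) n : (Fin d → K) ⧸ polyball K d k)) ?_
  intro c
  obtain ⟨y, rfl⟩ := QuotientAddGroup.mk_surjective c
  obtain ⟨n, hn⟩ := (TopologicalSpace.denseRange_denseSeq (Fin d → K)).exists_mem_open
    ((isOpen_polyball d k).preimage (continuous_const_add (-y))) ⟨y, by simp⟩
  exact ⟨n, (QuotientAddGroup.eq.mpr hn).symm⟩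

/-- A map which does not increase distances does not increase the Haar measure. -/
theorem haar_image_le {d n : ℕ} {Q : Set (Fin d → K)}
    (hQ : ∀ y ∈ Q, ∀ z ∈ polyball K d n, y + z ∈ Q) (g : (Fin d → K) → Fin d → K)
    (hg : ∀ k, n ≤ k → ∀ y ∈ Q, ∀ z ∈ polyball K d k, g (y + z) - g y ∈ polyball K d k)
    {S : Set (Fin d → K)} (hS : S ⊆ Q) : haar K d (g '' S) ≤ haar K d S := by
  let : MeasurableSpace (Fin d → K) := borel (Fin d → K)
  have : BorelSpace (Fin d → K) := ⟨rfl⟩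
  let μ : Measure (Fin d → K) := haar K d
  have : μ.IsAddHaarMeasure := inferInstanceAs (Measure.addHaarMeasure _).IsAddHaarMeasure
  have : μ.Regular := inferInstanceAs (Measure.addHaarMeasure _).Regular
  change μ (g '' S) ≤ μ S
  rw [S.measure_eq_iInf_isOpen μ]
  refine le_iInf₂ fun U hSU => le_iInf fun hU => ?_
  -- `V k` collects the points of `Q` whose ball of level `k + n` lies in the open set `U`. These
  -- sets increase and cover `S`; `V k` is a union of balls of that level, each mapped by `g` into a
  -- ball of the same level. The shift by `n` keeps the levels in the range of `hg`.
  let V : ℕ → Set (Fin d → K) := fun k => {y ∈ Q | ∀ z ∈ polyball K d (k + n), y + z ∈ U}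
  have hV : Monotone V := fun k l hkl y hy =>
    ⟨hy.1, fun z hz => hy.2 z (polyball_mono d (by omega) hz)⟩
  have hcov : g '' S ⊆ ⋃ k, g '' V k := by
    rintro _ ⟨y, hy, rfl⟩
    obtain ⟨k, hk⟩ := exists_polyball_subset hU (hSU hy)
    exact Set.mem_iUnion.mpr ⟨k, y, ⟨hS hy, fun z hz => hk z (polyball_mono d (by omega) hz)⟩, rfl⟩
  refine (measure_mono hcov).trans ?_
  rw [Monotone.measure_iUnion fun k l hkl => Set.image_mono (hV hkl)]
  refine iSup_le fun k => ?_
  have hVU : V k ⊆ U := fun y hy => by simpa using hy.2 0 (zero_mem _)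
  refine le_trans ?_ (measure_mono hVU)
  -- `V k` is a disjoint union of balls
  let B := polyball K d (k + n)
  let π : (Fin d → K) → (Fin d → K) ⧸ B := QuotientAddGroup.mk
  have hVB : ∀ y ∈ V k, ∀ z ∈ B, y + z ∈ V k := fun y hy z hz =>
    ⟨hQ y hy.1 z (polyball_mono d (by omega) hz), fun w hw => by
      rw [add_assoc]; exact hy.2 _ (add_mem hz hw)⟩
  have hVeq : V k = ⋃ c : π '' V k, π ⁻¹' {c.1} := by
    ext y
    simp only [Set.mem_iUnion, Set.mem_preimage, Set.mem_singleton_iff, Subtype.exists,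
      exists_prop, exists_eq_right']
    refine ⟨fun hy => ⟨y, hy, rfl⟩, ?_⟩
    rintro ⟨w, hw, hwy⟩
    have := hVB w hw _ (QuotientAddGroup.eq.mp hwy)
    rwa [add_neg_cancel_left] at this
  have hball : ∀ y, π ⁻¹' {π y} = (fun x => -y + x) ⁻¹' (B : Set (Fin d → K)) := by
    intro y
    ext x
    rw [Set.mem_preimage, Set.mem_singleton_iff, eq_comm]
    exact QuotientAddGroup.eq
  have hμ : ∀ c : π '' V k, μ (π ⁻¹' {c.1}) = μ B := by
    rintro ⟨_, y, -, rfl⟩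
    rw [hball, measure_preimage_add]
  have hμ' : ∀ c : π '' V k, μ (g '' (π ⁻¹' {c.1})) ≤ μ B := by
    rintro ⟨_, y, hy, rfl⟩
    rw [← measure_preimage_add μ (-g y) B]
    refine measure_mono ?_
    rintro _ ⟨x, hx, rfl⟩
    rw [hball] at hx
    have := hg _ (Nat.le_add_left n k) y hy.1 _ hx
    rw [add_neg_cancel_left, sub_eq_neg_add] at this
    exact this
  have h1 : μ (V k) = ∑' c : π '' V k, μ B := by
    rw [hVeq, measure_iUnion, ← hVeq]
    · exact tsum_congr hμ
    · intro c c' hcc'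
      exact Disjoint.preimage _ (Set.disjoint_singleton.mpr fun h => hcc' (Subtype.ext h))
    · rintro ⟨_, y, -, rfl⟩
      rw [hball]
      exact ((isOpen_polyball d _).preimage (continuous_const_add (-y))).measurableSet
  rw [h1]
  conv_lhs => rw [hVeq, Set.image_iUnion]
  exact (measure_iUnion_le _).trans (ENNReal.tsum_le_tsum hμ')

end Balls

/-! ### The integral of `|t| ^ (-c)` over the maximal ideal. -/

section PoleIntegral

variable {K : Type u} [Field K] [ValuativeRel K] [TopologicalSpace K]
  [IsNonarchimedeanLocalField K]

attribute [local instance] borelField borelField_borelSpace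

theorem haarOne_ball (n : ℕ) : haarOne K {x : K | normAbs x ≤ (residueCard K : ℝ)⁻¹ ^ n} =
    ENNReal.ofReal ((residueCard K : ℝ)⁻¹ ^ n) := by
  obtain ⟨ϖ, hϖ⟩ := exists_irreducible (K := K)
  have h0 : (ϖ : K) ^ n ≠ 0 := pow_ne_zero _ (by simpa using hϖ.ne_zero)
  have h1 : normAbs ((ϖ : K) ^ n) = (residueCard K : ℝ)⁻¹ ^ n := by
    rw [normAbs_pow, normAbs_irreducible hϖ]
  rw [← h1, ← haarOne_image_integer _ h0]
  congr 1
  ext x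
  rw [mem_image_mul_integer h0]
  rfl

theorem haarOne_singleton_zero : haarOne K {(0 : K)} = 0 := by
  refine le_antisymm (ENNReal.le_of_forall_pos_le_add fun ε hε _ => ?_) zero_le
  obtain ⟨k, hk⟩ := exists_pow_lt (K := K) (ε := ε) hε
  have : {(0 : K)} ⊆ {x : K | normAbs x ≤ (residueCard K : ℝ)⁻¹ ^ k} := by
    rintro _ rfl
    simp only [Set.mem_ofPred_eq, normAbs_zero]
    positivity
  refine (measure_mono this).trans ?_
  rw [haarOne_ball, zero_add]
  exact ENNReal.ofReal_le_of_le_toReal (by simpa using hk.le)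

theorem haar_coordinate_hyperplane {d : ℕ} (i : Fin d) : haar K d {y | y i = 0} = 0 := by
  have : {y : Fin d → K | y i = 0} = Set.univ.pi (Function.update (fun _ => Set.univ) i {0}) := by
    ext y
    rw [Set.mem_univ_pi]
    refine ⟨fun h j => ?_, fun h => by simpa using h i⟩
    rcases eq_or_ne j i with rfl | hj
    · simpa using h
    · simp [hj]
  rw [this, haar_pi]
  exact Finset.prod_eq_zero (Finset.mem_univ i) (by simp [haarOne_singleton_zero])

theorem exists_normAbs_eq_zpow {x : K} (hx : x ≠ 0) :
    ∃ n : ℤ, normAbs x = (residueCard K : ℝ) ^ n := ⟨_, normAbs_of_ne_zero hx⟩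

theorem measurable_normAbs : Measurable (normAbs : K → ℝ) := by
  refine measurable_of_Iic fun r => ?_
  rcases lt_or_ge r 0 with hr | hr
  · convert! MeasurableSet.empty
    ext x
    simpa using hr.trans_le (normAbs_nonneg x)
  · rcases hr.eq_or_lt with rfl | hr
    · convert! (measurableSet_singleton (0 : K))
      ext x
      simp only [Set.mem_preimage, Set.mem_Iic, Set.mem_singleton_iff]
      refine ⟨fun h => by_contra fun h0 => (normAbs_pos h0).not_ge h, fun h => by
        rw [h, normAbs_zero]⟩
    · exact (isOpen_ball hr).measurableSet

variable (K) in
/-- The maximal ideal of the ring of integers, as a subset of `K`. -/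
def maxDisc : Set K := {x | normAbs x ≤ (residueCard K : ℝ)⁻¹}

theorem isOpen_maxDisc : IsOpen (maxDisc K) :=
  isOpen_ball (inv_pos.mpr (by linarith [one_lt_residueCard' (K := K)]))

/-- The measurable function `|t| ^ (-c)`. -/
noncomputable def pole (c : ℝ) (t : K) : ℝ≥0∞ := ENNReal.ofReal (normAbs t ^ (-c))

theorem measurable_pole (c : ℝ) : Measurable (pole c : K → ℝ≥0∞) :=
  (measurable_normAbs.pow_const _).ennreal_ofReal

variable (K) in
open Classical in
/-- The contribution of a component with coefficient `c`. -/
noncomputable def poleFactor (c : ℝ) : ℝ≥0∞ :=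
  if c < 1 then ENNReal.ofReal (((residueCard K : ℝ) - 1) / ((residueCard K : ℝ) ^ (1 - c) - 1))
  else ⊤

/-- Slice the punctured disc into the spheres `|t| = q^{-(n+1)}`, of measure `(1 - q⁻¹) q^{-(n+1)}`,
on which the integrand is the constant `q^{c(n+1)}`. -/
theorem lintegral_pole_eq_tsum (c : ℝ) : ∫⁻ t in maxDisc K, pole c t ∂(haarOne K) =
    ∑' n : ℕ, ENNReal.ofReal (1 - (residueCard K : ℝ)⁻¹) *
      ENNReal.ofReal ((residueCard K : ℝ) ^ (c - 1)) ^ (n + 1) := by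
  have hq := one_lt_residueCard' (K := K)
  have hq0 : (0 : ℝ) < residueCard K := by linarith
  set q : ℝ := ((residueCard K : ℕ) : ℝ) with hqdef
  let S : ℕ → Set K := fun n => {x | normAbs x = q⁻¹ ^ (n + 1)}
  have hSdiff : ∀ n, S n = {x | normAbs x ≤ q⁻¹ ^ (n + 1)} \ {x | normAbs x ≤ q⁻¹ ^ (n + 2)} := by
    intro n
    ext x
    simp only [S, Set.mem_ofPred_eq, Set.mem_sdiff, not_le]
    constructor
    · intro h
      rw [h]
      exact ⟨le_rfl, pow_lt_pow_right_of_lt_one₀ (by positivity) (inv_lt_one_of_one_lt₀ hq)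
        (by omega)⟩
    · rintro ⟨h1, h2⟩
      have hx : x ≠ 0 := by
        rintro rfl
        rw [normAbs_zero] at h2
        exact h2.not_ge (by positivity)
      obtain ⟨m, hm⟩ := exists_normAbs_eq_zpow hx
      rw [hm] at h1 h2 ⊢
      rw [← hqdef, inv_pow, ← zpow_natCast, ← zpow_neg] at *
      rw [zpow_le_zpow_iff_right₀ hq] at h1
      rw [zpow_lt_zpow_iff_right₀ hq] at h2
      congr 1
      push_cast at *
      omega
  have hSmeas : ∀ n, MeasurableSet (S n) := fun n =>
    measurable_normAbs (measurableSet_singleton _)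
  have hSdisj : Pairwise (Function.onFun Disjoint S) := by
    intro m n hmn
    rw [Function.onFun, Set.disjoint_left]
    intro x hx hx'
    have : q⁻¹ ^ (m + 1) = q⁻¹ ^ (n + 1) := hx.symm.trans hx'
    have := (pow_right_strictAnti₀ (inv_pos.mpr hq0) (inv_lt_one_of_one_lt₀ hq)).injective this
    omega
  have hunion : maxDisc K = {0} ∪ ⋃ n, S n := by
    ext x
    simp only [maxDisc, S, Set.mem_union, Set.mem_singleton_iff, Set.mem_iUnion, Set.mem_ofPred_eq]
    constructor
    · intro h
      by_cases hx : x = 0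
      · exact .inl hx
      · right
        obtain ⟨m, hm⟩ := exists_normAbs_eq_zpow hx
        rw [hm, ← zpow_neg_one, zpow_le_zpow_iff_right₀ hq] at h
        refine ⟨(-m - 1).toNat, ?_⟩
        rw [hm, ← hqdef, inv_pow, ← zpow_natCast, ← zpow_neg]
        congr 1
        push_cast
        omega
    · rintro (rfl | ⟨n, hn⟩)
      · rw [normAbs_zero]; positivity
      · rw [hn]
        exact pow_le_of_le_one (by positivity) (inv_le_one_of_one_le₀ hq.le) (by omega)
  -- The origin, where `pole c` may take a default value, is a null set.
  have hae : maxDisc K =ᵐ[haarOne K] ⋃ n, S n := by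
    rw [hunion]
    exact union_ae_eq_right_of_ae_eq_empty (ae_eq_empty.mpr haarOne_singleton_zero)
  rw [setLIntegral_congr hae, lintegral_iUnion hSmeas hSdisj]
  refine tsum_congr fun n => ?_
  have hval : ∀ t ∈ S n, pole c t = ENNReal.ofReal (q ^ (c * (n + 1))) := by
    intro t ht
    rw [pole, show normAbs t = _ from ht, inv_pow, ← Real.rpow_natCast, ← Real.rpow_neg hq0.le,
      ← Real.rpow_mul hq0.le]
    congr 2
    push_cast
    ring
  rw [setLIntegral_congr_fun (hSmeas n) hval, lintegral_const, Measure.restrict_apply_univ, hSdiff,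
    measure_sdiff, haarOne_ball, haarOne_ball, ← ENNReal.ofReal_sub _ (by positivity),
    ← ENNReal.ofReal_mul (by positivity), ← ENNReal.ofReal_pow (by positivity),
    ← ENNReal.ofReal_mul (sub_nonneg.mpr (inv_le_one_of_one_le₀ hq.le)),
    ← Real.rpow_mul_natCast hq0.le]
  · congr 1
    have : q⁻¹ ^ (n + 1) - q⁻¹ ^ (n + 2) = (1 - q⁻¹) * q ^ (-((n : ℝ) + 1)) := by
      have h : q ^ (-((n : ℝ) + 1)) = q⁻¹ ^ (n + 1) := by
        rw [Real.rpow_neg hq0.le, inv_pow, ← Real.rpow_natCast]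
        push_cast
        rfl
      rw [h]
      ring
    rw [← hqdef, this, mul_left_comm, ← Real.rpow_add hq0]
    congr 2
    push_cast
    ring
  · intro x hx
    exact le_trans hx (pow_le_pow_of_le_one (by positivity) (inv_le_one_of_one_le₀ hq.le) (by omega))
  · exact (isOpen_ball (by positivity)).measurableSet.nullMeasurableSet
  · rw [haarOne_ball]; exact ENNReal.ofReal_ne_top

/-- A geometric series of ratio `q^{c-1}`, convergent exactly for `c < 1`. The factor `q` normalizes
the maximal ideal to volume one. -/
theorem lintegral_pole (c : ℝ) :
    (residueCard K : ℝ≥0∞) * ∫⁻ t in maxDisc K, pole c t ∂(haarOne K) = poleFactor K c := by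
  have hq := one_lt_residueCard' (K := K)
  have hq0 : (0 : ℝ) < residueCard K := by linarith
  have h1 : 0 < 1 - (residueCard K : ℝ)⁻¹ := sub_pos.mpr (inv_lt_one_of_one_lt₀ hq)
  rw [lintegral_pole_eq_tsum, ENNReal.tsum_mul_left]
  simp_rw [pow_succ']
  rw [ENNReal.tsum_mul_left, ENNReal.tsum_geometric, poleFactor]
  split_ifs with hc
  · have h2 : (residueCard K : ℝ) ^ (c - 1) < 1 :=
      Real.rpow_lt_one_of_one_lt_of_neg hq (by linarith)
    have h3 : 1 < (residueCard K : ℝ) ^ (1 - c) := Real.one_lt_rpow hq (by linarith)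
    rw [← ENNReal.ofReal_natCast, ← ENNReal.ofReal_one, ← ENNReal.ofReal_sub _ (by positivity),
      ← ENNReal.ofReal_inv_of_pos (sub_pos.mpr h2), ← ENNReal.ofReal_mul (by positivity),
      ← ENNReal.ofReal_mul h1.le, ← ENNReal.ofReal_mul hq0.le]
    congr 1
    have h4 : (residueCard K : ℝ) ^ (c - 1) = ((residueCard K : ℝ) ^ (1 - c))⁻¹ := by
      rw [← Real.rpow_neg hq0.le]; ring_nf
    rw [h4] at h2 ⊢
    have h5 : (residueCard K : ℝ) ^ (1 - c) - 1 ≠ 0 := by linarith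
    have h6 : (residueCard K : ℝ) ^ (1 - c) ≠ 0 := by positivity
    have h7 : 1 - ((residueCard K : ℝ) ^ (1 - c))⁻¹ ≠ 0 := by linarith
    field_simp
  · have h2 : 1 ≤ ENNReal.ofReal ((residueCard K : ℝ) ^ (c - 1)) := by
      rw [← ENNReal.ofReal_one]
      exact ENNReal.ofReal_le_ofReal (Real.one_le_rpow hq.le (by linarith))
    rw [tsub_eq_zero_of_le h2, ENNReal.inv_zero, ENNReal.mul_top (by positivity),
      ENNReal.mul_top (by simpa using h1), ENNReal.mul_top]
    exact_mod_cast (one_lt_residueCard (K := K)).ne_bot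

/-- Tonelli, each coordinate taking one factor of `q ^ d`. -/
theorem lintegral_prod_pole {d : ℕ} (c : Fin d → ℝ) (a : ℝ≥0∞) :
    (residueCard K : ℝ≥0∞) ^ d * ∫⁻ y in (Set.univ.pi fun _ => maxDisc K),
      a * ∏ i, pole (c i) (y i) ∂(haar K d) = a * ∏ i, poleFactor K (c i) := by
  refine haar_eq_pi d (fun m μ => (residueCard K : ℝ≥0∞) ^ d *
    ∫⁻ y in (Set.univ.pi fun _ => maxDisc K), a * ∏ i, pole (c i) (y i) ∂μ =
      a * ∏ i, poleFactor K (c i)) ?_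
  have hm := isOpen_maxDisc.measurableSet (α := K)
  have hP : Measurable fun y : Fin d → K => ∏ i, pole (c i) (y i) :=
    Finset.measurable_prod _ fun i _ => (measurable_pole (c i)).comp (measurable_pi_apply i)
  rw [lintegral_const_mul _ hP, ← lintegral_indicator (MeasurableSet.univ_pi fun _ => hm)]
  have : (Set.univ.pi fun _ => maxDisc K).indicator (fun y => ∏ i, pole (c i) (y i)) =
      fun y => ∏ i, (maxDisc K).indicator (pole (c i)) (y i) := by
    ext y
    by_cases hy : y ∈ Set.univ.pi fun _ : Fin d => maxDisc K
    · rw [Set.indicator_of_mem hy]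
      exact Finset.prod_congr rfl fun i _ => (Set.indicator_of_mem (hy i trivial) _).symm
    · rw [Set.indicator_of_notMem hy]
      obtain ⟨i, hi⟩ := not_forall.mp (fun h => hy (Set.mem_univ_pi.mpr h))
      exact (Finset.prod_eq_zero (Finset.mem_univ i) (Set.indicator_of_notMem hi _)).symm
  rw [this, lintegral_fin_prod _ _ fun i => (measurable_pole _).indicator hm, mul_left_comm,
    ← Fin.prod_const, ← Finset.prod_mul_distrib]
  simp_rw [lintegral_indicator hm, lintegral_pole]

end PoleIntegral

/-! ### Integral points and residue points as local homomorphisms of stalks. -/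

section SchemePoints

variable {K : Type u} [Field K] [ValuativeRel K] [TopologicalSpace K]
  [IsNonarchimedeanLocalField K] {X : Scheme.{u}} {f : X ⟶ base K}

/-- The structure homomorphism from `𝒪_K` to the stalk at `x`. -/
noncomputable def stalkStruct (f : X ⟶ base K) (x : X) : 𝒪[K] →+* X.presheaf.stalk x :=
  (X.presheaf.germ ⊤ x trivial).hom.comp (structMap f ⊤)

theorem map_structMap (f : X ⟶ base K) {U V : X.Opens} (h : V ≤ U) (a : 𝒪[K]) :
    (X.presheaf.map (homOfLE h).op).hom (structMap f U a) = structMap f V a := by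
  have h1 := Scheme.Hom.appLE_map f (U := ⊤) (V := U) le_top (homOfLE h).op
  exact congrArg (fun φ => φ.hom ((Scheme.ΓSpecIso (CommRingCat.of 𝒪[K])).inv.hom a)) h1

theorem germ_structMap (f : X ⟶ base K) {U : X.Opens} {x : X} (hx : x ∈ U) (a : 𝒪[K]) :
    (X.presheaf.germ U x hx).hom (structMap f U a) = stalkStruct f x a := by
  rw [← map_structMap f (le_top : U ≤ ⊤)]
  exact congrArg (fun φ => φ.hom (structMap f ⊤ a))
    (X.presheaf.germ_res (homOfLE (le_top : U ≤ ⊤)) x hx)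

theorem stalkSpecializes_stalkStruct (f : X ⟶ base K) {x y : X} (h : y ⤳ x) (a : 𝒪[K]) :
    (X.presheaf.stalkSpecializes h).hom (stalkStruct f x a) = stalkStruct f y a := by
  exact congrArg (fun φ => φ.hom (structMap f ⊤ a))
    (X.presheaf.germ_stalkSpecializes (U := ⊤) (y := x) trivial h)

/-- The local homomorphism of a morphism from the spectrum of a local ring. -/
noncomputable def localEv {R : Type u} [CommRing R] [IsLocalRing R]
    (p : Spec (CommRingCat.of R) ⟶ X) {x : X} (hx : p (IsLocalRing.closedPoint R) = x) :
    X.presheaf.stalk x →+* R :=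
  (Scheme.stalkClosedPointTo p).hom.comp
    (X.presheaf.stalkSpecializes (specializes_of_eq hx)).hom

section LocalEv

variable {R : Type u} [CommRing R] [IsLocalRing R] (p : Spec (CommRingCat.of R) ⟶ X) {x : X}
  (hx : p (IsLocalRing.closedPoint R) = x)

theorem localEv_germ {U : X.Opens} (hxU : x ∈ U) (h : ⊤ ≤ p ⁻¹ᵁ U) (g : Γ(X, U)) :
    localEv p hx ((X.presheaf.germ U x hxU).hom g) =
      (Scheme.ΓSpecIso (CommRingCat.of R)).hom.hom ((p.appLE U ⊤ h).hom g) := by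
  subst hx
  have h1 := Scheme.germ_stalkClosedPointTo p U hxU
  have h2 := X.presheaf.germ_stalkSpecializes hxU (specializes_of_eq rfl)
  change (Scheme.stalkClosedPointTo p).hom ((X.presheaf.germ U _ hxU ≫
    X.presheaf.stalkSpecializes (specializes_of_eq rfl)).hom g) = _
  rw [h2]
  change ((X.presheaf.germ U _ hxU) ≫ (Scheme.stalkClosedPointTo p)).hom g = _
  rw [h1]
  rfl

theorem isLocalHom_localEv : IsLocalHom (localEv p hx) := by
  subst hx
  have : localEv p rfl = (Scheme.stalkClosedPointTo p).hom := by
    rw [localEv, TopCat.Presheaf.stalkSpecializes_refl]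
    rfl
  rw [this]
  infer_instance

theorem ext_localEv {p p' : Spec (CommRingCat.of R) ⟶ X}
    (hx : p (IsLocalRing.closedPoint R) = x) (hx' : p' (IsLocalRing.closedPoint R) = x)
    (h : localEv p hx = localEv p' hx') : p = p' := by
  subst hx
  refine (SpecToEquivOfLocalRing X (CommRingCat.of R)).injective ?_
  refine SpecToEquivOfLocalRing_eq_iff.mpr ⟨hx'.symm, ?_⟩
  have h1 : localEv p rfl = (Scheme.stalkClosedPointTo p).hom := by
    rw [localEv, TopCat.Presheaf.stalkSpecializes_refl]
    rfl
  rw [h1] at h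
  ext1
  exact h

theorem exists_localEv_eq {x : X} (σ : X.presheaf.stalk x →+* R) [hσ : IsLocalHom σ] :
    ∃ (p : Spec (CommRingCat.of R) ⟶ X) (hx : p (IsLocalRing.closedPoint R) = x),
      localEv p hx = σ := by
  let φ : X.presheaf.stalk x ⟶ CommRingCat.of R := CommRingCat.ofHom σ
  have : IsLocalHom φ.hom := hσ
  have hx : (Spec.map φ ≫ X.fromSpecStalk x) (IsLocalRing.closedPoint R) = x := by
    have h1 : (Spec.map φ) (IsLocalRing.closedPoint R) = IsLocalRing.closedPoint _ :=
      Spec_closedPoint (f := φ)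
    exact (congrArg (X.fromSpecStalk x) h1).trans Scheme.fromSpecStalk_closedPoint
  refine ⟨Spec.map φ ≫ X.fromSpecStalk x, hx, ?_⟩
  have : X.presheaf.stalkSpecializes (specializes_of_eq hx) ≫
      Scheme.stalkClosedPointTo (Spec.map φ ≫ X.fromSpecStalk x) = φ := by
    refine TopCat.Presheaf.stalk_hom_ext _ fun U hxU => ?_
    rw [TopCat.Presheaf.germ_stalkSpecializes_assoc]
    exact Scheme.germ_stalkClosedPointTo_Spec_fromSpecStalk φ U _
  exact congrArg CommRingCat.Hom.hom this

end LocalEv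

theorem spec_hom_eq_map_iff {R S : CommRingCat.{u}} (g : Spec R ⟶ Spec S) (φ : S ⟶ R) :
    (Scheme.ΓSpecIso S).inv ≫ g.appTop ≫ (Scheme.ΓSpecIso R).hom = φ ↔ g = Spec.map φ := by
  have h : (Scheme.ΓSpecIso S).inv ≫ g.appTop ≫ (Scheme.ΓSpecIso R).hom = Spec.preimage g := by
    conv_lhs => rw [← Spec.map_preimage g]
    rw [Scheme.ΓSpecIso_naturality, Iso.inv_hom_id_assoc]
  rw [h]
  constructor
  · rintro rfl
    rw [Spec.map_preimage]
  · rintro rfl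
    rw [Spec.preimage_map]

theorem localEv_comp_stalkStruct_iff {R : Type u} [CommRing R] [IsLocalRing R]
    (p : Spec (CommRingCat.of R) ⟶ X) {x : X} (hx : p (IsLocalRing.closedPoint R) = x)
    (φ : 𝒪[K] →+* R) : (localEv p hx).comp (stalkStruct f x) = φ ↔
      p ≫ f = Spec.map (CommRingCat.ofHom φ) := by
  have key : (localEv p hx).comp (stalkStruct f x) = ((Scheme.ΓSpecIso (CommRingCat.of 𝒪[K])).inv ≫
      (p ≫ f).appTop ≫ (Scheme.ΓSpecIso (CommRingCat.of R)).hom).hom := by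
    ext a
    rw [RingHom.comp_apply, stalkStruct, RingHom.comp_apply,
      localEv_germ p hx (U := ⊤) trivial le_rfl, structMap]
    have h1 : f.appLE ⊤ ⊤ le_top ≫ p.appLE ⊤ ⊤ le_rfl = (p ≫ f).appTop := by
      refine (Scheme.Hom.appLE_comp_appLE p f ⊤ ⊤ ⊤ le_top le_rfl).trans ?_
      rw [Scheme.Hom.appTop, Scheme.Hom.app_eq_appLE]
      rfl
    rw [← h1]
    rfl
  rw [← spec_hom_eq_map_iff, key]
  exact ⟨fun h => by ext1; exact h, fun h => congrArg CommRingCat.Hom.hom h⟩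

namespace IntegralPoint

/-- The only open set of a local spectrum containing the closed point is the whole spectrum. -/
theorem factorsThrough_iff {p : IntegralPoint f} {U : X.Opens} :
    p.FactorsThrough U ↔ p.special ∈ U := by
  constructor
  · exact fun h => h (show closedPt K ∈ (⊤ : (base K).Opens) from trivial)
  · exact fun h => (Scheme.preimage_eq_top_of_closedPoint_mem p.1 h).ge

/-- The local homomorphism at `x` of an integral point specializing to `x`. -/
noncomputable def evAt (p : IntegralPoint f) {x : X} (hx : p.special = x) :
    X.presheaf.stalk x →+* 𝒪[K] := localEv p.1 hx

instance (p : IntegralPoint f) {x : X} (hx : p.special = x) : IsLocalHom (p.evAt hx) :=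
  isLocalHom_localEv p.1 hx

theorem evAt_germ (p : IntegralPoint f) {x : X} (hx : p.special = x) {U : X.Opens} (hxU : x ∈ U)
    (h : p.FactorsThrough U) (g : Γ(X, U)) :
    p.evAt hx ((X.presheaf.germ U x hxU).hom g) = p.eval h g :=
  localEv_germ p.1 hx hxU h g

theorem evAt_stalkStruct (p : IntegralPoint f) {x : X} (hx : p.special = x) (a : 𝒪[K]) :
    p.evAt hx (stalkStruct f x a) = a := by
  have h : p.1 ≫ f = Spec.map (CommRingCat.ofHom (RingHom.id 𝒪[K])) := by
    rw [p.2]; exact (Spec.map_id _).symm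
  exact RingHom.congr_fun ((localEv_comp_stalkStruct_iff p.1 hx _).mpr h) a

theorem ext_evAt {p p' : IntegralPoint f} {x : X} (hx : p.special = x) (hx' : p'.special = x)
    (h : p.evAt hx = p'.evAt hx') : p = p' :=
  Subtype.ext (ext_localEv hx hx' h)

theorem exists_evAt_eq {x : X} (σ : X.presheaf.stalk x →+* 𝒪[K]) [IsLocalHom σ]
    (hσ : ∀ a, σ (stalkStruct f x a) = a) :
    ∃ (p : IntegralPoint f) (hx : p.special = x), p.evAt hx = σ := by
  obtain ⟨p, hx, hp⟩ := exists_localEv_eq σ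
  have h : p ≫ f = Spec.map (CommRingCat.ofHom (RingHom.id 𝒪[K])) :=
    (localEv_comp_stalkStruct_iff p hx _).mp (RingHom.ext fun a => by
      rw [RingHom.comp_apply, hp, hσ]; rfl)
  exact ⟨⟨p, h.trans (Spec.map_id _)⟩, hx, hp⟩

/-- The reduction of an integral point. -/
noncomputable def reduction (p : IntegralPoint f) : ResiduePoint f :=
  ⟨residueMap K ≫ p.1, by rw [Category.assoc, p.2, Category.comp_id]⟩

theorem reduction_pt (p : IntegralPoint f) : p.reduction.pt = p.special := by
  have h : IsLocalHom (CommRingCat.ofHom (IsLocalRing.residue 𝒪[K])).hom :=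
    inferInstanceAs (IsLocalHom (IsLocalRing.residue 𝒪[K]))
  have : residueMap K (IsLocalRing.closedPoint 𝓀[K]) = closedPt K :=
    Spec_closedPoint (f := CommRingCat.ofHom (IsLocalRing.residue 𝒪[K]))
  exact congrArg p.1 this

end IntegralPoint

namespace ResiduePoint

/-- The local homomorphism at the underlying point of a `k`-point. -/
noncomputable def ev (x : ResiduePoint f) : X.presheaf.stalk x.pt →+* 𝓀[K] := localEv x.1 rfl

instance (x : ResiduePoint f) : IsLocalHom x.ev := isLocalHom_localEv x.1 _

theorem localEv_stalkStruct (x : ResiduePoint f) {y : X} (hy : x.pt = y) (a : 𝒪[K]) :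
    localEv x.1 hy (stalkStruct f y a) = IsLocalRing.residue _ a :=
  RingHom.congr_fun ((localEv_comp_stalkStruct_iff x.1 hy _).mpr x.2) a

theorem ev_stalkStruct (x : ResiduePoint f) (a : 𝒪[K]) :
    x.ev (stalkStruct f x.pt a) = IsLocalRing.residue _ a := x.localEv_stalkStruct rfl a

/-- Since `𝒪_K → k` is surjective, a germ at the point is a constant plus a nonunit; a local
homomorphism to `k` compatible with `𝒪_K` kills the nonunit, so the point determines it. -/
theorem pt_injective : Function.Injective (ResiduePoint.pt (f := f)) := by
  intro x x' h
  refine Subtype.ext (ext_localEv (x := x'.pt) h rfl ?_)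
  ext g
  have hloc := isLocalHom_localEv x.1 h
  have hloc' := isLocalHom_localEv x'.1 rfl
  obtain ⟨a, ha⟩ := IsLocalRing.residue_surjective (localEv x.1 h g)
  have h1 : ¬ IsUnit (g - stalkStruct f x'.pt a) := by
    rw [← isUnit_map_iff (localEv x.1 h), map_sub, localEv_stalkStruct, ha, sub_self]
    exact not_isUnit_zero
  have h2 : x'.ev (g - stalkStruct f x'.pt a) = 0 := by
    by_contra h2
    exact h1 ((isUnit_map_iff (localEv x'.1 rfl) _).mp (isUnit_iff_ne_zero.mpr h2))
  rw [map_sub, ev_stalkStruct, ha, sub_eq_zero] at h2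
  exact h2.symm

end ResiduePoint

end SchemePoints

/-! ### Stalks as localizations, and generizations as primes of a stalk. -/

section Stalks

variable {X : Scheme.{u}}

/-- The prime ideal of `Γ(X, U)` of a point of `U`. -/
noncomputable def idealAt (U : X.Opens) {x : X} (hx : x ∈ U) : Ideal Γ(X, U) :=
  (IsLocalRing.maximalIdeal (X.presheaf.stalk x)).comap (X.presheaf.germ U x hx).hom

instance (U : X.Opens) {x : X} (hx : x ∈ U) : (idealAt U hx).IsPrime :=
  inferInstanceAs (Ideal.comap _ _).IsPrime

theorem primeIdealOf_asIdeal {U : X.Opens} (hU : IsAffineOpen U) {x : X} (hx : x ∈ U) :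
    (hU.primeIdealOf ⟨x, hx⟩).asIdeal = idealAt U hx :=
  congrArg PrimeSpectrum.asIdeal (hU.primeIdealOf_eq_map_closedPoint ⟨x, hx⟩)

theorem isLocalization_germ {U : X.Opens} (hU : IsAffineOpen U) {x : X} (hx : x ∈ U) :
    letI := (X.presheaf.germ U x hx).hom.toAlgebra
    IsLocalization.AtPrime (X.presheaf.stalk x) (idealAt U hx) := by
  have h := hU.isLocalization_stalk ⟨x, hx⟩
  simp only [IsLocalization.AtPrime, primeIdealOf_asIdeal] at h ⊢
  exact h

theorem exists_idealAt_eq {U : X.Opens} (hU : IsAffineOpen U) (q : Ideal Γ(X, U)) [hq : q.IsPrime] :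
    ∃ (y : X) (hy : y ∈ U), idealAt U hy = q := by
  let y : U := hU.isoSpec.inv ⟨q, hq⟩
  refine ⟨y.1, y.2, ?_⟩
  rw [← primeIdealOf_asIdeal hU y.2]
  have : hU.primeIdealOf y = (⟨q, hq⟩ : PrimeSpectrum _) := by
    change (hU.isoSpec.inv ≫ hU.isoSpec.hom) ⟨q, hq⟩ = _
    rw [Iso.inv_hom_id]
    rfl
  exact congrArg PrimeSpectrum.asIdeal this

theorem specializes_of_idealAt_le {U : X.Opens} (hU : IsAffineOpen U) {x y : X} (hx : x ∈ U)
    (hy : y ∈ U) (h : idealAt U hy ≤ idealAt U hx) : y ⤳ x := by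
  have h1 : hU.primeIdealOf ⟨y, hy⟩ ⤳ hU.primeIdealOf ⟨x, hx⟩ := by
    rw [← PrimeSpectrum.le_iff_specializes, ← PrimeSpectrum.asIdeal_le_asIdeal,
      primeIdealOf_asIdeal, primeIdealOf_asIdeal]
    exact h
  have h2 := h1.map hU.fromSpec.continuous
  rwa [hU.fromSpec_primeIdealOf, hU.fromSpec_primeIdealOf] at h2

theorem mem_of_specializes {U : X.Opens} {x y : X} (hx : x ∈ U) (h : y ⤳ x) : y ∈ U :=
  h.mem_open U.2 hx

theorem stalkSpecializes_germ {U : X.Opens} {x y : X} (hx : x ∈ U) (h : y ⤳ x) (g : Γ(X, U)) :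
    (X.presheaf.stalkSpecializes h).hom ((X.presheaf.germ U x hx).hom g) =
      (X.presheaf.germ U y (mem_of_specializes hx h)).hom g :=
  congrArg (fun φ => φ.hom g) (X.presheaf.germ_stalkSpecializes hx h)

/-- The prime ideal of the stalk at `x` of a generization. -/
noncomputable def genericIdeal {x y : X} (h : y ⤳ x) : Ideal (X.presheaf.stalk x) :=
  (IsLocalRing.maximalIdeal (X.presheaf.stalk y)).comap (X.presheaf.stalkSpecializes h).hom

instance {x y : X} (h : y ⤳ x) : (genericIdeal h).IsPrime :=
  inferInstanceAs (Ideal.comap _ _).IsPrime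

theorem comap_genericIdeal {U : X.Opens} {x y : X} (hx : x ∈ U) (h : y ⤳ x) :
    (genericIdeal h).comap (X.presheaf.germ U x hx).hom =
      idealAt U (mem_of_specializes hx h) := by
  ext g
  rw [Ideal.mem_comap, genericIdeal, Ideal.mem_comap, stalkSpecializes_germ]
  rfl

theorem idealAt_le_of_specializes {U : X.Opens} {x y : X} (hx : x ∈ U) (h : y ⤳ x) :
    idealAt U (mem_of_specializes hx h) ≤ idealAt U hx := by
  rw [← comap_genericIdeal hx h]
  exact Ideal.comap_mono (IsLocalRing.le_maximalIdeal_of_isPrime _)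

theorem exists_affine_mem (x : X) : ∃ U : X.Opens, IsAffineOpen U ∧ x ∈ U := by
  obtain ⟨_, ⟨U, hU, rfl⟩, hxU, -⟩ :=
    X.isBasis_affineOpens.exists_subset_of_mem_open (Set.mem_univ x) isOpen_univ
  exact ⟨U, hU, hxU⟩

/-- On an affine neighbourhood of `x` both stalks are localizations of the ring of sections, and
localization can be done in stages. -/
theorem isLocalization_stalkSpecializes {x y : X} (h : y ⤳ x) :
    letI := (X.presheaf.stalkSpecializes h).hom.toAlgebra
    IsLocalization.AtPrime (X.presheaf.stalk y) (genericIdeal h) := by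
  obtain ⟨U, hU, hx⟩ := exists_affine_mem x
  have hy := mem_of_specializes hx h
  let _ := (X.presheaf.stalkSpecializes h).hom.toAlgebra
  let _ := (X.presheaf.germ U x hx).hom.toAlgebra
  let _ := (X.presheaf.germ U y hy).hom.toAlgebra
  have : IsScalarTower Γ(X, U) (X.presheaf.stalk x) (X.presheaf.stalk y) :=
    .of_algebraMap_eq fun g => (stalkSpecializes_germ hx h g).symm
  have h1 : IsLocalization.AtPrime (X.presheaf.stalk x) (idealAt U hx) := isLocalization_germ hU hx
  have h2 : IsLocalization.AtPrime (X.presheaf.stalk y) (idealAt U hy) := isLocalization_germ hU hy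
  have hle : (idealAt U hx).primeCompl ≤ (idealAt U hy).primeCompl :=
    fun g hg hg' => hg (idealAt_le_of_specializes hx h hg')
  have h3 := IsLocalization.isLocalization_of_submonoid_le (X.presheaf.stalk x)
    (X.presheaf.stalk y) (idealAt U hx).primeCompl (idealAt U hy).primeCompl hle
  refine IsLocalization.of_le ((idealAt U hy).primeCompl.map
    (algebraMap Γ(X, U) (X.presheaf.stalk x))) _ ?_ ?_
  · rintro _ ⟨g, hg, rfl⟩ hg'
    refine hg ?_
    rw [SetLike.mem_coe, ← comap_genericIdeal hx h]
    exact hg'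
  · intro r hr
    by_contra hu
    exact hr hu

theorem exists_genericIdeal_eq {x : X} (P : Ideal (X.presheaf.stalk x)) [P.IsPrime] :
    ∃ (y : X) (h : y ⤳ x), genericIdeal h = P := by
  obtain ⟨U, hU, hx⟩ := exists_affine_mem x
  let _ := (X.presheaf.germ U x hx).hom.toAlgebra
  have h1 : IsLocalization.AtPrime (X.presheaf.stalk x) (idealAt U hx) := isLocalization_germ hU hx
  obtain ⟨y, hy, hP⟩ := exists_idealAt_eq hU (P.comap (X.presheaf.germ U x hx).hom)
  have h : y ⤳ x := specializes_of_idealAt_le hU hx hy (by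
    rw [hP]
    exact Ideal.comap_mono (IsLocalRing.le_maximalIdeal_of_isPrime _))
  refine ⟨y, h, ?_⟩
  have h3 := (comap_genericIdeal hx h).trans hP
  have h4 := congrArg (Ideal.map (algebraMap Γ(X, U) (X.presheaf.stalk x))) h3
  rw [← IsLocalization.map_under (idealAt U hx).primeCompl (X.presheaf.stalk x) (genericIdeal h),
    ← IsLocalization.map_under (idealAt U hx).primeCompl (X.presheaf.stalk x) P]
  exact h4

theorem height_genericIdeal {x y : X} (h : y ⤳ x) : (genericIdeal h).height = Order.coheight y := by
  let _ := (X.presheaf.stalkSpecializes h).hom.toAlgebra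
  have := isLocalization_stalkSpecializes h
  have h1 := IsLocalization.AtPrime.ringKrullDim_eq_height (genericIdeal h) (X.presheaf.stalk y)
  rw [ringKrullDim_stalk_eq_coheight] at h1
  exact WithBot.coe_injective h1.symm

theorem height_idealAt {U : X.Opens} (hU : IsAffineOpen U) {x : X} (hx : x ∈ U) :
    (idealAt U hx).height = Order.coheight x := by
  let _ := (X.presheaf.germ U x hx).hom.toAlgebra
  have := isLocalization_germ hU hx
  have h1 := IsLocalization.AtPrime.ringKrullDim_eq_height (idealAt U hx) (X.presheaf.stalk x)
  rw [ringKrullDim_stalk_eq_coheight] at h1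
  exact WithBot.coe_injective h1.symm

end Stalks

/-! ### Smoothness at a point, read on the stalk. -/

section StalkSmooth

variable {K : Type u} [Field K] [ValuativeRel K] [TopologicalSpace K]
  [IsNonarchimedeanLocalField K] {X : Scheme.{u}} {f : X ⟶ base K}

/-- Reduces smoothness at `x` to the single ring map `𝒪_K → 𝒪_{X,x}`, by transporting formal
smoothness along the identifications of `Γ(Spec 𝒪_K)` with `𝒪_K` and of the algebraic localization
with the stalk. -/
theorem mem_smoothLocus_iff [LocallyOfFinitePresentation f] {x : X} :
    x ∈ f.smoothLocus ↔ (stalkStruct f x).FormallySmooth := by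
  obtain ⟨V, hV, hx⟩ := exists_affine_mem x
  rw [Scheme.Hom.mem_smoothLocus, formallySmooth_stalkMap_iff ⊤ (isAffineOpen_top _) V hV le_top hx]
  let _ := (f.appLE ⊤ V le_top).hom.toAlgebra
  let q := (hV.primeIdealOf ⟨x, hx⟩).asIdeal
  change Algebra.FormallySmooth Γ(base K, ⊤) (Localization.AtPrime q) ↔ _
  rw [← RingHom.formallySmooth_algebraMap]
  let _ := (X.presheaf.germ V x hx).hom.toAlgebra
  have hloc : IsLocalization.AtPrime (X.presheaf.stalk x) q := hV.isLocalization_stalk ⟨x, hx⟩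
  let e : Localization.AtPrime q ≃ₐ[Γ(X, V)] X.presheaf.stalk x :=
    IsLocalization.algEquiv q.primeCompl _ _
  let e' : 𝒪[K] ≃+* Γ(base K, ⊤) :=
    (Scheme.ΓSpecIso (CommRingCat.of 𝒪[K])).symm.commRingCatIsoToRingEquiv
  have h1 : stalkStruct f x = (e.toRingEquiv.toRingHom.comp
      (algebraMap Γ(base K, ⊤) (Localization.AtPrime q))).comp e'.toRingHom := by
    ext a
    rw [← germ_structMap f hx]
    simp only [RingHom.comp_apply]
    rw [IsScalarTower.algebraMap_apply Γ(base K, ⊤) Γ(X, V) (Localization.AtPrime q)]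
    exact (e.commutes _).symm
  have h2 : algebraMap Γ(base K, ⊤) (Localization.AtPrime q) =
      (e.symm.toRingEquiv.toRingHom.comp (stalkStruct f x)).comp e'.symm.toRingHom := by
    rw [h1]
    ext a
    simp
  constructor
  · intro h
    rw [h1]
    exact RingHom.FormallySmooth.respectsIso.2 _ _ (RingHom.FormallySmooth.respectsIso.1 _ _ h)
  · intro h
    rw [h2]
    exact RingHom.FormallySmooth.respectsIso.2 _ _ (RingHom.FormallySmooth.respectsIso.1 _ _ h)

end StalkSmooth

/-! ### The rank of the differentials on the smooth locus. -/

section KaehlerRank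

open KaehlerDifferential

/-- The module of differentials of the ring homomorphism is free of rank `d`. -/
def HasKaehlerRank {R S : Type*} [CommRing R] [CommRing S] (φ : R →+* S) (d : ℕ) : Prop :=
  letI := φ.toAlgebra
  Nonempty (Module.Basis (Fin d) S Ω[S⁄R])

theorem HasKaehlerRank.localization {R S S' : Type*} [CommRing R] [CommRing S] [CommRing S']
    {φ : R →+* S} {d : ℕ} (h : HasKaehlerRank φ d) [Algebra S S'] (M : Submonoid S)
    [IsLocalization M S'] : HasKaehlerRank ((algebraMap S S').comp φ) d := by
  let _ := φ.toAlgebra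
  let _ := ((algebraMap S S').comp φ).toAlgebra
  have : IsScalarTower R S S' := .of_algebraMap_eq fun _ => rfl
  obtain ⟨b⟩ := h
  exact ⟨b.ofIsLocalizedModule S' M (KaehlerDifferential.map R R S S')⟩

theorem isLocalization_bot_of_bijective {S S' : Type*} [CommRing S] [CommRing S'] [Algebra S S']
    (h : Function.Bijective (algebraMap S S')) : IsLocalization (⊥ : Submonoid S) S' where
  map_units := by
    rintro ⟨_, rfl⟩
    simp
  surj y := by
    obtain ⟨x, rfl⟩ := h.2 y
    exact ⟨(x, 1), by simp⟩
  exists_of_eq hxy := ⟨1, by rw [h.1 hxy]⟩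

theorem HasKaehlerRank.comp_equiv {R S S' : Type*} [CommRing R] [CommRing S] [CommRing S']
    {φ : R →+* S} {d : ℕ} (h : HasKaehlerRank φ d) (e : S →+* S') (he : Function.Bijective e) :
    HasKaehlerRank (e.comp φ) d := by
  let _ := e.toAlgebra
  have := isLocalization_bot_of_bijective (S := S) (S' := S') he
  exact h.localization (S' := S') ⊥

theorem HasKaehlerRank.of_isStandardSmooth {R S : Type u} [CommRing R] [CommRing S]
    {φ : R →+* S} {d : ℕ} [Nontrivial S] (h : φ.IsStandardSmoothOfRelativeDimension d) :
    HasKaehlerRank φ d := by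
  let _ := φ.toAlgebra
  have h1 : Algebra.IsStandardSmoothOfRelativeDimension d R S := h
  have := h1.isStandardSmooth
  have h2 := Algebra.IsStandardSmoothOfRelativeDimension.rank_kaehlerDifferential (R := R) (S := S) d
  have h3 := Module.Free.chooseBasis S Ω[S⁄R]
  have : Module.Free S Ω[S⁄R] := inferInstance
  have h4 : Module.finrank S Ω[S⁄R] = d := Module.finrank_eq_of_rank_eq h2
  exact ⟨Module.finBasisOfFinrankEq S Ω[S⁄R] h4⟩

variable {K : Type u} [Field K] [ValuativeRel K] [TopologicalSpace K]
  [IsNonarchimedeanLocalField K] {X : Scheme.{u}} {f : X ⟶ base K}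

/-- Standard smoothness holds on the basic open sets of a family generating the unit ideal. One of
them contains `z`, and the stalk is a further localization. -/
theorem hasKaehlerRank_of_smoothOfRelativeDimension {d : ℕ} (hf : SmoothOfRelativeDimension d f)
    (z : X) : HasKaehlerRank (stalkStruct f z) d := by
  obtain ⟨V, hV, hz⟩ := exists_affine_mem z
  have h1 := HasRingHomProperty.appLE (@SmoothOfRelativeDimension d) f hf
    ⟨⊤, isAffineOpen_top _⟩ ⟨V, hV⟩ le_top
  obtain ⟨s, hs, h2⟩ := h1
  obtain ⟨t, hts, ht⟩ : ∃ t ∈ s, t ∉ idealAt V hz := by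
    by_contra! h
    exact Ideal.IsPrime.ne_top inferInstance (top_le_iff.mp (hs ▸ Ideal.span_le.mpr h))
  let _ := (X.presheaf.germ V z hz).hom.toAlgebra
  have hloc : IsLocalization.AtPrime (X.presheaf.stalk z) (idealAt V hz) := isLocalization_germ hV hz
  have hle : Submonoid.powers t ≤ (idealAt V hz).primeCompl := by
    rw [Submonoid.powers_le]
    exact ht
  let e' : 𝒪[K] ≃+* Γ(base K, ⊤) :=
    (Scheme.ΓSpecIso (CommRingCat.of 𝒪[K])).symm.commRingCatIsoToRingEquiv
  have h3 := (RingHom.isStandardSmoothOfRelativeDimension_respectsIso (n := d)).2 _ e' (h2 t hts)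
  let _ := IsLocalization.localizationAlgebraOfSubmonoidLe (Localization.Away t)
    (X.presheaf.stalk z) _ _ hle
  have := IsLocalization.localization_isScalarTower_of_submonoid_le (Localization.Away t)
    (X.presheaf.stalk z) _ _ hle
  have := IsLocalization.isLocalization_of_submonoid_le (Localization.Away t)
    (X.presheaf.stalk z) _ _ hle
  have : Nontrivial (Localization.Away t) :=
    (algebraMap (Localization.Away t) (X.presheaf.stalk z)).domain_nontrivial
  have h4 := (HasKaehlerRank.of_isStandardSmooth h3).localization (S' := X.presheaf.stalk z)
    ((idealAt V hz).primeCompl.map (algebraMap _ (Localization.Away t)))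
  convert! h4
  ext a
  rw [← germ_structMap f hz]
  simp only [RingHom.comp_apply]
  rw [← IsScalarTower.algebraMap_apply]
  rfl

theorem hasKaehlerRank_of_mem {d : ℕ} {V : X.Opens} (hf : SmoothOfRelativeDimension d (V.ι ≫ f))
    {z : X} (hz : z ∈ V) : HasKaehlerRank (stalkStruct f z) d := by
  have h1 := hasKaehlerRank_of_smoothOfRelativeDimension hf ⟨z, hz⟩
  let e := (V.stalkIso ⟨z, hz⟩).commRingCatIsoToRingEquiv
  have h2 := h1.comp_equiv e.toRingHom e.bijective
  convert! h2
  ext a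
  rw [RingHom.comp_apply]
  have h3 := V.germ_stalkIso_hom (x := ⟨z, hz⟩) (V := ⊤) trivial
  refine Eq.trans ?_ (congrArg (fun φ => φ.hom (structMap (V.ι ≫ f) ⊤ a)) h3).symm
  rw [← germ_structMap f (show z ∈ V.ι ''ᵁ ⊤ by simpa using hz)]
  have h4 : f.appLE ⊤ (V.ι ''ᵁ ⊤) le_top ≫ V.ι.appLE (V.ι ''ᵁ ⊤) ⊤ (by simp) =
      (V.ι ≫ f).appLE ⊤ ⊤ le_top := Scheme.Hom.appLE_comp_appLE _ _ _ _ _ _ _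
  have h5 : V.ι.appLE (V.ι ''ᵁ ⊤) ⊤ (by simp) = 𝟙 _ := by
    rw [Scheme.Opens.ι_appLE]
    exact X.presheaf.map_id _
  rw [h5] at h4
  have h6 : f.appLE ⊤ (V.ι ''ᵁ ⊤) le_top = (V.ι ≫ f).appLE ⊤ ⊤ le_top :=
    (Category.comp_id _).symm.trans h4
  rw [structMap, structMap, h6]
  rfl

end KaehlerRank

/-! ### From generators of the differentials to a basis. -/

section KaehlerBasis

open KaehlerDifferential IsLocalRing

/-- Formal smoothness makes `Ω` free over the local ring. Its rank is read off on the localization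
`L`, and `d` generators of a free module of rank `d` are a basis, as surjective endomorphisms of `A
^ d` are injective. -/
theorem exists_kaehler_basis {O A L : Type*} [CommRing O] [CommRing A] [IsLocalRing A] [Algebra O A]
    [Algebra.FormallySmooth O A] [Module.Finite A Ω[A⁄O]] [CommRing L] [Nontrivial L] [Algebra A L]
    (M : Submonoid A) [IsLocalization M L] {d : ℕ}
    (hL : HasKaehlerRank ((algebraMap A L).comp (algebraMap O A)) d) (τ : Fin d → A)
    (hτ : Submodule.span A (Set.range fun i => D O A (τ i)) = ⊤) :
    ∃ b : Module.Basis (Fin d) A Ω[A⁄O], ∀ i, b i = D O A (τ i) := by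
  have : Module.Free A Ω[A⁄O] := Module.free_of_flat_of_isLocalRing
  let _ := ((algebraMap A L).comp (algebraMap O A)).toAlgebra
  have : IsScalarTower O A L := .of_algebraMap_eq fun _ => rfl
  obtain ⟨bL⟩ := hL
  let b := Module.finBasis A Ω[A⁄O]
  let bL' := b.ofIsLocalizedModule L M (KaehlerDifferential.map O O A L)
  have hd : Module.finrank A Ω[A⁄O] = d := by
    have h1 := Module.finrank_eq_card_basis bL
    have h2 := Module.finrank_eq_card_basis bL'
    rw [Fintype.card_fin] at h1 h2
    exact h2.symm.trans h1
  let e : Ω[A⁄O] ≃ₗ[A] (Fin d → A) := (Module.finBasisOfFinrankEq A Ω[A⁄O] hd).equivFun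
  let φ : (Fin d → A) →ₗ[A] Ω[A⁄O] := Fintype.linearCombination A fun i => D O A (τ i)
  have hφ : Function.Surjective φ := by
    rw [← LinearMap.range_eq_top, Fintype.range_linearCombination]
    exact hτ
  have hinj : Function.Injective (e.toLinearMap ∘ₗ φ) :=
    OrzechProperty.injective_of_surjective_endomorphism _ (e.surjective.comp hφ)
  have hinj' : Function.Injective φ := Function.Injective.of_comp (f := e) hinj
  refine ⟨Module.Basis.mk (v := fun i => D O A (τ i)) ?_ hτ.ge, fun i => Module.Basis.mk_apply _ _ i⟩
  rw [Fintype.linearIndependent_iff]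
  exact fun g hg i => congrFun (hinj' (a₁ := g) (a₂ := 0) (by
    rw [map_zero]; exact (Fintype.linearCombination_apply A _ g).trans hg)) i

end KaehlerBasis

/-! ### The order of the coordinate form equals the order of a Jacobian determinant. -/

section OrderForm

open KaehlerDifferential

variable {K : Type u} [Field K] [ValuativeRel K] [TopologicalSpace K]
  [IsNonarchimedeanLocalField K] {X : Scheme.{u}}

/-- The structure of an `𝒪_K`-algebra on the stalk at `x`. -/
@[reducible] noncomputable def stalkAlgebra (f : X ⟶ base K) (x : X) :
    Algebra 𝒪[K] (X.presheaf.stalk x) := (stalkStruct f x).toAlgebra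

/-- The structure of an `𝒪_K`-algebra on the sections on `U`. -/
@[reducible] noncomputable def sectionAlgebra (f : X ⟶ base K) (U : X.Opens) :
    Algebra 𝒪[K] Γ(X, U) := (structMap f U).toAlgebra

/-- The infimum defining `orderForm` is attained: by adjunction `det J` divides every minor and is
associated to one of them. -/
theorem orderForm_eq (f : X ⟶ base K) {U : X.Opens} (hU : IsAffineOpen U) {c d : ℕ}
    (gen : Fin c ⊕ Fin d → Γ(X, U))
    (hgen : Function.Surjective (MvPolynomial.eval₂Hom (structMap f U) gen)) {y : X} (hy : y ∈ U)
    [IsDomain (X.presheaf.stalk y)] [IsNoetherianRing (X.presheaf.stalk y)]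
    (τ : Fin d → X.presheaf.stalk y) :
    letI := stalkAlgebra f y
    ∀ (b : Module.Basis (Fin d) (X.presheaf.stalk y) Ω[X.presheaf.stalk y⁄𝒪[K]])
      (_ : ∀ i, b i = D 𝒪[K] _ (τ i)) (J : Matrix (Fin d) (Fin d) (X.presheaf.stalk y))
      (_ : ∀ i, D 𝒪[K] _ ((X.presheaf.germ U y hy).hom (gen (.inr i))) =
        ∑ j, J i j • D 𝒪[K] _ (τ j)),
      orderForm f gen y hy = Ring.ord (X.presheaf.stalk y) J.det := by
  intro b hb J hJ
  let _ := stalkAlgebra f y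
  let _ := sectionAlgebra f U
  let _ := (X.presheaf.germ U y hy).hom.toAlgebra
  have : IsScalarTower 𝒪[K] Γ(X, U) (X.presheaf.stalk y) :=
    .of_algebraMap_eq fun a => (germ_structMap f hy a).symm
  have := isLocalization_germ hU hy
  obtain ⟨h1, F, h2⟩ := exists_associated_det (O := 𝒪[K]) (B := Γ(X, U))
    (A := X.presheaf.stalk y) (gen := gen) hgen (idealAt U hy).primeCompl τ b hb J hJ
  have key : ∀ F : Fin c → RingHom.ker (MvPolynomial.eval₂Hom (structMap f U) gen),
      (X.presheaf.germ U y hy).hom (MvPolynomial.eval₂Hom (structMap f U) gen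
        (Matrix.det (Matrix.of fun i j : Fin c =>
          MvPolynomial.pderiv (Sum.inl j) (F i : MvPolynomial (Fin c ⊕ Fin d) 𝒪[K])))) =
      (Matrix.of fun i j : Fin c => gradAt (X.presheaf.stalk y) gen (F i).1 (.inl j)).det := by
    intro F
    rw [RingHom.map_det, RingHom.map_det]
    rfl
  refine le_antisymm ?_ ?_
  · refine (iInf_le _ F).trans ?_
    rw [key F]
    exact (Ring.ord_eq_of_associated h2).ge
  · refine le_iInf fun F => ?_
    rw [key F]
    exact Ring.ord_le_ord_of_dvd (h1 F)

end OrderForm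

/-! ### Spreading out primality and étaleness from a local ring. -/

section SpreadingOut

variable {R B A : Type u} [CommRing R] [CommRing B] [CommRing A] [Algebra B A]
  (q : Ideal B) [q.IsPrime] [IsLocalization.AtPrime A q]

theorem exists_smul_le {P I : Ideal B} (hP : P.FG)
    (h : P.map (algebraMap B A) ≤ I.map (algebraMap B A)) : ∃ s ∉ q, ∀ p ∈ P, s * p ∈ I := by
  classical
  obtain ⟨G, rfl⟩ := hP
  have h1 : ∀ g ∈ G, ∃ s ∉ q, s * g ∈ I := by
    intro g hg
    have h2 : algebraMap B A g ∈ I.map (algebraMap B A) :=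
      h (Ideal.mem_map_of_mem _ (Ideal.subset_span hg))
    obtain ⟨m, hm, hmg⟩ := (IsLocalization.algebraMap_mem_map_algebraMap_iff q.primeCompl A I g).mp h2
    exact ⟨m, hm, hmg⟩
  choose! s hs hsg using h1
  refine ⟨∏ g ∈ G, s g, ?_, ?_⟩
  · rw [Ideal.IsPrime.prod_mem_iff]
    rintro ⟨g, hg, hg'⟩
    exact hs g hg hg'
  · intro p hp
    induction hp using Submodule.span_induction with
    | mem g hg =>
      rw [← Finset.mul_prod_erase G s hg, mul_comm (s g), mul_assoc]
      exact I.mul_mem_left _ (hsg g hg)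
    | zero => simp
    | add x y _ _ hx hy => rw [mul_add]; exact add_mem hx hy
    | smul a x _ hx => rw [smul_eq_mul, mul_left_comm]; exact I.mul_mem_left _ hx

/-- A principal ideal which is prime in the local ring at `q` is prime on a neighborhood. -/
theorem exists_away_isPrime [IsNoetherianRing B] (a : B)
    (ha : (Ideal.span {algebraMap B A a}).IsPrime) :
    ∃ s ∉ q, ∀ s' ∉ q, s ∣ s' → ∀ (B' : Type u) [CommRing B'] [Algebra B B']
      [IsLocalization.Away s' B'], (Ideal.span {algebraMap B B' a}).IsPrime := by
  have : IsLocalRing A := IsLocalization.AtPrime.isLocalRing A q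
  -- The contraction `P` is prime and finitely generated, so a single `s ∉ q` carries it into `(a)`;
  -- the two ideals agree once `s` is inverted.
  let P : Ideal B := (Ideal.span {algebraMap B A a}).comap (algebraMap B A)
  have hPq : P ≤ q := by
    intro p hp
    by_contra hpq
    have h1 : IsUnit (algebraMap B A p) := IsLocalization.map_units A (⟨p, hpq⟩ : q.primeCompl)
    exact ha.ne_top (Ideal.eq_top_of_isUnit_mem _ hp h1)
  have hPmap : P.map (algebraMap B A) = (Ideal.span {a}).map (algebraMap B A) := by
    rw [Ideal.map_span, Set.image_singleton]
    exact IsLocalization.map_under q.primeCompl A _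
  obtain ⟨s, hs, hsP⟩ := exists_smul_le (A := A) q (IsNoetherian.noetherian P) hPmap.le
  refine ⟨s, hs, fun s' hs' hss' B' _ _ _ => ?_⟩
  have haP : a ∈ P := Ideal.mem_span_singleton_self _
  have h1 : Ideal.span {algebraMap B B' a} = P.map (algebraMap B B') := by
    refine le_antisymm ?_ ?_
    · rw [Ideal.span_singleton_le_iff_mem]
      exact Ideal.mem_map_of_mem _ haP
    · rw [Ideal.map_le_iff_le_comap]
      intro p hp
      have hu : IsUnit (algebraMap B B' s) := isUnit_of_dvd_unit (map_dvd _ hss')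
        (IsLocalization.Away.algebraMap_isUnit s')
      have h2 := Ideal.mem_map_of_mem (algebraMap B B') (hsP p hp)
      rw [Ideal.map_span, Set.image_singleton, map_mul] at h2
      exact (Ideal.unit_mul_mem_iff_mem _ hu).mp h2
  rw [h1]
  refine IsLocalization.isPrime_of_isPrime_disjoint (Submonoid.powers s') B' P
    (Ideal.IsPrime.comap _) ?_
  rw [Set.disjoint_left]
  rintro _ ⟨n, rfl⟩ hn
  exact hs' (Ideal.IsPrime.mem_of_pow_mem inferInstance n (hPq hn))

variable [Algebra R B] [Algebra R A] [IsScalarTower R B A]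

/-- Étaleness at a point spreads out. -/
theorem exists_away_etale [Algebra.FinitePresentation R B] [Algebra.FormallyEtale R A] :
    ∃ s ∉ q, ∀ s' : B, s ∣ s' → ∀ (B' : Type u) [CommRing B'] [Algebra B B'] [Algebra R B']
      [IsScalarTower R B B'] [IsLocalization.Away s' B'], Algebra.Etale R B' := by
  let e : A ≃ₐ[B] Localization.AtPrime q := IsLocalization.algEquiv q.primeCompl _ _
  have : Algebra.IsEtaleAt R q := Algebra.FormallyEtale.of_equiv (e.restrictScalars R)
  obtain ⟨s, hs, h⟩ := Algebra.exists_etale_of_isEtaleAt (R := R) q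
  refine ⟨s, hs, fun s' hss' B' _ _ _ _ _ => ?_⟩
  have h1 := Algebra.basicOpen_subset_etaleLocus_iff_etale.mpr h
  have h2 : (PrimeSpectrum.basicOpen s' : Set (PrimeSpectrum B)) ⊆ Algebra.etaleLocus R B := by
    refine subset_trans ?_ h1
    obtain ⟨c, rfl⟩ := hss'
    exact PrimeSpectrum.basicOpen_mul_le_left s c
  have h3 := Algebra.basicOpen_subset_etaleLocus_iff_etale.mp h2
  let e' : Localization.Away s' ≃ₐ[B] B' := IsLocalization.algEquiv (Submonoid.powers s') _ _
  exact Algebra.Etale.of_equiv (e'.restrictScalars R)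

end SpreadingOut

/-! ### Finiteness, generic points and étaleness at smooth `k`-points. -/

section SchemeAlgebra

open KaehlerDifferential IsLocalRing

variable {K : Type u} [Field K] [ValuativeRel K] [TopologicalSpace K]
  [IsNonarchimedeanLocalField K] {X : Scheme.{u}}

theorem germ_map {U V : X.Opens} (h : V ≤ U) {x : X} (hx : x ∈ V) (g : Γ(X, U)) :
    (X.presheaf.germ V x hx).hom ((X.presheaf.map (homOfLE h).op).hom g) =
      (X.presheaf.germ U x (h hx)).hom g :=
  congrArg (fun φ => φ.hom g) (X.presheaf.germ_res (homOfLE h) x hx)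

theorem structMap_finitePresentation (f : X ⟶ base K) [LocallyOfFinitePresentation f]
    {U : X.Opens} (hU : IsAffineOpen U) : (structMap f U).FinitePresentation :=
  (f.finitePresentation_appLE (isAffineOpen_top _) hU le_top).comp
    (RingHom.FinitePresentation.of_bijective
      (ConcreteCategory.bijective_of_isIso (Scheme.ΓSpecIso (CommRingCat.of 𝒪[K])).inv))

theorem isNoetherianRing_sections (f : X ⟶ base K) [LocallyOfFinitePresentation f]
    {U : X.Opens} (hU : IsAffineOpen U) : IsNoetherianRing Γ(X, U) := by
  let _ := sectionAlgebra f U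
  have : Algebra.FinitePresentation 𝒪[K] Γ(X, U) := structMap_finitePresentation f hU
  exact Algebra.FiniteType.isNoetherianRing 𝒪[K] _

theorem finite_kaehlerDifferential_stalk (f : X ⟶ base K) [LocallyOfFinitePresentation f] (x : X) :
    letI := stalkAlgebra f x
    Module.Finite (X.presheaf.stalk x) Ω[X.presheaf.stalk x⁄𝒪[K]] := by
  obtain ⟨U, hU, hx⟩ := exists_affine_mem x
  let _ := stalkAlgebra f x
  let _ := sectionAlgebra f U
  let _ := (X.presheaf.germ U x hx).hom.toAlgebra
  have : IsScalarTower 𝒪[K] Γ(X, U) (X.presheaf.stalk x) :=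
    .of_algebraMap_eq fun a => (germ_structMap f hx a).symm
  have := isLocalization_germ hU hx
  have : Algebra.FinitePresentation 𝒪[K] Γ(X, U) := structMap_finitePresentation f hU
  have := Algebra.EssFiniteType.of_isLocalization (X.presheaf.stalk x) (idealAt U hx).primeCompl
  have := Algebra.EssFiniteType.comp 𝒪[K] Γ(X, U) (X.presheaf.stalk x)
  exact KaehlerDifferential.finite 𝒪[K] _

theorem isAdicComplete_integer :
    IsAdicComplete (maximalIdeal 𝒪[K]) 𝒪[K] := by
  let := IsTopologicalAddGroup.rightUniformSpace K
  have := isUniformAddGroup_of_addCommGroup (G := K)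
  infer_instance

/-- A shrinking of an affine neighbourhood on which the sections form a domain. -/
theorem exists_basicOpen_isDomain {U : X.Opens} (hU : IsAffineOpen U) [IsNoetherianRing Γ(X, U)]
    {x : X} (hx : x ∈ U) [IsDomain (X.presheaf.stalk x)] :
    ∃ s : Γ(X, U), x ∈ X.basicOpen s ∧ IsDomain Γ(X, X.basicOpen s) := by
  let _ := (X.presheaf.germ U x hx).hom.toAlgebra
  have := isLocalization_germ hU hx
  obtain ⟨s, hs, h⟩ := exists_away_isPrime (B := Γ(X, U)) (A := X.presheaf.stalk x)
    (idealAt U hx) 0 (by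
      rw [map_zero, Ideal.span_singleton_zero]
      exact Ideal.isPrime_bot)
  refine ⟨s, ?_, ?_⟩
  · rw [Scheme.mem_basicOpen _ _ _ hx]
    exact IsLocalization.map_units (M := (idealAt U hx).primeCompl) _ ⟨s, hs⟩
  · have := hU.isLocalization_basicOpen s
    have h1 := h s hs dvd_rfl Γ(X, X.basicOpen s)
    rw [map_zero, Ideal.span_singleton_zero] at h1
    exact IsDomain.of_bot_isPrime _

/-- On a neighbourhood whose sections form a domain, the generic point specializes to every point
and lies in every nonempty open subset, in particular in the trace of `V`. -/
theorem exists_specializes_mem (f : X ⟶ base K) [LocallyOfFinitePresentation f] {V : X.Opens}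
    (hV : Dense (V : Set X)) (x : X) [IsDomain (X.presheaf.stalk x)] : ∃ w ∈ V, w ⤳ x := by
  obtain ⟨U, hU, hx⟩ := exists_affine_mem x
  have := isNoetherianRing_sections f hU
  obtain ⟨s, hxs, hs⟩ := exists_basicOpen_isDomain hU hx
  have hUs := hU.basicOpen s
  have : (⊥ : Ideal Γ(X, X.basicOpen s)).IsPrime := Ideal.isPrime_bot
  obtain ⟨w, hw, h⟩ := exists_idealAt_eq hUs ⊥
  obtain ⟨z, hz, hzV⟩ := hV.inter_open_nonempty _ (X.basicOpen s).2 ⟨x, hxs⟩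
  refine ⟨w, ?_, specializes_of_idealAt_le hUs hxs hw (h.trans_le bot_le)⟩
  exact mem_of_specializes hzV (specializes_of_idealAt_le hUs hz hw (h.trans_le bot_le))

variable {f : X ⟶ base K}

/-- A `k`-point, as a homomorphism of `𝒪_K`-algebras on the local ring. -/
theorem ResiduePoint.exists_algHom (x : ResiduePoint f) :
    letI := stalkAlgebra f x.pt
    Nonempty (X.presheaf.stalk x.pt →ₐ[𝒪[K]] ResidueField 𝒪[K]) := by
  let _ := stalkAlgebra f x.pt
  exact ⟨{ x.ev with commutes' := fun a => x.ev_stalkStruct a }⟩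

theorem ResiduePoint.exists_sub_mem (x : ResiduePoint f) (a : X.presheaf.stalk x.pt) :
    ∃ o : 𝒪[K], a - stalkStruct f x.pt o ∈ maximalIdeal (X.presheaf.stalk x.pt) := by
  obtain ⟨o, ho⟩ := residue_surjective (x.ev a)
  refine ⟨o, ?_⟩
  rw [mem_maximalIdeal, mem_nonunits_iff, ← isUnit_map_iff x.ev, map_sub, x.ev_stalkStruct]
  have : x.ev a - residue 𝒪[K] o = 0 := by rw [ho, sub_self]
  rw [this]
  exact not_isUnit_zero

/-- Hensel's lemma: parameters of the local ring at a `k`-point take arbitrary values. -/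
theorem ResiduePoint.exists_algHom_eq (x : ResiduePoint f) {d : ℕ}
    {τ : Fin d → X.presheaf.stalk x.pt}
    (h : (MvPolynomial.eval₂Hom (stalkStruct f x.pt) τ).FormallyEtale)
    (hτ : ∀ i, τ i ∈ maximalIdeal (X.presheaf.stalk x.pt))
    (a : Fin d → 𝒪[K]) (ha : ∀ i, a i ∈ maximalIdeal 𝒪[K]) :
    letI := stalkAlgebra f x.pt
    ∃ σ : X.presheaf.stalk x.pt →ₐ[𝒪[K]] 𝒪[K], ∀ i, σ (τ i) = a i := by
  let _ := stalkAlgebra f x.pt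
  obtain ⟨ρ⟩ := x.exists_algHom
  have := isAdicComplete_integer (K := K)
  exact StringyCount.exists_algHom_eq (O := 𝒪[K]) (A := X.presheaf.stalk x.pt) (τ := τ) h ρ hτ a ha

theorem ResiduePoint.coeff_mem (x : ResiduePoint f) [IsRegularLocalRing (X.presheaf.stalk x.pt)]
    {d : ℕ} {t : Fin (d + 1) → X.presheaf.stalk x.pt} {ϖ : 𝒪[K]} (hϖ : Irreducible ϖ)
    (h0 : t 0 = stalkStruct f x.pt ϖ)
    (ht : Ideal.span (Set.range t) = maximalIdeal (X.presheaf.stalk x.pt))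
    (h : (MvPolynomial.eval₂Hom (stalkStruct f x.pt) fun i : Fin d => t i.succ).FormallyEtale)
    (c : Fin (d + 1) → X.presheaf.stalk x.pt)
    (hc : ∑ i, c i * t i ∈ maximalIdeal (X.presheaf.stalk x.pt) ^ 2) (i) :
    c i ∈ maximalIdeal (X.presheaf.stalk x.pt) := by
  have hm : ∀ i, t i ∈ maximalIdeal (X.presheaf.stalk x.pt) := fun i =>
    ht ▸ Ideal.subset_span ⟨i, rfl⟩
  let _ := stalkAlgebra f x.pt
  obtain ⟨σ, -⟩ := x.exists_algHom_eq h (fun i => hm i.succ) 0 fun _ => zero_mem _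
  obtain ⟨b, hb⟩ := exists_kaehler_basis_of_formallyEtale (O := 𝒪[K]) (A := X.presheaf.stalk x.pt)
    (fun i : Fin d => t i.succ) h
  exact coeff_mem_of_sum_mem_sq t hϖ.maximalIdeal_eq hϖ.ne_zero h0 ht b hb σ c hc i

/-- The residue field is that of `𝒪_K`, so `dt₁, …, dt_d` generate the differentials by
`span_kaehler_eq_top`. A generization in the dense smooth locus gives rank `d`, hence a basis, hence
étaleness. -/
theorem formallyEtale_stalk [LocallyOfFinitePresentation f] {d : ℕ} (hX : IsVariety f d)
    (x : ResiduePoint f) (hx : x.pt ∈ f.smoothLocus) [IsDomain (X.presheaf.stalk x.pt)]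
    {t : Fin (d + 1) → X.presheaf.stalk x.pt} {ϖ : 𝒪[K]} (h0 : t 0 = stalkStruct f x.pt ϖ)
    (ht : Ideal.span (Set.range t) = maximalIdeal (X.presheaf.stalk x.pt)) :
    (MvPolynomial.eval₂Hom (stalkStruct f x.pt) fun i : Fin d => t i.succ).FormallyEtale := by
  let _ := stalkAlgebra f x.pt
  have : Algebra.FormallySmooth 𝒪[K] (X.presheaf.stalk x.pt) := mem_smoothLocus_iff.1 hx
  have := finite_kaehlerDifferential_stalk f x.pt
  have h1 := span_kaehler_eq_top (O := 𝒪[K]) x.exists_sub_mem t h0 ht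
  obtain ⟨V, hV, hsm⟩ := hX.smooth_dense
  obtain ⟨w, hw, hwx⟩ := exists_specializes_mem f hV x.pt
  have h2 := hasKaehlerRank_of_mem hsm hw
  let _ := (X.presheaf.stalkSpecializes hwx).hom.toAlgebra
  have := isLocalization_stalkSpecializes hwx
  obtain ⟨b, hb⟩ := exists_kaehler_basis (O := 𝒪[K]) (A := X.presheaf.stalk x.pt)
    (L := X.presheaf.stalk w) (genericIdeal hwx).primeCompl (d := d) (by
      convert h2 using 1
      ext a
      exact stalkSpecializes_stalkStruct f hwx a) _ h1
  exact formallyEtale_of_kaehler_basis _ b hb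

end SchemeAlgebra

/-! ### Étale coordinates adapted to the divisor on a neighbourhood of a smooth `k`-point. -/

section LocalCoordinates

open KaehlerDifferential IsLocalRing

variable {K : Type u} [Field K] [ValuativeRel K] [TopologicalSpace K]
  [IsNonarchimedeanLocalField K] {X : Scheme.{u}} {f : X ⟶ base K}

/-- Étale coordinates on an affine neighbourhood of a `k`-point whose coordinate hyperplanes,
together with the special fibre, contain the divisor `D`. -/
structure LocalCoordinates (D : QDivisor X) (d : ℕ) (x : ResiduePoint f) where
  U : X.Opens
  affine : IsAffineOpen U
  mem : x.pt ∈ U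
  domain : IsDomain Γ(X, U)
  ϖ : 𝒪[K]
  irreducible : Irreducible ϖ
  t : Fin (d + 1) → Γ(X, U)
  t_zero : t 0 = structMap f U ϖ
  span_germ : Ideal.span (Set.range fun i => (X.presheaf.germ U x.pt mem).hom (t i)) =
    maximalIdeal (X.presheaf.stalk x.pt)
  isPrime_span : ∀ i, (Ideal.span {t i}).IsPrime
  etale : (MvPolynomial.eval₂Hom (structMap f U) fun i : Fin d => t i.succ).Etale
  exists_mem : ∀ y ∈ D.support, ∀ hy : y.1 ∈ U, ∃ i, t i ∈ idealAt U hy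

theorem mem_idealAt_iff {U : X.Opens} {x : X} (hx : x ∈ U) (g : Γ(X, U)) :
    g ∈ idealAt U hx ↔ x ∉ X.basicOpen g := by
  rw [Scheme.mem_basicOpen _ _ _ hx]
  rfl

theorem basicOpen_map {U V : X.Opens} (h : V ≤ U) (g : Γ(X, U)) {x : X} (hx : x ∈ V) :
    x ∈ X.basicOpen ((X.presheaf.map (homOfLE h).op).hom g) ↔ x ∈ X.basicOpen g := by
  rw [Scheme.mem_basicOpen _ _ _ hx, Scheme.mem_basicOpen _ _ _ (h hx), ← germ_map h hx]

/-- At the local ring of `x`, zero is prime, each parameter is prime and `t₁, …, t_d` are étale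
coordinates. Each property spreads out to a basic open neighbourhood, and finitely many of these
have a common refinement. -/
theorem exists_localCoordinates [LocallyOfFinitePresentation f] {d : ℕ} (hX : IsVariety f d)
    (hreg : IsRegularScheme X) {D : QDivisor X} (hD : IsSNC f d D) (x : ResiduePoint f)
    (hx : x.pt ∈ f.smoothLocus) : Nonempty (LocalCoordinates D d x) := by
  have := hreg x.pt
  have := isDomain_of_isRegularLocalRing (X.presheaf.stalk x.pt)
  obtain ⟨U₀, hx₀, ϖ, t₀, S, hϖ, ht₀, hspan₀, hS⟩ := hD.exists_parameters x hx
  obtain ⟨V, hV, hxV, hVU⟩ := exists_isAffineOpen_mem_and_subset hx₀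
  replace hVU : V ≤ U₀ := hVU
  set t : Fin (d + 1) → Γ(X, V) := fun i => (X.presheaf.map (homOfLE hVU).op).hom (t₀ i) with ht
  have hgt : ∀ i, (X.presheaf.germ V x.pt hxV).hom (t i) =
      (X.presheaf.germ U₀ x.pt hx₀).hom (t₀ i) := fun i => germ_map hVU hxV (t₀ i)
  have ht0 : t 0 = structMap f V ϖ := by rw [ht]; simp only [ht₀, map_structMap]
  have hspan : Ideal.span (Set.range fun i => (X.presheaf.germ V x.pt hxV).hom (t i)) =
      maximalIdeal (X.presheaf.stalk x.pt) := by simp only [hgt, hspan₀]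
  have hg0 : (X.presheaf.germ V x.pt hxV).hom (t 0) = stalkStruct f x.pt ϖ := by
    rw [ht0, germ_structMap]
  have hfe := formallyEtale_stalk hX x hx
    (t := fun i => (X.presheaf.germ V x.pt hxV).hom (t i)) hg0 hspan
  have hind := x.coeff_mem hϖ hg0 hspan hfe
  have hNoeth := isNoetherianRing_sections f hV
  let _ := (X.presheaf.germ V x.pt hxV).hom.toAlgebra
  have := isLocalization_germ hV hxV
  have hprime : ∀ i, ∃ s ∉ idealAt V hxV, ∀ s' ∉ idealAt V hxV, s ∣ s' →
      ∀ (B' : Type u) [CommRing B'] [Algebra Γ(X, V) B'] [IsLocalization.Away s' B'],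
        (Ideal.span {algebraMap Γ(X, V) B' (t i)}).IsPrime := fun i =>
    exists_away_isPrime (idealAt V hxV) (A := X.presheaf.stalk x.pt) (t i)
      (isPrime_span_singleton (hspan ▸ Ideal.subset_span ⟨i, rfl⟩)
        (notMem_sq_of_independent hind i))
  choose s hs hs' using hprime
  obtain ⟨s₁, hs₁, hs₁'⟩ := exists_away_isPrime (idealAt V hxV) (A := X.presheaf.stalk x.pt) 0 (by
    rw [map_zero, Ideal.span_singleton_zero]
    exact Ideal.isPrime_bot)
  let R := MvPolynomial (Fin d) 𝒪[K]
  let ψ : R →+* Γ(X, V) := MvPolynomial.eval₂Hom (structMap f V) fun i : Fin d => t i.succ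
  let _ : Algebra R Γ(X, V) := ψ.toAlgebra
  have hψ : (X.presheaf.germ V x.pt hxV).hom.comp ψ =
      MvPolynomial.eval₂Hom (stalkStruct f x.pt)
        fun i : Fin d => (X.presheaf.germ V x.pt hxV).hom (t i.succ) := by
    refine MvPolynomial.ringHom_ext (fun a => ?_) fun i => ?_
    · simp [ψ, germ_structMap]
    · simp [ψ]
  let _ : Algebra R (X.presheaf.stalk x.pt) :=
    ((X.presheaf.germ V x.pt hxV).hom.comp ψ).toAlgebra
  have : IsScalarTower R Γ(X, V) (X.presheaf.stalk x.pt) := .of_algebraMap_eq fun a => rfl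
  let _ := sectionAlgebra f V
  have : Algebra.FinitePresentation 𝒪[K] Γ(X, V) := structMap_finitePresentation f hV
  have : IsScalarTower 𝒪[K] R Γ(X, V) := .of_algebraMap_eq fun a => by
    exact (MvPolynomial.eval₂_C (structMap f V) (fun i : Fin d => t i.succ) a).symm
  have : Algebra.FinitePresentation R Γ(X, V) :=
    Algebra.FinitePresentation.of_restrict_scalars_finitePresentation 𝒪[K] R Γ(X, V)
  have : Algebra.FormallyEtale R (X.presheaf.stalk x.pt) := by
    have h : ((X.presheaf.germ V x.pt hxV).hom.comp ψ).FormallyEtale := by rw [hψ]; exact hfe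
    exact h
  obtain ⟨s₂, hs₂, hs₂'⟩ := exists_away_etale (R := R) (idealAt V hxV) (A := X.presheaf.stalk x.pt)
  -- A common multiple of all the functions that have to be inverted.
  set σ := s₁ * s₂ * ∏ i, s i with hσ
  have hσq : σ ∉ idealAt V hxV := by
    refine (idealAt V hxV).primeCompl.mul_mem ((idealAt V hxV).primeCompl.mul_mem hs₁ hs₂) ?_
    exact Submonoid.prod_mem _ fun i _ => hs i
  have hle : X.basicOpen σ ≤ V := X.basicOpen_le σ
  have hxσ : x.pt ∈ X.basicOpen σ := by
    by_contra h
    exact hσq ((mem_idealAt_iff hxV σ).2 h)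
  have := hV.isLocalization_basicOpen σ
  have halg : ∀ g, algebraMap Γ(X, V) Γ(X, X.basicOpen σ) g =
    (X.presheaf.map (homOfLE hle).op).hom g := fun g => rfl
  let _ : Algebra R Γ(X, X.basicOpen σ) :=
    ((algebraMap Γ(X, V) Γ(X, X.basicOpen σ)).comp ψ).toAlgebra
  have : IsScalarTower R Γ(X, V) Γ(X, X.basicOpen σ) := .of_algebraMap_eq fun a => rfl
  have hp0 := hs₁' σ hσq ⟨s₂ * ∏ i, s i, by rw [hσ, mul_assoc]⟩ Γ(X, X.basicOpen σ)
  rw [map_zero, Ideal.span_singleton_zero] at hp0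
  refine ⟨⟨X.basicOpen σ, hV.basicOpen σ, hxσ, IsDomain.of_bot_isPrime _, ϖ, hϖ,
    fun i => (X.presheaf.map (homOfLE hle).op).hom (t i), ?_, ?_, ?_, ?_, ?_⟩⟩
  · rw [ht0, map_structMap]
  · rw [← hspan]
    congr 1
    ext a
    simp only [germ_map hle hxσ]
  · intro i
    exact hs' i σ hσq ((Finset.dvd_prod_of_mem s (Finset.mem_univ i)).trans (Dvd.intro_left _ rfl))
      Γ(X, X.basicOpen σ)
  · have h1 : Algebra.Etale R Γ(X, X.basicOpen σ) :=
      hs₂' σ ⟨s₁ * ∏ i, s i, by rw [hσ]; ring⟩ _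
    have h2 : ((algebraMap Γ(X, V) Γ(X, X.basicOpen σ)).comp ψ).Etale := h1
    convert h2 using 1
    refine MvPolynomial.ringHom_ext (fun a => ?_) fun i => ?_
    · simp [ψ, halg, map_structMap]
    · simp [ψ, halg]
  · intro y hy hyU
    -- The generic point of a component of `D` lies where the product of some parameters vanishes,
    -- so one of them vanishes there.
    have h1 : y.1 ∈ (U₀ : Set X) ∩ divisorSupport D :=
      ⟨hVU (hle hyU), Set.mem_biUnion hy (subset_closure rfl)⟩
    rw [hS] at h1
    have h2 := (mem_idealAt_iff (hVU (hle hyU)) _).2 h1.2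
    obtain ⟨i, -, hi⟩ := (Ideal.IsPrime.prod_mem_iff).1 h2
    refine ⟨i, ?_⟩
    rw [mem_idealAt_iff] at hi ⊢
    rwa [basicOpen_map _ _ hyU, basicOpen_map _ _ (hle hyU)]

end LocalCoordinates

/-! ### The coordinate hyperplanes as prime divisors. -/

section CoordinateDivisors

open KaehlerDifferential IsLocalRing

variable {K : Type u} [Field K] [ValuativeRel K] [TopologicalSpace K]
  [IsNonarchimedeanLocalField K] {X : Scheme.{u}} {f : X ⟶ base K}

theorem closedPt_eq_iff {ϖ : 𝒪[K]} (hϖ : Irreducible ϖ) {y : X} :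
    f y = closedPt K ↔ stalkStruct f y ϖ ∈ maximalIdeal (X.presheaf.stalk y) := by
  have hy : y ∈ (⊤ : X.Opens) := TopologicalSpace.Opens.mem_top y
  rw [← germ_structMap f hy]
  change _ ↔ structMap f ⊤ ϖ ∈ idealAt ⊤ hy
  rw [mem_idealAt_iff]
  have h1 : X.basicOpen (structMap f ⊤ ϖ) =
      f ⁻¹ᵁ (base K).basicOpen ((Scheme.ΓSpecIso (CommRingCat.of 𝒪[K])).inv.hom ϖ) := by
    rw [Scheme.preimage_basicOpen]
    congr 1
    change (f.appLE ⊤ ⊤ le_top).hom _ = (f.app ⊤).hom _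
    rw [f.app_eq_appLE]
    rfl
  rw [h1]
  have h2 : (base K).basicOpen ((Scheme.ΓSpecIso (CommRingCat.of 𝒪[K])).inv.hom ϖ) =
    PrimeSpectrum.basicOpen ϖ := basicOpen_eq_of_affine (R := CommRingCat.of 𝒪[K]) ϖ
  rw [h2]
  change _ ↔ ¬ (f y ∈ PrimeSpectrum.basicOpen ϖ)
  have h3 : ∀ P : PrimeSpectrum 𝒪[K],
      P = closedPoint 𝒪[K] ↔ ¬ P ∈ PrimeSpectrum.basicOpen ϖ := by
    intro P
    rw [PrimeSpectrum.mem_basicOpen, not_not]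
    constructor
    · rintro rfl
      exact (mem_maximalIdeal _).2 hϖ.not_isUnit
    · intro h
      refine PrimeSpectrum.ext ?_
      change P.asIdeal = maximalIdeal 𝒪[K]
      refine le_antisymm (le_maximalIdeal P.2.ne_top) ?_
      rw [hϖ.maximalIdeal_eq, Ideal.span_singleton_le_iff_mem]
      exact h
  exact h3 (f y)

theorem isVertical_iff {ϖ : 𝒪[K]} (hϖ : Irreducible ϖ) (y : PrimeDivisor X) {U : X.Opens}
    (hy : y.1 ∈ U) : IsVertical f y ↔ structMap f U ϖ ∈ idealAt U hy := by
  rw [IsVertical, closedPt_eq_iff hϖ, ← germ_structMap f hy]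
  rfl

theorem ord_eq_one {R : Type*} [CommRing R] [IsLocalRing R] {a : R}
    (ha : Ideal.span {a} = maximalIdeal R) : Ring.ord R a = 1 := by
  rw [Ring.ord, ha]
  have : IsSimpleModule R (R ⧸ maximalIdeal R) :=
    isSimpleModule_iff_isCoatom.2 (maximalIdeal.isMaximal R).out
  exact Module.length_eq_one _ _

theorem map_idealAt {U : X.Opens} (hU : IsAffineOpen U) {y : X} (hy : y ∈ U) :
    (idealAt U hy).map (X.presheaf.germ U y hy).hom = maximalIdeal (X.presheaf.stalk y) := by
  let _ := (X.presheaf.germ U y hy).hom.toAlgebra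
  have := isLocalization_germ hU hy
  exact IsLocalization.AtPrime.map_eq_maximalIdeal (idealAt U hy) (X.presheaf.stalk y)

namespace LocalCoordinates

variable {D : QDivisor X} {d : ℕ} {x : ResiduePoint f} (c : LocalCoordinates D d x)

theorem comp_germ {y : X} (hy : y ∈ c.U) :
    (X.presheaf.germ c.U y hy).hom.comp
      (MvPolynomial.eval₂Hom (structMap f c.U) fun i : Fin d => c.t i.succ) =
    MvPolynomial.eval₂Hom (stalkStruct f y)
      fun i : Fin d => (X.presheaf.germ c.U y hy).hom (c.t i.succ) := by
  refine MvPolynomial.ringHom_ext (fun a => ?_) fun i => ?_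
  · simp [germ_structMap]
  · simp

theorem formallyEtale_germ {y : X} (hy : y ∈ c.U) :
    (MvPolynomial.eval₂Hom (stalkStruct f y)
      fun i : Fin d => (X.presheaf.germ c.U y hy).hom (c.t i.succ)).FormallyEtale := by
  rw [← comp_germ]
  have h1 : (MvPolynomial.eval₂Hom (structMap f c.U) fun i : Fin d => c.t i.succ).FormallyEtale := by
    let _ := (MvPolynomial.eval₂Hom (structMap f c.U) fun i : Fin d => c.t i.succ).toAlgebra
    have : Algebra.Etale (MvPolynomial (Fin d) 𝒪[K]) Γ(X, c.U) := c.etale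
    exact (inferInstance : Algebra.FormallyEtale (MvPolynomial (Fin d) 𝒪[K]) Γ(X, c.U))
  refine h1.comp ?_
  let _ := (X.presheaf.germ c.U y hy).hom.toAlgebra
  have := isLocalization_germ c.affine hy
  exact Algebra.FormallyEtale.of_isLocalization (idealAt c.U hy).primeCompl

theorem exists_basis {y : X} (hy : y ∈ c.U) :
    letI := stalkAlgebra f y
    ∃ b : Module.Basis (Fin d) (X.presheaf.stalk y) Ω[X.presheaf.stalk y⁄𝒪[K]],
      ∀ i, b i = KaehlerDifferential.D 𝒪[K] _ ((X.presheaf.germ c.U y hy).hom (c.t i.succ)) := by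
  let _ := stalkAlgebra f y
  exact exists_kaehler_basis_of_formallyEtale (O := 𝒪[K]) (A := X.presheaf.stalk y) _
    (c.formallyEtale_germ hy)

/-- The parameters in the local ring at the `k`-point. -/
noncomputable def param (i : Fin (d + 1)) : X.presheaf.stalk x.pt :=
  (X.presheaf.germ c.U x.pt c.mem).hom (c.t i)

theorem param_zero : c.param 0 = stalkStruct f x.pt c.ϖ := by
  rw [param, c.t_zero, germ_structMap]

theorem span_param : Ideal.span (Set.range c.param) = maximalIdeal (X.presheaf.stalk x.pt) :=
  c.span_germ

theorem param_mem (i) : c.param i ∈ maximalIdeal (X.presheaf.stalk x.pt) :=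
  c.span_param ▸ Ideal.subset_span ⟨i, rfl⟩

variable (hreg : IsRegularScheme X)
include hreg

theorem coeff_mem (a : Fin (d + 1) → X.presheaf.stalk x.pt)
    (ha : ∑ i, a i * c.param i ∈ maximalIdeal (X.presheaf.stalk x.pt) ^ 2) (i) :
    a i ∈ maximalIdeal (X.presheaf.stalk x.pt) := by
  have := hreg x.pt
  exact x.coeff_mem c.irreducible c.param_zero c.span_param (c.formallyEtale_germ c.mem) a ha i

theorem param_ne_zero (i) : c.param i ≠ 0 := by
  have := hreg x.pt
  exact ne_zero_of_independent (c.coeff_mem hreg) i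

theorem t_ne_zero (i) : c.t i ≠ 0 := fun h =>
  c.param_ne_zero hreg i (by rw [param, h, map_zero])

theorem t_notMem_span {i j} (hij : i ≠ j) : c.t j ∉ Ideal.span {c.t i} := by
  intro h
  have := hreg x.pt
  refine notMem_span_of_independent (c.coeff_mem hreg) hij ?_
  rw [Ideal.mem_span_singleton] at h ⊢
  exact map_dvd (X.presheaf.germ c.U x.pt c.mem).hom h

variable [LocallyOfFinitePresentation f]

/-- Krull's principal ideal theorem for the upper bound; `t i ≠ 0` in a domain for the lower one. -/
theorem height_span (i) : (Ideal.span {c.t i}).height = 1 := by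
  have := isNoetherianRing_sections f c.affine
  have := c.domain
  have := c.isPrime_span i
  refine le_antisymm (Ideal.height_le_one_of_isPrincipal_of_mem_minimalPrimes (Ideal.span {c.t i})
    _ (by rw [Ideal.minimalPrimes_eq_subsingleton_self]; rfl)) ?_
  exact Ideal.one_le_height_span_singleton_of_mem_nonZeroDivisors
    (mem_nonZeroDivisors_of_ne_zero (c.t_ne_zero hreg i))

theorem exists_divisor (i) :
    ∃ (y : PrimeDivisor X) (hy : y.1 ∈ c.U), idealAt c.U hy = Ideal.span {c.t i} := by
  have := c.isPrime_span i
  obtain ⟨y, hy, h⟩ := exists_idealAt_eq c.affine (Ideal.span {c.t i})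
  exact ⟨⟨y, by rw [← height_idealAt c.affine hy, h, c.height_span hreg]⟩, hy, h⟩

/-- The coordinate hyperplane, as a prime divisor. -/
noncomputable def divisor (i : Fin (d + 1)) : PrimeDivisor X := (c.exists_divisor hreg i).choose

theorem divisor_mem (i) : (c.divisor hreg i).1 ∈ c.U :=
  (c.exists_divisor hreg i).choose_spec.choose

theorem idealAt_divisor (i) : idealAt c.U (c.divisor_mem hreg i) = Ideal.span {c.t i} :=
  (c.exists_divisor hreg i).choose_spec.choose_spec

theorem divisor_injective : Function.Injective (c.divisor hreg) := by
  intro i j h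
  by_contra hij
  refine c.t_notMem_span hreg hij ?_
  rw [← c.idealAt_divisor hreg i]
  have h1 : c.t j ∈ idealAt c.U (c.divisor_mem hreg j) := by
    rw [c.idealAt_divisor]
    exact Ideal.mem_span_singleton_self _
  simp only [← h] at h1
  exact h1

/-- The prime `(t i)` and the ideal of `y` both have height one and the first is contained in the
second, so they coincide. -/
theorem eq_divisor {y : PrimeDivisor X} (hy : y.1 ∈ c.U) {i} (h : c.t i ∈ idealAt c.U hy) :
    y = c.divisor hreg i := by
  have := isNoetherianRing_sections f c.affine
  have := c.isPrime_span i
  have h1 : Ideal.span {c.t i} = idealAt c.U hy :=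
    Ideal.eq_of_le_of_height_le _ (by rwa [Ideal.span_singleton_le_iff_mem])
      (by rw [c.height_span hreg, height_idealAt c.affine, y.2])
  rw [← c.idealAt_divisor hreg] at h1
  exact Subtype.ext (((specializes_of_idealAt_le c.affine hy _ h1.le).antisymm
    (specializes_of_idealAt_le c.affine _ hy h1.ge)).eq).symm

theorem exists_eq_divisor {y : PrimeDivisor X} (hy : y.1 ∈ c.U) (h : D y ≠ 0) :
    ∃ i, y = c.divisor hreg i := by
  obtain ⟨i, hi⟩ := c.exists_mem y (Finsupp.mem_support_iff.2 h) hy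
  exact ⟨i, c.eq_divisor hreg hy hi⟩

theorem divisor_specializes (i) : (c.divisor hreg i).1 ⤳ x.pt := by
  refine specializes_of_idealAt_le c.affine c.mem (c.divisor_mem hreg i) ?_
  rw [c.idealAt_divisor, Ideal.span_singleton_le_iff_mem]
  exact c.param_mem i

theorem isVertical_divisor_iff (i) : IsVertical f (c.divisor hreg i) ↔ i = 0 := by
  rw [isVertical_iff c.irreducible _ (c.divisor_mem hreg i), ← c.t_zero, c.idealAt_divisor]
  constructor
  · intro h
    by_contra h0
    exact c.t_notMem_span hreg h0 h
  · rintro rfl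
    exact Ideal.mem_span_singleton_self _

/-- The special fibre is cut out by the prime element `t 0 = ϖ`. This is why exactly one `A_h`
passes through a smooth `k`-point. -/
theorem eq_divisor_zero {y : PrimeDivisor X} (hy : IsVertical f y) (hyx : y.1 ⤳ x.pt) :
    y = c.divisor hreg 0 := by
  refine c.eq_divisor hreg (mem_of_specializes c.mem hyx) ?_
  rw [c.t_zero]
  exact (isVertical_iff c.irreducible _ _).1 hy

theorem isUnit_germ {y : PrimeDivisor X} (hy : y.1 ∈ c.U) {i} (h : y ≠ c.divisor hreg i) :
    IsUnit ((X.presheaf.germ c.U y.1 hy).hom (c.t i)) := by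
  by_contra h1
  exact h (c.eq_divisor hreg hy h1)

theorem ord_t [DecidableEq (PrimeDivisor X)] {y : PrimeDivisor X} (hy : y.1 ∈ c.U) (i) :
    Ring.ord (X.presheaf.stalk y.1) ((X.presheaf.germ c.U y.1 hy).hom (c.t i)) =
      if y = c.divisor hreg i then 1 else 0 := by
  split_ifs with h
  · subst h
    refine ord_eq_one ?_
    rw [← map_idealAt c.affine hy]
    change _ = (idealAt c.U (c.divisor_mem hreg i)).map _
    rw [c.idealAt_divisor, Ideal.map_span, Set.image_singleton]
  · exact Ring.ord_of_isUnit (c.isUnit_germ hreg hy h)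

end LocalCoordinates

end CoordinateDivisors

/-! ### Measures of charts and their local comparison. -/

section ChartMeasure

variable {K : Type u} [Field K] [ValuativeRel K] [TopologicalSpace K]
  [IsNonarchimedeanLocalField K] {X : Scheme.{u}} {f : X ⟶ base K}

instance : BorelSpace (IntegralPoint f) := ⟨rfl⟩

/-- A measure is bounded by another one if this holds locally on a countable cover. -/
theorem measure_le_of_cover {α : Type*} [MeasurableSpace α] {μ ν : Measure α} {O : ℕ → Set α}
    (hO : ∀ n, MeasurableSet (O n)) (hμ : μ (⋃ n, O n)ᶜ = 0)
    (h : ∀ n, ∀ S ⊆ O n, MeasurableSet S → μ S ≤ ν S) : μ ≤ ν := by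
  refine Measure.le_iff.2 fun S hS => ?_
  have hm : ∀ n, MeasurableSet (S ∩ disjointed O n) := fun n =>
    hS.inter (MeasurableSet.disjointed hO n)
  have hd : Pairwise (Function.onFun Disjoint fun n => S ∩ disjointed O n) := fun i j hij =>
    (disjoint_disjointed O hij).mono Set.inter_subset_right Set.inter_subset_right
  have hU : ⋃ n, S ∩ disjointed O n = S ∩ ⋃ n, O n := by
    rw [← Set.inter_iUnion, iUnion_disjointed]
  calc μ S ≤ μ (S ∩ ⋃ n, O n) + μ (⋃ n, O n)ᶜ := by
        refine (measure_mono fun p hp => ?_).trans (measure_union_le _ _)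
        by_cases hpO : p ∈ ⋃ n, O n
        exacts [Or.inl ⟨hp, hpO⟩, Or.inr hpO]
    _ = ∑' n, μ (S ∩ disjointed O n) := by
        rw [hμ, add_zero, ← hU, measure_iUnion hd hm]
    _ ≤ ∑' n, ν (S ∩ disjointed O n) := ENNReal.tsum_le_tsum fun n =>
        h n _ (Set.inter_subset_right.trans (disjointed_subset O n)) (hm n)
    _ = ν (⋃ n, S ∩ disjointed O n) := (measure_iUnion hd hm).symm
    _ ≤ ν S := measure_mono (Set.iUnion_subset fun _ => Set.inter_subset_left)

namespace Chart

variable {D : QDivisor X} {d : ℕ} (c : Chart f D d)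

attribute [local instance] borelField borelField_borelSpace

theorem measurableEmbedding_coord :
    letI : MeasurableSpace (Fin d → K) := borel _
    MeasurableEmbedding c.coord := by
  let : MeasurableSpace (Fin d → K) := borel _
  have : BorelSpace (Fin d → K) := ⟨rfl⟩
  have h : Topology.IsOpenEmbedding c.coord := c.isOpenEmbedding
  exact h.measurableEmbedding

/-- The measure `dx₁ ⋯ dx_d` on the patch, as a measure on `X(𝒪_K)`. -/
noncomputable def volume : Measure (IntegralPoint f) :=
  letI : MeasurableSpace (Fin d → K) := borel (Fin d → K)
  (Measure.comap c.coord (haar K d)).map Subtype.val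

open Classical in
/-- The density on the patch, extended by zero. -/
noncomputable def totalDensity (p : IntegralPoint f) : ℝ≥0∞ :=
  if h : p ∈ c.W then c.density ⟨p, h⟩ else 0

theorem totalDensity_coe (p : c.W) : c.totalDensity p.1 = c.density p := dif_pos p.2

theorem volume_apply {S : Set (IntegralPoint f)} (hS : MeasurableSet S) :
    c.volume S = haar K d (c.coord '' (Subtype.val ⁻¹' S)) := by
  let : MeasurableSpace (Fin d → K) := borel _
  rw [volume, Measure.map_apply measurable_subtype_coe hS, c.measurableEmbedding_coord.comap_apply]

theorem measure_apply {S : Set (IntegralPoint f)} (hS : MeasurableSet S) :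
    c.measure S = ∫⁻ p in S, c.totalDensity p ∂c.volume := by
  let : MeasurableSpace (Fin d → K) := borel _
  have hW : MeasurableEmbedding (Subtype.val : c.W → IntegralPoint f) :=
    MeasurableEmbedding.subtype_coe c.isOpen_W.measurableSet
  rw [measure, volume, Measure.map_apply measurable_subtype_coe hS,
    withDensity_apply _ (measurable_subtype_coe hS), hW.restrict_map, hW.lintegral_map]
  simp only [totalDensity_coe]

theorem measure_compl_W : c.measure c.Wᶜ = 0 := by
  rw [c.measure_apply c.isOpen_W.measurableSet.compl]
  refine (setLIntegral_congr_fun (g := 0) c.isOpen_W.measurableSet.compl fun p hp => ?_).trans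
    (by simp)
  exact dif_neg hp

/-- Comparison of two patches from a comparison of their coordinates and densities. -/
theorem measure_le_of_le (c' : Chart f D d) {S : Set (IntegralPoint f)} (hS : MeasurableSet S)
    (a : ℝ≥0∞) (h : ∀ T ⊆ S, MeasurableSet T → c.volume T ≤ a * c'.volume T)
    (hd : ∀ᵐ p ∂c'.volume, p ∈ S → a * c.totalDensity p ≤ c'.totalDensity p) :
    c.measure S ≤ c'.measure S := by
  rw [c.measure_apply hS, c'.measure_apply hS]
  have h1 : c.volume.restrict S ≤ a • c'.volume.restrict S := by
    refine Measure.le_iff.2 fun T hT => ?_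
    rw [Measure.smul_apply, Measure.restrict_apply hT, Measure.restrict_apply hT, smul_eq_mul]
    exact h _ Set.inter_subset_right (hT.inter hS)
  -- Every step is valid for arbitrary functions, so the densities need not be shown measurable.
  calc ∫⁻ p in S, c.totalDensity p ∂c.volume
      ≤ ∫⁻ p, c.totalDensity p ∂(a • c'.volume.restrict S) := lintegral_mono' h1 le_rfl
    _ = a * ∫⁻ p in S, c.totalDensity p ∂c'.volume := by rw [lintegral_smul_measure, smul_eq_mul]
    _ ≤ ∫⁻ p in S, a * c.totalDensity p ∂c'.volume := lintegral_const_mul_le _ _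
    _ ≤ ∫⁻ p in S, c'.totalDensity p ∂c'.volume :=
        lintegral_mono_ae ((ae_restrict_iff' hS).2 hd)

theorem secondCountable_W : SecondCountableTopology c.W :=
  c.isOpenEmbedding.toIsEmbedding.secondCountableTopology

/-- A measure which is locally on the patch at least the measure of the patch. -/
theorem measure_le_of_forall_exists {ν : Measure (IntegralPoint f)}
    (h : ∀ p ∈ c.W, ∃ O, IsOpen O ∧ p ∈ O ∧ ∀ S ⊆ O, MeasurableSet S → c.measure S ≤ ν S) :
    c.measure ≤ ν := by
  have := c.secondCountable_W
  choose O hO hpO hle using h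
  obtain ⟨T, hT, hTU⟩ := TopologicalSpace.isOpen_iUnion_countable
    (fun p : c.W => (Subtype.val ⁻¹' O p.1 p.2 : Set c.W))
    fun p => (hO p.1 p.2).preimage continuous_subtype_val
  -- Enumerating the cover by `ℕ` requires it to be nonempty; if it is empty, so is the patch.
  rcases T.eq_empty_or_nonempty with hTe | hTe
  · have hW : c.W = ∅ := by
      refine Set.eq_empty_iff_forall_notMem.2 fun p hp => ?_
      have h1 : (⟨p, hp⟩ : c.W) ∈ ⋃ p : c.W, (Subtype.val ⁻¹' O p.1 p.2 : Set c.W) :=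
        Set.mem_iUnion.2 ⟨⟨p, hp⟩, hpO p hp⟩
      rw [← hTU, hTe] at h1
      simp at h1
    have h0 := c.measure_compl_W
    rw [hW, Set.compl_empty, Measure.measure_univ_eq_zero] at h0
    rw [h0]
    exact Measure.zero_le _
  obtain ⟨e, rfl⟩ := hT.exists_eq_range hTe
  refine measure_le_of_cover (O := fun n => O (e n).1 (e n).2)
    (fun n => (hO _ _).measurableSet) (measure_mono_null ?_ c.measure_compl_W) fun n => hle _ _
  rw [Set.compl_subset_compl]
  intro p hp
  have h1 : (⟨p, hp⟩ : c.W) ∈ ⋃ p : c.W, (Subtype.val ⁻¹' O p.1 p.2 : Set c.W) :=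
    Set.mem_iUnion.2 ⟨⟨p, hp⟩, hpO p hp⟩
  rw [← hTU] at h1
  simp only [Set.mem_range, Set.iUnion_exists, Set.iUnion_iUnion_eq', Set.mem_iUnion] at h1
  exact Set.mem_iUnion.2 h1

end Chart

end ChartMeasure

/-! ### The disc of a `k`-point and its coordinates. -/

section Disc

open IsLocalRing

variable {K : Type u} [Field K] [ValuativeRel K] [TopologicalSpace K]
  [IsNonarchimedeanLocalField K] {X : Scheme.{u}} {f : X ⟶ base K}

theorem isOpen_maximalIdeal_pow (n : ℕ) : IsOpen {z : 𝒪[K] | z ∈ 𝓂[K] ^ n} := by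
  obtain ⟨ϖ, hϖ⟩ := exists_irreducible (K := K)
  have hq := one_lt_residueCard' (K := K)
  simp only [mem_maximalIdeal_pow_iff hϖ]
  exact (isOpen_ball (by positivity)).preimage continuous_subtype_val

theorem exists_pow_subset {V : Set 𝒪[K]} (hV : IsOpen V) {z : 𝒪[K]} (hz : z ∈ V) :
    ∃ n, ∀ w, w - z ∈ 𝓂[K] ^ n → w ∈ V := by
  obtain ⟨ϖ, hϖ⟩ := exists_irreducible (K := K)
  obtain ⟨V', hV', rfl⟩ := isOpen_induced_iff.1 hV
  have h1 : (fun y => (z : K) + y) ⁻¹' V' ∈ nhds (0 : K) := by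
    have h2 : Continuous fun y => (z : K) + y := by fun_prop
    exact h2.continuousAt.preimage_mem_nhds (by simpa using hV'.mem_nhds hz)
  obtain ⟨n, hn⟩ := exists_ball_subset h1
  refine ⟨n, fun w hw => ?_⟩
  have h3 := hn _ ((mem_maximalIdeal_pow_iff hϖ).1 hw)
  simpa using h3

/-- The `𝒪_K`-points reducing to a given `k`-point. -/
def disc (x : ResiduePoint f) : Set (IntegralPoint f) := {p | p.special = x.pt}

theorem IntegralPoint.continuous_eval {W : Set (IntegralPoint f)} {U : X.Opens}
    (h : ∀ p ∈ W, p.FactorsThrough U) (g : Γ(X, U)) :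
    Continuous fun p : W => p.1.eval (h p.1 p.2) g := by
  refine continuous_def.2 fun V hV => ?_
  have h1 : IsOpen {p : IntegralPoint f | ∃ h : p.FactorsThrough U, p.eval h g ∈ V} :=
    TopologicalSpace.isOpen_generateFrom_of_mem ⟨U, g, V, hV, rfl⟩
  convert h1.preimage (continuous_subtype_val (p := (· ∈ W))) using 1
  ext p
  exact ⟨fun hp => ⟨h p.1 p.2, hp⟩, fun ⟨_, hp⟩ => hp⟩

theorem IntegralPoint.eval_mem_maximalIdeal_iff (p : IntegralPoint f) {U : X.Opens}
    (h : p.FactorsThrough U) (hU : p.special ∈ U) (g : Γ(X, U)) :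
    p.eval h g ∈ 𝓂[K] ↔ g ∈ idealAt U hU := by
  rw [← p.evAt_germ rfl hU h g, mem_maximalIdeal, mem_nonunits_iff, isUnit_map_iff]
  rfl

theorem ResiduePoint.isMaximal_idealAt (x : ResiduePoint f) {U : X.Opens} (hx : x.pt ∈ U) :
    (idealAt U hx).IsMaximal := by
  have h1 : idealAt U hx = RingHom.ker (x.ev.comp (X.presheaf.germ U x.pt hx).hom) := by
    ext g
    change (X.presheaf.germ U x.pt hx).hom g ∈ maximalIdeal _ ↔ x.ev _ = 0
    rw [mem_maximalIdeal, mem_nonunits_iff, ← isUnit_map_iff x.ev, isUnit_iff_ne_zero, not_not]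
  rw [h1]
  refine RingHom.ker_isMaximal_of_surjective _ fun a => ?_
  obtain ⟨o, rfl⟩ := residue_surjective a
  exact ⟨structMap f U o, by
    rw [RingHom.comp_apply, germ_structMap, x.ev_stalkStruct]⟩

/-- Reducing to `x` means that finitely many generators of its maximal ideal take values in `𝔪`, an
open condition. -/
theorem isOpen_disc [LocallyOfFinitePresentation f] (x : ResiduePoint f) : IsOpen (disc x) := by
  classical
  obtain ⟨U, hU, hx⟩ := exists_affine_mem x.pt
  have := isNoetherianRing_sections f hU
  obtain ⟨G, hG⟩ := (isNoetherianRing_iff_ideal_fg _).1 this (idealAt U hx)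
  -- Inserting `0` forces `p` to factor through `U` even when `G` is empty.
  have h1 : disc x = ⋂ g ∈ insert 0 G, {p | ∃ h : p.FactorsThrough U, p.eval h g ∈
      {z : 𝒪[K] | z ∈ 𝓂[K] ^ 1}} := by
    ext p
    simp only [Set.mem_iInter, Set.mem_ofPred_eq, pow_one]
    constructor
    · intro hp g hg
      have hpU : p.special ∈ U := by rw [show p.special = x.pt from hp]; exact hx
      refine ⟨IntegralPoint.factorsThrough_iff.2 hpU, ?_⟩
      rw [p.eval_mem_maximalIdeal_iff _ hpU]
      have h2 : g ∈ idealAt U hx := by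
        rcases Finset.mem_insert.1 hg with rfl | hg
        exacts [zero_mem _, hG ▸ Ideal.subset_span hg]
      have h3 : ∀ y (hy : y ∈ U), y = x.pt → g ∈ idealAt U hy := by rintro _ _ rfl; exact h2
      exact h3 _ hpU hp
    · intro hp
      obtain ⟨h, -⟩ := hp 0 (Finset.mem_insert_self _ _)
      have hpU := IntegralPoint.factorsThrough_iff.1 h
      have h2 : idealAt U hx ≤ idealAt U hpU := by
        rw [← hG, Ideal.span_le]
        intro g hg
        obtain ⟨h', hg'⟩ := hp g (Finset.mem_insert_of_mem hg)
        exact (p.eval_mem_maximalIdeal_iff h' hpU g).1 hg'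
      have h3 := (x.isMaximal_idealAt hx).eq_of_le (Ideal.IsPrime.ne_top inferInstance) h2
      exact ((specializes_of_idealAt_le hU hpU hx h2).antisymm
        (specializes_of_idealAt_le hU hx hpU h3.ge)).eq.symm
  rw [h1]
  exact isOpen_biInter_finset fun g _ => TopologicalSpace.isOpen_generateFrom_of_mem
    ⟨U, g, _, isOpen_maximalIdeal_pow 1, rfl⟩

/-- An `𝒪_K`-point of the disc, as a homomorphism of `𝒪_K`-algebras. -/
noncomputable def discHom {x : ResiduePoint f} (p : disc x) :
    letI := stalkAlgebra f x.pt
    X.presheaf.stalk x.pt →ₐ[𝒪[K]] 𝒪[K] :=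
  letI := stalkAlgebra f x.pt
  { p.1.evAt p.2 with commutes' := fun a => p.1.evAt_stalkStruct p.2 a }

namespace LocalCoordinates

variable {D : QDivisor X} {d : ℕ} {x : ResiduePoint f} (c : LocalCoordinates D d x)

/-- The coordinates of the points of the disc. -/
noncomputable def coord (p : disc x) (i : Fin d) : K := (p.1.evAt p.2 (c.param i.succ) : K)

theorem evAt_sub_mem {p p' : disc x} {n : ℕ} (h : c.coord p - c.coord p' ∈ polyball K d n)
    (a : X.presheaf.stalk x.pt) : p.1.evAt p.2 a - p'.1.evAt p'.2 a ∈ 𝓂[K] ^ n := by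
  let _ := stalkAlgebra f x.pt
  refine algHom_sub_mem_pow (O := 𝒪[K]) (A := X.presheaf.stalk x.pt)
    (c.formallyEtale_germ c.mem) (discHom p) (discHom p') n (fun i => ?_) a
  obtain ⟨z, hz, h1⟩ := h i
  have h2 : z = p.1.evAt p.2 (c.param i.succ) - p'.1.evAt p'.2 (c.param i.succ) := by
    apply Subtype.ext
    rw [h1]
    rfl
  rw [h2] at hz
  exact hz

theorem coord_injective : Function.Injective c.coord := by
  intro p p' h
  let _ := stalkAlgebra f x.pt
  have h1 : discHom p = discHom p' :=
    algHom_eq_of_eq (O := 𝒪[K]) (A := X.presheaf.stalk x.pt) (c.formallyEtale_germ c.mem)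
      fun i => Subtype.ext (congrFun h i)
  refine Subtype.ext (IntegralPoint.ext_evAt p.2 p'.2 (RingHom.ext fun a => ?_))
  exact DFunLike.congr_fun h1 a

/-- Parameters take values in `𝔪` at points of the disc, and Hensel's lemma realizes every such
tuple of values. -/
theorem range_coord : Set.range c.coord = polyball K d 1 := by
  ext y
  simp only [SetLike.mem_coe, mem_polyball, pow_one]
  constructor
  · rintro ⟨p, rfl⟩ i
    refine ⟨p.1.evAt p.2 (c.param i.succ), ?_, rfl⟩
    have : IsLocalHom (p.1.evAt p.2) := isLocalHom_localEv p.1.1 _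
    exact fun h => c.param_mem i.succ ((isUnit_map_iff (p.1.evAt p.2) _).1 h)
  · intro h
    choose a ha hay using h
    let _ := stalkAlgebra f x.pt
    obtain ⟨σ, hσ⟩ := x.exists_algHom_eq (c.formallyEtale_germ c.mem)
      (fun i => c.param_mem i.succ) a ha
    have : IsLocalHom σ.toRingHom := ⟨fun b hb => by
      by_contra hb'
      exact (mem_maximalIdeal _).1 (algHom_mem (σ := σ) ((mem_maximalIdeal _).2 hb')) hb⟩
    obtain ⟨p, hp, h1⟩ := IntegralPoint.exists_evAt_eq σ.toRingHom fun o => σ.commutes o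
    refine ⟨⟨p, hp⟩, funext fun i => ?_⟩
    rw [← hay i, ← hσ i]
    exact congrArg (fun φ : X.presheaf.stalk x.pt →+* 𝒪[K] => (φ (c.param i.succ) : K)) h1

/-- Induction on the generation of the topology. For a subbasic set, congruent coordinates modulo
`𝔪ⁿ` give congruent values of every germ at `x`, by étaleness. -/
theorem exists_polyball_nhd {O : Set (IntegralPoint f)} (hO : IsOpen O) {p : disc x}
    (hp : p.1 ∈ O) : ∃ n, ∀ p' : disc x, c.coord p' - c.coord p ∈ polyball K d n → p'.1 ∈ O := by
  induction hO with
  | basic S hS =>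
    obtain ⟨U, g, V, hV, rfl⟩ := hS
    obtain ⟨hpU, hpV⟩ := hp
    have hxU : x.pt ∈ U := by
      rw [← show p.1.special = x.pt from p.2]
      exact IntegralPoint.factorsThrough_iff.1 hpU
    obtain ⟨n, hn⟩ := exists_pow_subset hV hpV
    refine ⟨n, fun p' hp' => ?_⟩
    have hpU' : p'.1.FactorsThrough U := IntegralPoint.factorsThrough_iff.2 (by
      rw [show p'.1.special = x.pt from p'.2]
      exact hxU)
    refine ⟨hpU', hn _ ?_⟩
    rw [← p'.1.evAt_germ p'.2 hxU hpU', ← p.1.evAt_germ p.2 hxU hpU]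
    exact c.evAt_sub_mem hp' _
  | univ => exact ⟨0, fun _ _ => trivial⟩
  | inter S T _ _ hS hT =>
    obtain ⟨m, hm⟩ := hS hp.1
    obtain ⟨n, hn⟩ := hT hp.2
    exact ⟨max m n, fun p' h => ⟨hm p' (polyball_mono d (le_max_left m n) h),
      hn p' (polyball_mono d (le_max_right m n) h)⟩⟩
  | sUnion 𝒮 _ h =>
    obtain ⟨S, hS, hpS⟩ := hp
    obtain ⟨n, hn⟩ := h S hS hpS
    exact ⟨n, fun p' h => ⟨S, hS, hn p' h⟩⟩

theorem factorsThrough {p : IntegralPoint f} (hp : p ∈ disc x) : p.FactorsThrough c.U :=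
  IntegralPoint.factorsThrough_iff.2 (by rw [show p.special = x.pt from hp]; exact c.mem)

theorem coord_eq (p : disc x) (i : Fin d) :
    c.coord p i = (p.1.eval (c.factorsThrough p.2) (c.t i.succ) : K) :=
  congrArg Subtype.val (p.1.evAt_germ p.2 c.mem (c.factorsThrough p.2) (c.t i.succ))

theorem isOpenEmbedding_coord : Topology.IsOpenEmbedding c.coord := by
  refine .of_continuous_injective_isOpenMap ?_ c.coord_injective ?_
  · refine continuous_pi fun i => ?_
    simp only [coord_eq]
    exact continuous_subtype_val.comp
      (IntegralPoint.continuous_eval (fun p => c.factorsThrough (p := p)) (c.t i.succ))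
  · intro S hS
    obtain ⟨O, hO, rfl⟩ := isOpen_induced_iff.1 hS
    refine isOpen_iff_mem_nhds.2 ?_
    rintro _ ⟨p, hp, rfl⟩
    obtain ⟨n, hn⟩ := c.exists_polyball_nhd hO hp
    have h1 : (fun y => y - c.coord p) ⁻¹' (polyball K d (max n 1) : Set (Fin d → K)) ∈
        nhds (c.coord p) := by
      have h2 : Continuous fun y : Fin d → K => y - c.coord p := by fun_prop
      refine h2.continuousAt.preimage_mem_nhds ((isOpen_polyball d _).mem_nhds ?_)
      simp only [sub_self, SetLike.mem_coe, zero_mem]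
    filter_upwards [h1] with y hy
    have h3 : y ∈ Set.range c.coord := by
      rw [range_coord]
      have h4 : c.coord p ∈ (polyball K d 1 : Set (Fin d → K)) :=
        c.range_coord ▸ Set.mem_range_self p
      have h5 := add_mem (polyball_mono d (le_max_right n 1) hy) h4
      simpa using h5
    obtain ⟨p', rfl⟩ := h3
    exact ⟨p', hn p' (polyball_mono d (le_max_left n 1) hy), rfl⟩

end LocalCoordinates

end Disc

/-! ### The chart of a disc and its total mass. -/

section DiscChart

open IsLocalRing

variable {K : Type u} [Field K] [ValuativeRel K] [TopologicalSpace K]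
  [IsNonarchimedeanLocalField K] {X : Scheme.{u}} {f : X ⟶ base K}

theorem ord_prod_pow {R ι : Type*} [CommRing R] [IsDomain R] (s : Finset ι) {a : ι → R}
    (ha : ∀ i ∈ s, a i ≠ 0) (n : ι → ℕ) :
    Ring.ord R (∏ i ∈ s, a i ^ n i) = ∑ i ∈ s, n i * Ring.ord R (a i) := by
  classical
  induction s using Finset.induction_on with
  | empty => simp [Ring.ord_of_isUnit]
  | insert i s hi ih =>
    rw [Finset.prod_insert hi, Finset.sum_insert hi, mul_comm,
      Ring.ord_mul _ (mem_nonZeroDivisors_of_ne_zero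
        (pow_ne_zero _ (ha i (Finset.mem_insert_self i s)))),
      ih fun j hj => ha j (Finset.mem_insert_of_mem hj),
      Ring.ord_pow (mem_nonZeroDivisors_of_ne_zero (ha i (Finset.mem_insert_self i s))),
      nsmul_eq_mul, add_comm]

theorem exists_integer_multiples {ι : Type*} [Fintype ι] (e : ι → ℚ) :
    ∃ r : ℕ, 0 < r ∧ ∃ m : ι → ℤ, ∀ i, (m i : ℚ) = r * e i := by
  classical
  refine ⟨∏ i, (e i).den, Finset.prod_pos fun i _ => (e i).pos,
    fun i => (∏ j ∈ Finset.univ.erase i, (e j).den : ℕ) * (e i).num, fun i => ?_⟩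
  rw [← Finset.mul_prod_erase _ _ (Finset.mem_univ i)]
  push_cast
  rw [mul_comm (((e i).den : ℚ)), mul_assoc, mul_comm ((e i).den : ℚ), Rat.mul_den_eq_num]

namespace LocalCoordinates

variable {D : QDivisor X} {d : ℕ} {x : ResiduePoint f} (c : LocalCoordinates D d x)
  (hreg : IsRegularScheme X) [LocallyOfFinitePresentation f]

/-- The coefficients of `D` along the coordinate hyperplanes. -/
noncomputable def coeff (i : Fin (d + 1)) : ℚ := D (c.divisor hreg i)

/-- A common denominator of the coefficients. -/
noncomputable def denominator : ℕ := (exists_integer_multiples (c.coeff hreg)).choose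

theorem denominator_pos : 0 < c.denominator hreg :=
  (exists_integer_multiples (c.coeff hreg)).choose_spec.1

/-- The coefficients multiplied by their common denominator. -/
noncomputable def numerator : Fin (d + 1) → ℤ :=
  (exists_integer_multiples (c.coeff hreg)).choose_spec.2.choose

theorem numerator_eq (i) : (c.numerator hreg i : ℚ) = c.denominator hreg * c.coeff hreg i :=
  (exists_integer_multiples (c.coeff hreg)).choose_spec.2.choose_spec i

/-- A chart wants its coordinates among the generators of the ring of sections, so they are appended
to an arbitrary finite generating family. -/
theorem exists_generators : ∃ (n : ℕ) (g : Fin n → Γ(X, c.U)), Function.Surjective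
    (MvPolynomial.eval₂Hom (structMap f c.U) (Sum.elim g fun i : Fin d => c.t i.succ)) := by
  let _ := sectionAlgebra f c.U
  have : Algebra.FinitePresentation 𝒪[K] Γ(X, c.U) := structMap_finitePresentation f c.affine
  obtain ⟨n, φ, hφ⟩ := Algebra.FiniteType.iff_quotient_mvPolynomial''.1
    (inferInstance : Algebra.FiniteType 𝒪[K] Γ(X, c.U))
  refine ⟨n, fun i => φ (.X i), fun a => ?_⟩
  obtain ⟨P, rfl⟩ := hφ a
  refine ⟨MvPolynomial.rename Sum.inl P, ?_⟩
  have h : (MvPolynomial.eval₂Hom (structMap f c.U)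
      (Sum.elim (fun i => φ (.X i)) fun i : Fin d => c.t i.succ)).comp
        (MvPolynomial.rename Sum.inl : MvPolynomial (Fin n) 𝒪[K] →ₐ[𝒪[K]] _).toRingHom =
      φ.toRingHom := by
    refine MvPolynomial.ringHom_ext (fun a => ?_) fun i => ?_
    · simp
      rfl
    · simp
  exact DFunLike.congr_fun h P

/-- The Jacobian matrix of the `t_i` with respect to themselves is the identity, so `dt₁ ∧ ⋯ ∧ dt_d`
has order zero everywhere on `U`. -/
theorem exists_orderForm_eq_zero : ∃ (n : ℕ) (gen : Fin n ⊕ Fin d → Γ(X, c.U)),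
    Function.Surjective (MvPolynomial.eval₂Hom (structMap f c.U) gen) ∧
    (∀ i, gen (.inr i) = c.t i.succ) ∧
    ((∀ x : X, IsRegularLocalRing (X.presheaf.stalk x)) →
      ∀ (y : X) (hy : y ∈ c.U), orderForm f gen y hy = 0) := by
  obtain ⟨n, g, hg⟩ := c.exists_generators
  refine ⟨n, _, hg, fun i => rfl, fun hreg y hy => ?_⟩
  have := hreg y
  have := isDomain_of_isRegularLocalRing (X.presheaf.stalk y)
  let _ := stalkAlgebra f y
  obtain ⟨b, hb⟩ := c.exists_basis hy
  have h := orderForm_eq f c.affine _ hg hy _ b hb 1 fun i => by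
    simp [Matrix.one_apply]
  rw [h, Matrix.det_one, Ring.ord_one]

/-- The chart of a disc. -/
noncomputable def chart : Chart f D d where
  U := c.U
  affine := c.affine
  domain := c.domain
  c := c.exists_orderForm_eq_zero.choose
  gen := c.exists_orderForm_eq_zero.choose_spec.choose
  gen_surjective := c.exists_orderForm_eq_zero.choose_spec.choose_spec.1
  r := c.denominator hreg
  r_pos := c.denominator_pos hreg
  -- The generator is `∏ t_i ^ (-r D_i)`: truncation by `toNat` sends the positive exponents to the
  -- numerator and the negative ones to the denominator.
  num := ∏ i, c.t i ^ (-c.numerator hreg i).toNat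
  den := ∏ i, c.t i ^ (c.numerator hreg i).toNat
  num_ne_zero := by
    have := c.domain
    exact Finset.prod_ne_zero_iff.2 fun i _ => pow_ne_zero _ (c.t_ne_zero hreg i)
  den_ne_zero := by
    have := c.domain
    exact Finset.prod_ne_zero_iff.2 fun i _ => pow_ne_zero _ (c.t_ne_zero hreg i)
  div_eq := by
    classical
    intro y hy
    rw [c.exists_orderForm_eq_zero.choose_spec.choose_spec.2.2 hreg]
    have := hreg y.1
    have := isDomain_of_isRegularLocalRing (X.presheaf.stalk y.1)
    have h0 : ∀ i, (X.presheaf.germ c.U y.1 hy).hom (c.t i) ≠ 0 := by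
      have := c.domain
      let _ := (X.presheaf.germ c.U y.1 hy).hom.toAlgebra
      have := isLocalization_germ c.affine hy
      intro i h
      exact c.t_ne_zero hreg i ((IsLocalization.injective (X.presheaf.stalk y.1)
        (idealAt c.U hy).primeCompl_le_nonZeroDivisors) (h.trans (map_zero _).symm))
    have key : ∀ n : Fin (d + 1) → ℕ, ((Ring.ord (X.presheaf.stalk y.1)
        ((X.presheaf.germ c.U y.1 hy).hom (∏ i, c.t i ^ n i))).toNat : ℚ) =
          ∑ i, if y = c.divisor hreg i then (n i : ℚ) else 0 := by
      intro n
      simp only [map_prod, map_pow]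
      rw [ord_prod_pow _ fun i _ => h0 i]
      simp only [c.ord_t hreg hy]
      have : ∑ i, (n i : ℕ∞) * (if y = c.divisor hreg i then 1 else 0) =
        ((∑ i, if y = c.divisor hreg i then n i else 0 : ℕ) : ℕ∞) := by
        push_cast
        exact Finset.sum_congr rfl fun i _ => by split_ifs <;> simp
      rw [this, ENat.toNat_natCast]
      push_cast
      rfl
    rw [key, key, ← Finset.sum_sub_distrib]
    simp only [ENat.toNat_zero, Nat.cast_zero, mul_zero, add_zero]
    have h2 : ∀ m : ℤ, (((-m).toNat : ℕ) : ℚ) - ((m.toNat : ℕ) : ℚ) = -m := by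
      intro m
      have : (((-m).toNat : ℕ) : ℤ) - ((m.toNat : ℕ) : ℤ) = -m := by omega
      exact_mod_cast this
    by_cases hyD : ∃ i, y = c.divisor hreg i
    · obtain ⟨i, rfl⟩ := hyD
      rw [Finset.sum_eq_single i]
      · simp only [if_true]
        rw [h2, c.numerator_eq]
        rfl
      · intro j _ hj
        rw [if_neg fun h => hj (c.divisor_injective hreg h).symm,
          if_neg fun h => hj (c.divisor_injective hreg h).symm, sub_zero]
      · simp
    · have h3 : D y = 0 := by
        by_contra h
        exact hyD (c.exists_eq_divisor hreg hy h)
      rw [h3, mul_zero, neg_zero]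
      exact Finset.sum_eq_zero fun i _ => by
        rw [if_neg fun h => hyD ⟨i, h⟩, if_neg fun h => hyD ⟨i, h⟩, sub_zero]
  s := 1
  etale := by
    refine RingHom.Etale.stableUnderComposition _ _ ?_ ?_
    · simp only [c.exists_orderForm_eq_zero.choose_spec.choose_spec.2.1]
      exact c.etale
    · exact RingHom.etale_algebraMap.2 (Algebra.Etale.of_isLocalizationAway (1 : Γ(X, c.U)))
  W := disc x
  isOpen_W := isOpen_disc x
  factors p hp := c.factorsThrough hp
  eval_s_ne_zero p hp := by rw [map_one]; exact one_ne_zero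
  isOpenEmbedding := by
    simp only [c.exists_orderForm_eq_zero.choose_spec.choose_spec.2.1, ← c.coord_eq]
    exact c.isOpenEmbedding_coord

theorem chart_coord (p : disc x) : (c.chart hreg).coord p = c.coord p := by
  funext i
  exact (congrArg (fun g => (p.1.eval (c.factorsThrough p.2) g : K))
    (c.exists_orderForm_eq_zero.choose_spec.choose_spec.2.1 i)).trans (c.coord_eq p i).symm

theorem normAbs_zpow_rpow (t : K) (m : ℤ) {r : ℕ} (hr : 0 < r) {e : ℚ} (h : (m : ℚ) = r * e) :
    (normAbs t ^ (-m)) ^ (1 / (r : ℝ)) = normAbs t ^ (-(e : ℝ)) := by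
  rw [← Real.rpow_intCast, ← Real.rpow_mul (normAbs_nonneg t)]
  congr 1
  have h1 : (m : ℝ) = r * e := by exact_mod_cast h
  have h2 : (r : ℝ) ≠ 0 := by positivity
  push_cast
  rw [h1]
  field_simp

theorem normAbs_pow_toNat_div (t : K) (m : ℤ) :
    normAbs (t ^ (-m).toNat / t ^ m.toNat) = normAbs t ^ (-m) := by
  rw [normAbs_div, normAbs_pow, normAbs_pow]
  rcases le_total 0 m with h | h
  · obtain ⟨n, rfl⟩ := Int.eq_ofNat_of_zero_le h
    simp
  · obtain ⟨n, hn⟩ := Int.eq_ofNat_of_zero_le (neg_nonneg.2 h)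
    obtain rfl : m = -n := by omega
    simp

/-- The function `t 0` has the constant value `ϖ` on the disc, and `|ϖ|^{-a} = q^a`; this is the
source of the factors `q^{a_h}`. -/
theorem chart_density (p : disc x) : (c.chart hreg).density p =
    ENNReal.ofReal ((residueCard K : ℝ) ^ (c.coeff hreg 0 : ℝ)) *
      ∏ i : Fin d, pole (c.coeff hreg i.succ : ℝ) (c.coord p i) := by
  have hq := one_lt_residueCard' (K := K)
  have h1 : ∀ n : Fin (d + 1) → ℕ, (p.1.eval (c.factorsThrough p.2) (∏ i, c.t i ^ n i) : K) =
      ∏ i, (p.1.eval (c.factorsThrough p.2) (c.t i) : K) ^ n i := by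
    intro n
    simp only [map_prod, map_pow]
    exact (map_prod (𝒪[K]).subtype _ _).trans
      (Finset.prod_congr rfl fun i _ => map_pow (𝒪[K]).subtype _ _)
  have h2 : (c.chart hreg).density p = ENNReal.ofReal (normAbs
      ((p.1.eval (c.factorsThrough p.2) (∏ i, c.t i ^ (-c.numerator hreg i).toNat) : K) /
      (p.1.eval (c.factorsThrough p.2) (∏ i, c.t i ^ (c.numerator hreg i).toNat) : K)) ^
        (1 / (c.denominator hreg : ℝ))) := rfl
  rw [h2, h1, h1, ← Finset.prod_div_distrib, normAbs_prod]
  simp only [normAbs_pow_toNat_div]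
  rw [← Real.finsetProd_rpow _ _ fun i _ => zpow_nonneg (normAbs_nonneg _) _]
  simp only [normAbs_zpow_rpow _ _ (c.denominator_pos hreg) (c.numerator_eq hreg _)]
  rw [Fin.prod_univ_succ, ENNReal.ofReal_mul (Real.rpow_nonneg (normAbs_nonneg _) _),
    ENNReal.ofReal_prod_of_nonneg fun i _ => Real.rpow_nonneg (normAbs_nonneg _) _]
  congr 2
  · have h3 : p.1.eval (c.factorsThrough p.2) (c.t 0) = c.ϖ :=
      (p.1.evAt_germ p.2 c.mem (c.factorsThrough p.2) (c.t 0)).symm.trans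
        ((congrArg (p.1.evAt p.2) c.param_zero).trans (p.1.evAt_stalkStruct p.2 c.ϖ))
    rw [h3, normAbs_irreducible c.irreducible, Real.inv_rpow (by positivity),
      Real.rpow_neg (by positivity), inv_inv]
  · funext i
    rw [c.coord_eq, pole]

/-- The coordinates carry the disc onto `𝔪^d`, which reduces the mass to the product integral. -/
theorem measure_chart_univ : (residueCard K : ℝ≥0∞) ^ d * (c.chart hreg).measure Set.univ =
    ENNReal.ofReal ((residueCard K : ℝ) ^ (c.coeff hreg 0 : ℝ)) *
      ∏ i : Fin d, poleFactor K (c.coeff hreg i.succ : ℝ) := by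
  rw [← lintegral_prod_pole]
  congr 1
  let : MeasurableSpace (Fin d → K) := borel _
  have h1 := (c.chart hreg).measurableEmbedding_coord
  have hcoord : (c.chart hreg).coord = c.coord := funext fun p => c.chart_coord hreg p
  have h2 : (Set.univ.pi fun _ : Fin d => maxDisc K) = Set.range (c.chart hreg).coord := by
    rw [hcoord]
    refine Eq.trans ?_ c.range_coord.symm
    ext y
    rw [Set.mem_univ_pi, SetLike.mem_coe, mem_polyball]
    exact forall_congr' fun i => (exists_mem_maximalIdeal_pow_iff.trans (by rw [pow_one]; rfl)).symm
  rw [h2, ← h1.map_comap, h1.lintegral_map, Chart.measure,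
    Measure.map_apply measurable_subtype_coe MeasurableSet.univ, Set.preimage_univ,
    withDensity_apply _ MeasurableSet.univ, setLIntegral_univ]
  refine lintegral_congr fun p => ?_
  rw [c.chart_density hreg p, hcoord]

end LocalCoordinates

end DiscChart

/-! ### Comparison of charts: divisibility of the generating forms. -/

section ChartComparisonAlgebra

open IsLocalRing

theorem isDiscreteValuationRing_of_ringKrullDim {R : Type*} [CommRing R] [IsRegularLocalRing R]
    [IsDomain R] (h : ringKrullDim R = 1) : IsDiscreteValuationRing R := by
  have h1 : ¬ IsField R := fun hf => by
    have := ringKrullDim_eq_zero_of_isField hf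
    rw [this] at h
    exact zero_ne_one h
  refine ((IsDiscreteValuationRing.TFAE R h1).out 5 0).1 ?_
  have h2 := (IsRegularLocalRing.iff_finrank_cotangentSpace R).1 inferInstance
  rw [h] at h2
  exact_mod_cast h2

theorem isDiscreteValuationRing_stalk {X : Scheme.{u}} (hreg : IsRegularScheme X)
    (y : PrimeDivisor X) [IsDomain (X.presheaf.stalk y.1)] :
    IsDiscreteValuationRing (X.presheaf.stalk y.1) := by
  have := hreg y.1
  refine isDiscreteValuationRing_of_ringKrullDim ?_
  rw [ringKrullDim_stalk_eq_coheight, y.2]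
  rfl

/-- Geometric form of `dvd_of_forall_height_one`: the primes of the stalk are the generizations of
`x`, and those of height one are the prime divisors through `x`. -/
theorem dvd_of_forall_divisor {X : Scheme.{u}} (hreg : IsRegularScheme X) {x : X}
    {a b : X.presheaf.stalk x} (hb : b ≠ 0)
    (h : ∀ (y : PrimeDivisor X) (hy : y.1 ⤳ x),
      (X.presheaf.stalkSpecializes hy).hom b ∣ (X.presheaf.stalkSpecializes hy).hom a) :
    b ∣ a := by
  have := hreg x
  have := isDomain_of_isRegularLocalRing (X.presheaf.stalk x)
  refine dvd_of_forall_height_one (fun P hP => ?_) hb fun P hP hP1 => ?_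
  · obtain ⟨y, hy, rfl⟩ := exists_genericIdeal_eq P
    have := hreg y
    let _ := (X.presheaf.stalkSpecializes hy).hom.toAlgebra
    have := isLocalization_stalkSpecializes hy
    exact IsRegularLocalRing.of_ringEquiv (IsLocalization.algEquiv (genericIdeal hy).primeCompl
      (X.presheaf.stalk y) (Localization.AtPrime (genericIdeal hy))).toRingEquiv
  · obtain ⟨y, hy, rfl⟩ := exists_genericIdeal_eq P
    rw [height_genericIdeal] at hP1
    let _ := (X.presheaf.stalkSpecializes hy).hom.toAlgebra
    have := isLocalization_stalkSpecializes hy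
    have h1 := map_dvd (IsLocalization.algEquiv (genericIdeal hy).primeCompl
      (X.presheaf.stalk y) (Localization.AtPrime (genericIdeal hy))) (h ⟨y, hP1⟩ hy)
    have h2 : ∀ z, IsLocalization.algEquiv (genericIdeal hy).primeCompl
      (X.presheaf.stalk y) (Localization.AtPrime (genericIdeal hy))
        ((X.presheaf.stalkSpecializes hy).hom z) = algebraMap _ _ z := fun z =>
      AlgEquiv.commutes _ z
    rwa [h2, h2] at h1

/-- Eliminating the coefficient `δ` of the divisor between the two equations, and clearing the
denominators `r`, `r'`, shows that both sides have the same order, so they are associated in the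
discrete valuation ring. -/
theorem dvd_of_ord {R : Type*} [CommRing R] [IsDomain R] [IsDiscreteValuationRing R]
    {n m j n' m' : R} (hn : n ≠ 0) (hm : m ≠ 0) (hj : j ≠ 0) (hn' : n' ≠ 0) (hm' : m' ≠ 0)
    {r r' : ℕ} {δ : ℚ}
    (h : ((Ring.ord R n).toNat : ℚ) - ((Ring.ord R m).toNat : ℚ) + r * ((Ring.ord R j).toNat : ℚ) =
      -(r * δ))
    (h' : ((Ring.ord R n').toNat : ℚ) - ((Ring.ord R m').toNat : ℚ) = -(r' * δ)) :
    m ^ r' * n' ^ r ∣ n ^ r' * j ^ (r * r') * m' ^ r := by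
  have key : ∀ {z : R}, z ≠ 0 → ∃ k : ℕ, Ring.ord R z = k := fun hz => by
    obtain ⟨k, hk⟩ := ENat.ne_top_iff_exists.1 (Ring.ord_ne_top (mem_nonZeroDivisors_of_ne_zero hz))
    exact ⟨k, hk.symm⟩
  have hp : ∀ {z : R}, z ≠ 0 → ∀ k : ℕ, Ring.ord R (z ^ k) = k * Ring.ord R z := fun hz k => by
    rw [Ring.ord_pow (mem_nonZeroDivisors_of_ne_zero hz), nsmul_eq_mul]
  have hmul : ∀ {y z : R}, z ≠ 0 → Ring.ord R (y * z) = Ring.ord R y + Ring.ord R z := fun hz =>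
    Ring.ord_mul _ (mem_nonZeroDivisors_of_ne_zero hz)
  obtain ⟨a, ha⟩ := key hn
  obtain ⟨b, hb⟩ := key hm
  obtain ⟨c, hc⟩ := key hj
  obtain ⟨a', ha'⟩ := key hn'
  obtain ⟨b', hb'⟩ := key hm'
  rw [ha, hb, hc] at h
  rw [ha', hb'] at h'
  simp only [ENat.toNat_natCast] at h h'
  refine Associated.dvd ((Ring.ord_eq_iff_associated _ _).1 ?_)
  rw [hmul (pow_ne_zero _ hn'), hmul (pow_ne_zero _ hm'), hmul (pow_ne_zero _ hj),
    hp hm, hp hn', hp hn, hp hj, hp hm', ha, hb, hc, ha', hb']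
  have h2 : ((r' * b + r * a' : ℕ) : ℚ) = ((r' * a + (r * r') * c + r * b' : ℕ) : ℚ) := by
    push_cast
    linear_combination (-(r' : ℚ)) * h + (r : ℚ) * h'
  have h3 : r' * b + r * a' = r' * a + (r * r') * c + r * b' := by exact_mod_cast h2
  exact_mod_cast h3

open KaehlerDifferential in
/-- The determinant of a change of coordinates does not vanish at the points at which both families
are étale coordinates. -/
theorem apply_det_ne_zero {O A F : Type*} [CommRing O] [CommRing A] [Algebra O A] [CommRing F]
    [IsDomain F] (σ : A →+* F) {s : A} (hs : σ s ≠ 0) {d : ℕ} {ξ τ : Fin d → A}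
    (hξ : ((algebraMap A (Localization.Away s)).comp
      (MvPolynomial.eval₂Hom (algebraMap O A) ξ)).FormallyEtale)
    (hτ : (MvPolynomial.eval₂Hom (algebraMap O A) τ).FormallyEtale)
    {J : Matrix (Fin d) (Fin d) A} (hJ : ∀ i, D O A (ξ i) = ∑ j, J i j • D O A (τ j)) :
    σ J.det ≠ 0 := by
  let A' := Localization.Away s
  have hloc : (algebraMap A A').FormallyEtale := by
    rw [RingHom.formallyEtale_algebraMap]
    exact Algebra.FormallyEtale.of_isLocalization (Submonoid.powers s)
  have hcomp : ∀ ρ : Fin d → A, (algebraMap A A').comp (MvPolynomial.eval₂Hom (algebraMap O A) ρ) =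
      (MvPolynomial.aeval fun i => algebraMap A A' (ρ i) :
        MvPolynomial (Fin d) O →ₐ[O] A').toRingHom := by
    intro ρ
    refine MvPolynomial.ringHom_ext (fun a => ?_) fun i => ?_
    · simpa using (IsScalarTower.algebraMap_apply O A A' a).symm
    · simp
  obtain ⟨b, hb⟩ := exists_kaehler_basis_of_formallyEtale (O := O) (A := A')
    (fun i => algebraMap A A' (ξ i)) (by rw [← hcomp]; exact hξ)
  obtain ⟨b', hb'⟩ := exists_kaehler_basis_of_formallyEtale (O := O) (A := A')
    (fun i => algebraMap A A' (τ i)) (by rw [← hcomp]; exact hτ.comp hloc)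
  have h1 : b'.toMatrix b = ((algebraMap A A').mapMatrix J).transpose := by
    ext j i
    have h2 : b i = ∑ j, algebraMap A A' (J i j) • b' j := by
      have h3 := congrArg (KaehlerDifferential.map O O A A') (hJ i)
      simp only [map_sum, map_smul, KaehlerDifferential.map_D] at h3
      rw [hb, h3]
      exact Finset.sum_congr rfl fun j _ => by rw [hb', algebraMap_smul]
    rw [Module.Basis.toMatrix_apply, h2, Module.Basis.repr_sum_self]
    rfl
  have h2 := b'.isUnit_det b
  rw [Module.Basis.det_apply, h1, Matrix.det_transpose, ← RingHom.map_det] at h2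
  -- Clearing denominators in an inverse of `det J` over the localization: some power of `s` times a
  -- multiple of `det J` is again a power of `s`, and `σ s ≠ 0`.
  obtain ⟨w, hw⟩ := h2.exists_right_inv
  obtain ⟨⟨w', t⟩, hw'⟩ := IsLocalization.surj (Submonoid.powers s) w
  obtain ⟨t, n, rfl⟩ := t
  have h3 : algebraMap A A' (J.det * w') = algebraMap A A' (s ^ n) := by
    rw [map_mul, ← hw', ← mul_assoc, hw, one_mul]
  obtain ⟨⟨u, m, rfl⟩, hu⟩ := (IsLocalization.eq_iff_exists (Submonoid.powers s) A').1 h3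
  intro h0
  have h4 := congrArg σ hu
  simp only [map_mul, map_pow, h0, zero_mul, mul_zero] at h4
  exact mul_ne_zero (pow_ne_zero m hs) (pow_ne_zero n hs) h4.symm

variable {K : Type u} [Field K] [ValuativeRel K] [TopologicalSpace K]
  [IsNonarchimedeanLocalField K] {X : Scheme.{u}} {f : X ⟶ base K}

/-- The coordinate functions of a chart in the local ring at a point. -/
noncomputable def Chart.coordGerm {D : QDivisor X} {d : ℕ} (ch : Chart f D d) {x : X}
    (hx : x ∈ ch.U) (i : Fin d) : X.presheaf.stalk x :=
  (X.presheaf.germ ch.U x hx).hom (ch.gen (.inr i))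

theorem Chart.formallyEtale_germ {D : QDivisor X} {d : ℕ} (ch : Chart f D d) {x : X}
    (hx : x ∈ ch.U) :
    ((algebraMap (X.presheaf.stalk x)
      (Localization.Away ((X.presheaf.germ ch.U x hx).hom ch.s))).comp
      (MvPolynomial.eval₂Hom (stalkStruct f x) (ch.coordGerm hx))).FormallyEtale := by
  let A := X.presheaf.stalk x
  let B := Γ(X, ch.U)
  let A' := Localization.Away ((X.presheaf.germ ch.U x hx).hom ch.s)
  let B' := Localization.Away ch.s
  let _ : Algebra B A := (X.presheaf.germ ch.U x hx).hom.toAlgebra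
  have := isLocalization_germ ch.affine hx
  have hBA : Algebra.FormallyEtale B A :=
    Algebra.FormallyEtale.of_isLocalization (idealAt ch.U hx).primeCompl
  have hAA : Algebra.FormallyEtale A A' := Algebra.FormallyEtale.of_isLocalization
    (Submonoid.powers ((X.presheaf.germ ch.U x hx).hom ch.s))
  have : IsScalarTower B A A' := inferInstance
  have hBA' : Algebra.FormallyEtale B A' := .comp B A A'
  have hu : IsUnit (algebraMap B A' ch.s) :=
    IsLocalization.Away.algebraMap_isUnit ((X.presheaf.germ ch.U x hx).hom ch.s)
  let _ : Algebra B' A' := (IsLocalization.Away.lift ch.s hu).toAlgebra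
  have : IsScalarTower B B' A' := .of_algebraMap_eq fun b =>
    (IsLocalization.Away.lift_eq ch.s hu b).symm
  have hB'A' : Algebra.FormallyEtale B' A' :=
    .localization_base (R := B) (Submonoid.powers ch.s)
  have h1 : ((algebraMap B B').comp (MvPolynomial.eval₂Hom (structMap f ch.U)
      fun i : Fin d => ch.gen (.inr i))).FormallyEtale := by
    let _ := ((algebraMap B B').comp (MvPolynomial.eval₂Hom (structMap f ch.U)
      fun i : Fin d => ch.gen (.inr i))).toAlgebra
    have : Algebra.Etale (MvPolynomial (Fin d) 𝒪[K]) B' := ch.etale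
    exact (inferInstance : Algebra.FormallyEtale (MvPolynomial (Fin d) 𝒪[K]) B')
  have h2 := h1.comp (RingHom.formallyEtale_algebraMap.2 hB'A')
  convert h2 using 1
  have h3 : (algebraMap B' A').comp (algebraMap B B') = algebraMap B A' :=
    (IsScalarTower.algebraMap_eq B B' A').symm
  rw [← RingHom.comp_assoc, h3]
  refine MvPolynomial.ringHom_ext (fun a => ?_) fun i => ?_
  · simp only [RingHom.comp_apply, MvPolynomial.coe_eval₂Hom, MvPolynomial.eval₂_C,
      ← germ_structMap f hx]
    rfl
  · simp only [RingHom.comp_apply, MvPolynomial.coe_eval₂Hom, MvPolynomial.eval₂_X]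
    rfl

namespace LocalCoordinates

variable {D : QDivisor X} {d : ℕ} {x : ResiduePoint f} (e : LocalCoordinates D d x)
  (ch : Chart f D d) (hx : x.pt ∈ ch.U)

/-- `J` is the Jacobian matrix of the coordinates of the chart with respect to `t₁, …, t_d`. -/
def IsJacobian (J : Matrix (Fin d) (Fin d) (X.presheaf.stalk x.pt)) : Prop :=
  letI := stalkAlgebra f x.pt
  ∀ i, KaehlerDifferential.D 𝒪[K] (X.presheaf.stalk x.pt) (ch.coordGerm hx i) =
    ∑ j, J i j • KaehlerDifferential.D 𝒪[K] (X.presheaf.stalk x.pt) (e.param j.succ)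

theorem exists_isJacobian : ∃ J, e.IsJacobian ch hx J := by
  let _ := stalkAlgebra f x.pt
  obtain ⟨b, hb⟩ := e.exists_basis e.mem
  refine ⟨fun i j => b.repr (KaehlerDifferential.D 𝒪[K] _ (ch.coordGerm hx i)) j, fun i => ?_⟩
  conv_lhs => rw [← b.sum_repr (KaehlerDifferential.D 𝒪[K] _ (ch.coordGerm hx i))]
  exact Finset.sum_congr rfl fun j _ => by rw [hb]; rfl

variable {J : Matrix (Fin d) (Fin d) (X.presheaf.stalk x.pt)} (hJ : e.IsJacobian ch hx J)

include hJ

theorem evAt_det_ne_zero (p : disc x) (hp : p.1 ∈ ch.W) : p.1.evAt p.2 J.det ≠ 0 := by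
  let _ := stalkAlgebra f x.pt
  refine apply_det_ne_zero (O := 𝒪[K]) (p.1.evAt p.2)
    (s := (X.presheaf.germ ch.U x.pt hx).hom ch.s) ?_ (ch.formallyEtale_germ hx)
    (e.formallyEtale_germ e.mem) hJ
  intro h
  exact ch.eval_s_ne_zero p.1 hp
    ((p.1.evAt_germ p.2 hx (ch.factors p.1 hp) ch.s).symm.trans h)

variable (hreg : IsRegularScheme X) [LocallyOfFinitePresentation f]

/-- Both generators have divisor `-r D`, each with its own `r`. Along a prime divisor through `x`
the coordinate form of `ch` has the order of `det J` and that of the disc chart has order zero, so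
`dvd_of_ord` applies there, and codimension one suffices. -/
theorem dvd_of_isJacobian (hdet : J.det ≠ 0) :
    (X.presheaf.germ ch.U x.pt hx).hom ch.den ^ (e.chart hreg).r *
      (X.presheaf.germ e.U x.pt e.mem).hom (e.chart hreg).num ^ ch.r ∣
    (X.presheaf.germ ch.U x.pt hx).hom ch.num ^ (e.chart hreg).r * J.det ^ (ch.r * (e.chart hreg).r)
      * (X.presheaf.germ e.U x.pt e.mem).hom (e.chart hreg).den ^ ch.r := by
  have := hreg x.pt
  have := isDomain_of_isRegularLocalRing (X.presheaf.stalk x.pt)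
  have hinj : ∀ {U : X.Opens} (_ : IsAffineOpen U) (_ : IsDomain Γ(X, U)) {y : X} (hy : y ∈ U)
      {g : Γ(X, U)}, g ≠ 0 → (X.presheaf.germ U y hy).hom g ≠ 0 := by
    intro U hU hUd y hy g hg h
    let _ := (X.presheaf.germ U y hy).hom.toAlgebra
    have := isLocalization_germ hU hy
    exact hg (IsLocalization.injective (X.presheaf.stalk y)
      (idealAt U hy).primeCompl_le_nonZeroDivisors (h.trans (map_zero _).symm))
  refine dvd_of_forall_divisor hreg (mul_ne_zero (pow_ne_zero _
    (hinj ch.affine ch.domain hx ch.den_ne_zero)) (pow_ne_zero _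
      (hinj e.affine e.domain e.mem (e.chart hreg).num_ne_zero))) fun y hy => ?_
  have := hreg y.1
  have := isDomain_of_isRegularLocalRing (X.presheaf.stalk y.1)
  have := isDiscreteValuationRing_stalk hreg y
  simp only [map_mul, map_pow, stalkSpecializes_germ hx hy]
  rw [stalkSpecializes_germ e.mem hy (e.chart hreg).num,
    stalkSpecializes_germ e.mem hy (e.chart hreg).den]
  have hyc := mem_of_specializes hx hy
  have hye := mem_of_specializes e.mem hy
  have hj0 : (X.presheaf.stalkSpecializes hy).hom J.det ≠ 0 := by
    let _ := (X.presheaf.stalkSpecializes hy).hom.toAlgebra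
    have := isLocalization_stalkSpecializes hy
    intro h
    exact hdet (IsLocalization.injective (X.presheaf.stalk y.1)
      (genericIdeal hy).primeCompl_le_nonZeroDivisors (h.trans (map_zero _).symm))
  have hform : orderForm f ch.gen y.1 hyc =
      Ring.ord (X.presheaf.stalk y.1) ((X.presheaf.stalkSpecializes hy).hom J.det) := by
    let _ := stalkAlgebra f y.1
    let _ := stalkAlgebra f x.pt
    let _ := (X.presheaf.stalkSpecializes hy).hom.toAlgebra
    have : IsScalarTower 𝒪[K] (X.presheaf.stalk x.pt) (X.presheaf.stalk y.1) :=
      .of_algebraMap_eq fun a => (stalkSpecializes_stalkStruct f hy a).symm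
    obtain ⟨b, hb⟩ := e.exists_basis hye
    rw [orderForm_eq f ch.affine ch.gen ch.gen_surjective hyc _ b hb
      ((X.presheaf.stalkSpecializes hy).hom.mapMatrix J) fun i => ?_, RingHom.map_det]
    have h3 := congrArg (KaehlerDifferential.map 𝒪[K] 𝒪[K] (X.presheaf.stalk x.pt)
      (X.presheaf.stalk y.1)) (hJ i)
    simp only [map_sum, map_smul, KaehlerDifferential.map_D] at h3
    rw [← stalkSpecializes_germ hx hy]
    refine h3.trans (Finset.sum_congr rfl fun j _ => ?_)
    rw [← stalkSpecializes_germ e.mem hy]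
    exact (algebraMap_smul (X.presheaf.stalk y.1) (J i j) _).symm
  have h1 := ch.div_eq y hyc
  rw [hform] at h1
  have h2 := (e.chart hreg).div_eq y hye
  have h3 : orderForm f (e.chart hreg).gen y.1 hye = 0 :=
    e.exists_orderForm_eq_zero.choose_spec.choose_spec.2.2 hreg y.1 hye
  rw [h3, ENat.toNat_zero, Nat.cast_zero, mul_zero, add_zero] at h2
  exact dvd_of_ord (hinj ch.affine ch.domain hyc ch.num_ne_zero)
    (hinj ch.affine ch.domain hyc ch.den_ne_zero) hj0
    (hinj e.affine e.domain hye (e.chart hreg).num_ne_zero)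
    (hinj e.affine e.domain hye (e.chart hreg).den_ne_zero) h1 h2

end LocalCoordinates

end ChartComparisonAlgebra

/-! ### Comparison of charts: volumes. -/

section ChartComparisonHaar

open IsLocalRing

variable {K : Type u} [Field K] [ValuativeRel K] [TopologicalSpace K]
  [IsNonarchimedeanLocalField K]

/-- Entries are bounded, so a linear map loses at most a fixed number `a` of levels. -/
theorem exists_mulVec_mem_polyball {d : ℕ} (M : Matrix (Fin d) (Fin d) K) :
    ∃ a : ℕ, ∀ k, ∀ v ∈ polyball K d (a + k), M.mulVec v ∈ polyball K d k := by
  have hq := one_lt_residueCard' (K := K)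
  have hs : 0 ≤ ∑ i, ∑ j, normAbs (M i j) :=
    Finset.sum_nonneg fun i _ => Finset.sum_nonneg fun j _ => normAbs_nonneg _
  obtain ⟨a, ha⟩ := exists_pow_lt (K := K) (ε := (1 + ∑ i, ∑ j, normAbs (M i j))⁻¹)
    (by positivity)
  refine ⟨a, fun k v hv => ?_⟩
  rw [Matrix.mulVec_eq_sum]
  refine sum_mem fun j _ => ?_
  rw [mem_polyball] at hv ⊢
  intro i
  rw [exists_mem_maximalIdeal_pow_iff]
  have h1 := exists_mem_maximalIdeal_pow_iff.1 (hv j)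
  have h2 : normAbs (M i j) ≤ 1 + ∑ i, ∑ j, normAbs (M i j) := by
    have h3 : ∑ j, normAbs (M i j) ≤ _ := Finset.single_le_sum (f := fun i => ∑ j, normAbs (M i j))
      (fun i _ => Finset.sum_nonneg fun j _ => normAbs_nonneg (M i j)) (Finset.mem_univ i)
    have h4 : normAbs (M i j) ≤ _ := Finset.single_le_sum (f := fun j => normAbs (M i j))
      (fun j _ => normAbs_nonneg (M i j)) (Finset.mem_univ j)
    linarith
  simp only [Pi.smul_apply, Matrix.transpose_apply, op_smul_eq_smul, smul_eq_mul, normAbs_mul]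
  have h5 : (residueCard K : ℝ)⁻¹ ^ a * (1 + ∑ i, ∑ j, normAbs (M i j)) ≤ 1 := by
    rw [← le_div_iff₀ (by positivity), one_div]
    exact ha.le
  calc normAbs (v j) * normAbs (M i j)
      ≤ (residueCard K : ℝ)⁻¹ ^ (a + k) * (1 + ∑ i, ∑ j, normAbs (M i j)) := by
        gcongr
        exact normAbs_nonneg _
    _ = ((residueCard K : ℝ)⁻¹ ^ a * (1 + ∑ i, ∑ j, normAbs (M i j))) *
        (residueCard K : ℝ)⁻¹ ^ k := by rw [pow_add]; ring
    _ ≤ (residueCard K : ℝ)⁻¹ ^ k := mul_le_of_le_one_left (by positivity) h5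

variable {X : Scheme.{u}} {f : X ⟶ base K} {D : QDivisor X} {d : ℕ} {x : ResiduePoint f}

theorem normAbs_le_of_sub_mem {a b : 𝒪[K]} {n : ℕ} (h : a - b ∈ 𝓂[K] ^ n)
    (hn : (residueCard K : ℝ)⁻¹ ^ n < normAbs (b : K)) : normAbs (b : K) ≤ normAbs (a : K) := by
  obtain ⟨ϖ, hϖ⟩ := exists_irreducible (K := K)
  have h1 := (mem_maximalIdeal_pow_iff hϖ).1 (neg_mem h)
  have h2 : ((-(a - b) : 𝒪[K]) : K) + (a : K) = b := by
    push_cast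
    ring
  have hm := le_max_iff.mpr ((le_max_iff.mp ((valuation K).map_add
    ((-(a - b) : 𝒪[K]) : K) (a : K))).imp
      normAbs_le_normAbs_iff.mpr normAbs_le_normAbs_iff.mpr)
  rw [h2] at hm
  rcases le_max_iff.1 hm with h3 | h3
  · exact absurd (h3.trans h1) (not_le.2 hn)
  · exact h3

namespace LocalCoordinates

variable (e : LocalCoordinates D d x)

/-- The values of the coordinate functions of a chart at the points of a disc. -/
noncomputable def values (ξ : Fin d → X.presheaf.stalk x.pt) (p : disc x) (i : Fin d) : K :=
  (p.1.evAt p.2 (ξ i) : K)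

theorem coord_sub_apply (p p' : disc x) (j : Fin d) : (e.coord p - e.coord p') j =
    ((p.1.evAt p.2 (e.param j.succ) - p'.1.evAt p'.2 (e.param j.succ) : 𝒪[K]) : K) := rfl

theorem sub_mem_of_coord_sub_mem {p p' : disc x} {n : ℕ}
    (h : e.coord p - e.coord p' ∈ polyball K d n) (j : Fin d) :
    p.1.evAt p.2 (e.param j.succ) - p'.1.evAt p'.2 (e.param j.succ) ∈ 𝓂[K] ^ n := by
  obtain ⟨z, hz, h1⟩ := h j
  rw [coord_sub_apply] at h1
  rwa [← Subtype.ext h1]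

/-- Let `M` be the value of `J` at `p₀` and write the change of coordinates as `M ∘ g`. By Taylor
expansion, increments of `g` differ from those of the coordinates by at most the level of the
increment, so `g` does not increase volume by `haar_image_le`, and `M` contributes `|det M|`. -/
theorem haar_image_values_le {ξ : Fin d → X.presheaf.stalk x.pt}
    {J : Matrix (Fin d) (Fin d) (X.presheaf.stalk x.pt)}
    (hJ : letI := stalkAlgebra f x.pt
      ∀ i, KaehlerDifferential.D 𝒪[K] (X.presheaf.stalk x.pt) (ξ i) =
        ∑ j, J i j • KaehlerDifferential.D 𝒪[K] (X.presheaf.stalk x.pt) (e.param j.succ))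
    (p₀ : disc x) (h0 : p₀.1.evAt p₀.2 J.det ≠ 0) :
    ∃ n, ∀ S : Set (disc x), (∀ p ∈ S, e.coord p - e.coord p₀ ∈ polyball K d n) →
      haar K d (values ξ '' S) ≤
        ENNReal.ofReal (normAbs (p₀.1.evAt p₀.2 J.det : K)) * haar K d (e.coord '' S) := by
  let _ := stalkAlgebra f x.pt
  let σ₀ : X.presheaf.stalk x.pt →+* K := (𝒪[K]).subtype.comp (p₀.1.evAt p₀.2)
  let M : Matrix (Fin d) (Fin d) K := σ₀.mapMatrix J
  have hdet : M.det = (p₀.1.evAt p₀.2 J.det : K) := (RingHom.map_det σ₀ J).symm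
  have hM0 : M.det ≠ 0 := by
    rw [hdet]
    exact fun h => h0 (Subtype.ext h)
  have hMu : IsUnit M.det := isUnit_iff_ne_zero.2 hM0
  obtain ⟨a, ha⟩ := exists_mulVec_mem_polyball M⁻¹
  have : Nonempty (disc x) := ⟨p₀⟩
  -- Level `a` pays for the loss under `M⁻¹`; level `1` keeps the ball inside the image of the disc.
  set n := max a 1 with hn
  let g : (Fin d → K) → (Fin d → K) := fun y =>
    M⁻¹.mulVec (values ξ (Function.invFun e.coord y))
  have hinv : ∀ p, Function.invFun e.coord (e.coord p) = p :=
    Function.leftInverse_invFun e.coord_injective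
  let Q : Set (Fin d → K) := {y | y - e.coord p₀ ∈ polyball K d n}
  have hQr : ∀ y ∈ Q, y ∈ Set.range e.coord := by
    intro y hy
    rw [e.range_coord]
    have h1 : e.coord p₀ ∈ (polyball K d 1 : Set (Fin d → K)) :=
      e.range_coord ▸ Set.mem_range_self p₀
    simpa using add_mem (polyball_mono d (le_max_right a 1) hy) h1
  have hQ : ∀ y ∈ Q, ∀ z ∈ polyball K d n, y + z ∈ Q := by
    intro y hy z hz
    change y + z - e.coord p₀ ∈ polyball K d n
    rw [add_sub_right_comm]
    exact add_mem hy hz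
  have hg : ∀ k ≥ n, ∀ y ∈ Q, ∀ z ∈ polyball K d k, g (y + z) - g y ∈ polyball K d k := by
    intro k hk y hy z hz
    obtain ⟨p, hp⟩ := hQr _ (hQ y hy z (polyball_mono d hk hz))
    obtain ⟨p', rfl⟩ := hQr y hy
    have hz' : z = e.coord p - e.coord p' := by rw [hp, add_sub_cancel_left]
    rw [← hp]
    simp only [g, hinv]
    rw [← Matrix.mulVec_sub]
    have hw : values ξ p - values ξ p' - M.mulVec z ∈ polyball K d (a + k) := by
      intro i
      refine ⟨p.1.evAt p.2 (ξ i) - p'.1.evAt p'.2 (ξ i) - ∑ j, p₀.1.evAt p₀.2 (J i j) *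
        (p.1.evAt p.2 (e.param j.succ) - p'.1.evAt p'.2 (e.param j.succ)), ?_, ?_⟩
      · rw [hz'] at hz
        have h1 := algHom_taylor (O := 𝒪[K]) (A := X.presheaf.stalk x.pt)
          (discHom p) (discHom p') k (fun b => e.evAt_sub_mem hz b) (hJ i)
        -- Replacing the Jacobian at `p'` by the one at `p₀` costs an error of level `n + k ≥ a +
        -- k`; the Taylor remainder has level `2 * k ≥ a + k`, because `k ≥ n ≥ a`.
        have h2 : ∑ j, (p'.1.evAt p'.2 (J i j) - p₀.1.evAt p₀.2 (J i j)) *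
            (p.1.evAt p.2 (e.param j.succ) - p'.1.evAt p'.2 (e.param j.succ)) ∈
              𝓂[K] ^ (a + k) := by
          refine sum_mem fun j _ => ?_
          rw [pow_add]
          refine Ideal.mul_mem_mul (Ideal.pow_le_pow_right (le_max_left a 1) ?_)
            (e.sub_mem_of_coord_sub_mem hz j)
          exact e.evAt_sub_mem hy _
        have h3 := add_mem (Ideal.pow_le_pow_right (by omega : a + k ≤ 2 * k) h1) h2
        convert h3 using 1
        simp only [sub_mul _ _ (p.1.evAt p.2 _ - _), Finset.sum_sub_distrib]
        change _ = p.1.evAt p.2 (ξ i) - p'.1.evAt p'.2 (ξ i) - ∑ j, p'.1.evAt p'.2 (J i j) *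
          (p.1.evAt p.2 (e.param j.succ) - p'.1.evAt p'.2 (e.param j.succ)) + _
        ring
      · rw [hz']
        have h4 : ((∑ j, p₀.1.evAt p₀.2 (J i j) * (p.1.evAt p.2 (e.param j.succ) -
            p'.1.evAt p'.2 (e.param j.succ)) : 𝒪[K]) : K) =
              (M.mulVec (e.coord p - e.coord p')) i := by
          rw [Matrix.mulVec, dotProduct]
          exact map_sum (𝒪[K]).subtype _ _
        rw [Pi.sub_apply, Pi.sub_apply, ← h4]
        rfl
    have h5 : M⁻¹.mulVec (values ξ p - values ξ p') =
        z + M⁻¹.mulVec (values ξ p - values ξ p' - M.mulVec z) := by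
      rw [Matrix.mulVec_sub M⁻¹ (_ - _), Matrix.mulVec_mulVec, Matrix.nonsing_inv_mul M hMu,
        Matrix.one_mulVec, add_sub_cancel]
    rw [h5]
    exact add_mem hz (ha k _ hw)
  refine ⟨n, fun S hS => ?_⟩
  have hSQ : e.coord '' S ⊆ Q := by
    rintro _ ⟨p, hp, rfl⟩
    exact hS p hp
  have himg : values ξ '' S = (fun v => M.mulVec v) '' (g '' (e.coord '' S)) := by
    rw [Set.image_image, Set.image_image]
    refine Set.image_congr fun p _ => ?_
    simp only [g, hinv]
    rw [Matrix.mulVec_mulVec, Matrix.mul_nonsing_inv M hMu, Matrix.one_mulVec]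
  rw [himg, haar_image_mulVec M hM0, hdet]
  exact mul_le_mul' le_rfl (haar_image_le hQ g hg hSQ)

end LocalCoordinates

end ChartComparisonHaar

/-! ### Comparison of charts: the local inequality of measures. -/

section ChartComparison

open IsLocalRing

variable {K : Type u} [Field K] [ValuativeRel K] [TopologicalSpace K]
  [IsNonarchimedeanLocalField K] {X : Scheme.{u}} {f : X ⟶ base K} {D : QDivisor X} {d : ℕ}

theorem Chart.ae_volume (c : Chart f D d) {P : IntegralPoint f → Prop} {Z : Set (Fin d → K)}
    (hZ : haar K d Z = 0) (h : ∀ p : c.W, c.coord p ∉ Z → P p.1) : ∀ᵐ p ∂c.volume, P p := by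
  let : MeasurableSpace (Fin d → K) := borel _
  rw [Chart.volume,
    (MeasurableEmbedding.subtype_coe c.isOpen_W.measurableSet).ae_map_iff, ae_iff,
    c.measurableEmbedding_coord.comap_apply]
  refine measure_mono_null ?_ hZ
  rintro _ ⟨p, hp, rfl⟩
  by_contra h1
  exact hp (h p h1)

theorem mul_rpow_le_rpow {n m j n' m' : ℝ} (hn : 0 ≤ n) (hm : 0 ≤ m) (hj : 0 ≤ j) (hn' : 0 ≤ n')
    (hm' : 0 < m') {r r' : ℕ} (hr : 0 < r) (hr' : 0 < r')
    (h : n ^ r' * j ^ (r * r') * m' ^ r ≤ m ^ r' * n' ^ r) :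
    j * (n / m) ^ (1 / (r : ℝ)) ≤ (n' / m') ^ (1 / (r' : ℝ)) := by
  -- With the convention `n / 0 = 0` the left side vanishes at zeros of the denominator.
  rcases hm.eq_or_lt with rfl | hm
  · rw [div_zero, Real.zero_rpow (by positivity), mul_zero]
    positivity
  have hpow : ∀ {z : ℝ} (_ : 0 ≤ z) {k : ℕ} (_ : 0 < k), (z ^ (1 / (k : ℝ))) ^ k = z := by
    intro z hz k hk
    rw [one_div, Real.rpow_inv_natCast_pow hz hk.ne']
  rw [← pow_le_pow_iff_left₀ (by positivity) (by positivity) (mul_pos hr hr').ne', mul_pow,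
    pow_mul ((n / m) ^ (1 / (r : ℝ))), hpow (by positivity) hr, mul_comm r r',
    pow_mul ((n' / m') ^ (1 / (r' : ℝ))), hpow (by positivity) hr', div_pow, div_pow,
    ← mul_div_assoc, div_le_div_iff₀ (by positivity) (by positivity)]
  calc j ^ (r' * r) * n ^ r' * m' ^ r = n ^ r' * j ^ (r * r') * m' ^ r := by
        rw [mul_comm r r']; ring
    _ ≤ m ^ r' * n' ^ r := h
    _ = n' ^ r * m ^ r' := mul_comm _ _

namespace LocalCoordinates

variable {x : ResiduePoint f} (e : LocalCoordinates D d x) (ch : Chart f D d) (hx : x.pt ∈ ch.U)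
  {J : Matrix (Fin d) (Fin d) (X.presheaf.stalk x.pt)} (hJ : e.IsJacobian ch hx J)
  (hreg : IsRegularScheme X) [LocallyOfFinitePresentation f]

include hJ in
-- Evaluation at `p` turns the divisibility of `dvd_of_isJacobian` into an inequality of absolute
-- values, from which the `r`-th roots are extracted.
theorem mul_density_le (p : disc x) (hp : p.1 ∈ ch.W) (h0 : ∀ i, e.coord p i ≠ 0) :
    ENNReal.ofReal (normAbs (p.1.evAt p.2 J.det : K)) * ch.density ⟨p.1, hp⟩ ≤
      (e.chart hreg).density p := by
  have hdet := e.evAt_det_ne_zero ch hx hJ p hp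
  have h1 := map_dvd (p.1.evAt p.2) (e.dvd_of_isJacobian ch hx hJ hreg fun h => hdet (by
    rw [h, map_zero]))
  have h2 : ∀ g, p.1.evAt p.2 ((X.presheaf.germ ch.U x.pt hx).hom g) =
    p.1.eval (ch.factors p.1 hp) g := p.1.evAt_germ p.2 hx _
  have h3 : ∀ g, p.1.evAt p.2 ((X.presheaf.germ e.U x.pt e.mem).hom g) =
    p.1.eval (e.factorsThrough p.2) g := p.1.evAt_germ p.2 e.mem _
  rw [dvd_iff_normAbs_le] at h1
  simp only [map_mul, map_pow, h2] at h1
  rw [h3 (e.chart hreg).num, h3 (e.chart hreg).den] at h1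
  push_cast at h1
  simp only [normAbs_mul, normAbs_pow] at h1
  -- The denominator is a product of powers of `ϖ` and of the coordinates, which `h0` keeps away
  -- from zero.
  have hden : p.1.eval (e.factorsThrough p.2) (e.chart hreg).den ≠ 0 := by
    have h4 : (e.chart hreg).den = ∏ i, e.t i ^ (e.numerator hreg i).toNat := rfl
    rw [h4, map_prod]
    refine Finset.prod_ne_zero_iff.2 fun i _ => ?_
    rw [map_pow]
    refine pow_ne_zero _ ?_
    refine Fin.cases ?_ (fun i => ?_) i
    · rw [← h3]
      intro h
      refine e.irreducible.ne_zero (Eq.trans ?_ h)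
      exact ((congrArg (p.1.evAt p.2) e.param_zero).trans
        (p.1.evAt_stalkStruct p.2 e.ϖ)).symm
    · intro h
      exact h0 i ((e.coord_eq p i).trans (congrArg Subtype.val h))
  have hm' : 0 < normAbs (p.1.eval (e.factorsThrough p.2) (e.chart hreg).den : K) :=
    normAbs_pos fun h => hden (Subtype.ext h)
  rw [Chart.density, ← ENNReal.ofReal_mul (normAbs_nonneg _)]
  refine ENNReal.ofReal_le_ofReal ?_
  rw [normAbs_div, normAbs_div]
  exact mul_rpow_le_rpow (normAbs_nonneg _) (normAbs_nonneg _) (normAbs_nonneg _)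
    (normAbs_nonneg _) hm' ch.r_pos (e.chart hreg).r_pos h1

/-- Near `p₀` the volume of `ch` is at most `|det J(p₀)|` times that of the disc, while `|det J(p)|`
times the density of `ch` is at most the density of the disc chart; the two factors cancel. -/
theorem exists_nhd_measure_le (p₀ : disc x) (hp₀ : p₀.1 ∈ ch.W) : ∃ O, IsOpen O ∧ p₀.1 ∈ O ∧
    ∀ S ⊆ O, MeasurableSet S → ch.measure S ≤ (e.chart hreg).measure S := by
  have hx : x.pt ∈ ch.U := by
    rw [← show p₀.1.special = x.pt from p₀.2]
    exact IntegralPoint.factorsThrough_iff.1 (ch.factors p₀.1 hp₀)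
  obtain ⟨J, hJ⟩ := e.exists_isJacobian ch hx
  have h0 := e.evAt_det_ne_zero ch hx hJ p₀ hp₀
  obtain ⟨n₁, hn₁⟩ := e.exists_polyball_nhd ch.isOpen_W hp₀
  obtain ⟨n₂, hn₂⟩ := e.haar_image_values_le hJ p₀ h0
  obtain ⟨n₃, hn₃⟩ := exists_pow_lt (K := K)
    (normAbs_pos (x := (p₀.1.evAt p₀.2 J.det : K)) fun h => h0 (Subtype.ext h))
  -- Level `n₁` keeps the ball in the patch, `n₂` gives the volume comparison, and from `n₃` on
  -- `|det J|` is at least its value at `p₀`.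
  set n := max n₁ (max n₂ n₃) with hn
  have hle₁ : n₁ ≤ n := le_max_left _ _
  have hle₂ : n₂ ≤ n := (le_max_left _ _).trans (le_max_right _ _)
  have hle₃ : n₃ ≤ n := (le_max_right _ _).trans (le_max_right _ _)
  let O' : Set (disc x) := {p | e.coord p - e.coord p₀ ∈ polyball K d n}
  have hO' : IsOpen O' := by
    have h1 : Continuous fun p => e.coord p - e.coord p₀ :=
      e.isOpenEmbedding_coord.continuous.sub continuous_const
    exact (isOpen_polyball d n).preimage h1
  refine ⟨Subtype.val '' O', (isOpen_disc x).isOpenMap_subtype_val _ hO',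
    ⟨p₀, by simp only [O', Set.mem_ofPred_eq, sub_self, zero_mem], rfl⟩, fun S hS hSm => ?_⟩
  have hSO : ∀ p ∈ S, ∃ hp : p ∈ disc x,
      e.coord ⟨p, hp⟩ - e.coord p₀ ∈ polyball K d n := by
    intro p hp
    obtain ⟨q, hq, rfl⟩ := hS hp
    exact ⟨q.2, hq⟩
  have hSW : ∀ p ∈ S, p ∈ ch.W := by
    intro p hp
    obtain ⟨hpx, hq⟩ := hSO p hp
    exact hn₁ ⟨p, hpx⟩ (polyball_mono d hle₁ hq)
  refine ch.measure_le_of_le (e.chart hreg) hSm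
    (ENNReal.ofReal (normAbs (p₀.1.evAt p₀.2 J.det : K))) (fun T hT hTm => ?_) ?_
  · rw [ch.volume_apply hTm, (e.chart hreg).volume_apply hTm]
    have h1 : ch.coord '' (Subtype.val ⁻¹' T) =
        values (ch.coordGerm hx) '' (Subtype.val ⁻¹' T : Set (disc x)) := by
      ext y
      constructor
      · rintro ⟨p, hp, rfl⟩
        obtain ⟨hpx, -⟩ := hSO p.1 (hT hp)
        refine ⟨⟨p.1, hpx⟩, hp, funext fun i => ?_⟩
        exact congrArg Subtype.val (p.1.evAt_germ hpx hx (ch.factors p.1 p.2) (ch.gen (.inr i)))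
      · rintro ⟨p, hp, rfl⟩
        have hpW := hSW p.1 (hT hp)
        refine ⟨⟨p.1, hpW⟩, hp, funext fun i => ?_⟩
        exact congrArg Subtype.val
          (p.1.evAt_germ p.2 hx (ch.factors p.1 hpW) (ch.gen (.inr i))).symm
    have h2 : (e.chart hreg).coord = e.coord := funext fun p => e.chart_coord hreg p
    rw [h1, h2]
    refine hn₂ _ fun p hp => ?_
    obtain ⟨_, hq⟩ := hSO p.1 (hT hp)
    exact polyball_mono d hle₂ hq
  · have hZ : haar K d (⋃ i : Fin d, {y | y i = 0}) = 0 :=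
      measure_iUnion_null fun i => haar_coordinate_hyperplane i
    refine (e.chart hreg).ae_volume hZ fun p hp hpS => ?_
    obtain ⟨hpx, hq⟩ := hSO p.1 hpS
    have hpW := hSW p.1 hpS
    have hp0 : ∀ i, e.coord ⟨p.1, hpx⟩ i ≠ 0 := by
      intro i hi
      refine hp (Set.mem_iUnion.2 ⟨i, ?_⟩)
      rw [← hi]
      exact congrFun (e.chart_coord hreg ⟨p.1, hpx⟩) i
    have h1 := e.mul_density_le ch hx hJ hreg ⟨p.1, hpx⟩ hpW hp0
    have h2 : normAbs (p₀.1.evAt p₀.2 J.det : K) ≤ normAbs (p.1.evAt hpx J.det : K) :=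
      normAbs_le_of_sub_mem (n := n₃)
        (e.evAt_sub_mem (p := ⟨p.1, hpx⟩) (polyball_mono d hle₃ hq) J.det) hn₃
    rw [ch.totalDensity_coe ⟨p.1, hpW⟩, (e.chart hreg).totalDensity_coe p]
    exact (mul_le_mul' (ENNReal.ofReal_le_ofReal h2) le_rfl).trans h1

end LocalCoordinates

end ChartComparison

/-! ### The measure as the sum of the measures of the discs. -/

section LogMeasure

open IsLocalRing

variable {K : Type u} [Field K] [ValuativeRel K] [TopologicalSpace K]
  [IsNonarchimedeanLocalField K] {X : Scheme.{u}} {f : X ⟶ base K} {D : QDivisor X} {d : ℕ}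
  [LocallyOfFinitePresentation f]

/-- The section carried by the point forces the regular stalk to be formally smooth. Hence the discs
of the smooth `k`-points exhaust `X(𝒪_K)`. -/
theorem IntegralPoint.special_mem_smoothLocus (hreg : IsRegularScheme X) (p : IntegralPoint f) :
    p.special ∈ f.smoothLocus := by
  rw [mem_smoothLocus_iff]
  have := hreg p.special
  obtain ⟨U, hU, hx⟩ := exists_affine_mem p.special
  let _ := stalkAlgebra f p.special
  let _ := sectionAlgebra f U
  let _ := (X.presheaf.germ U p.special hx).hom.toAlgebra
  have : IsScalarTower 𝒪[K] Γ(X, U) (X.presheaf.stalk p.special) :=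
    .of_algebraMap_eq fun a => (germ_structMap f hx a).symm
  have := isLocalization_germ hU hx
  have : Algebra.FinitePresentation 𝒪[K] Γ(X, U) := structMap_finitePresentation f hU
  exact formallySmooth_of_section (O := 𝒪[K]) (B := Γ(X, U)) (A := X.presheaf.stalk p.special)
    (idealAt U hx) { p.evAt rfl with commutes' := fun a => p.evAt_stalkStruct rfl a }

/-- The values at a `k`-point of the functions on a neighbourhood. -/
noncomputable def ResiduePoint.sectionEv (x : ResiduePoint f) {U : X.Opens} (hx : x.pt ∈ U) :
    Γ(X, U) →+* 𝓀[K] := x.ev.comp (X.presheaf.germ U x.pt hx).hom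

theorem ResiduePoint.ker_sectionEv (x : ResiduePoint f) {U : X.Opens} (hx : x.pt ∈ U) :
    RingHom.ker (x.sectionEv hx) = idealAt U hx := by
  ext g
  change x.ev _ = 0 ↔ (X.presheaf.germ U x.pt hx).hom g ∈ maximalIdeal _
  rw [mem_maximalIdeal, mem_nonunits_iff, ← isUnit_map_iff x.ev, isUnit_iff_ne_zero, not_not]

/-- A `k`-point is determined by the values of finitely many generators in the finite field `k`. -/
theorem finite_residuePoint_mem {U : X.Opens} (hU : IsAffineOpen U) :
    {x : ResiduePoint f | x.pt ∈ U}.Finite := by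
  classical
  let _ := sectionAlgebra f U
  have : Algebra.FinitePresentation 𝒪[K] Γ(X, U) := structMap_finitePresentation f hU
  obtain ⟨n, φ, hφ⟩ := Algebra.FiniteType.iff_quotient_mvPolynomial''.1
    (inferInstance : Algebra.FiniteType 𝒪[K] Γ(X, U))
  refine Set.Finite.of_injOn (f := fun x : ResiduePoint f => fun i : Fin n =>
    if h : x.pt ∈ U then x.sectionEv h (φ (.X i)) else 0) (t := Set.univ)
    (fun _ _ => Set.mem_univ _) ?_ Set.finite_univ
  intro x hx y hy hxy
  have hx' : x.pt ∈ U := hx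
  have hy' : y.pt ∈ U := hy
  have h1 : (x.sectionEv hx').comp φ.toRingHom = (y.sectionEv hy').comp φ.toRingHom := by
    refine MvPolynomial.ringHom_ext (fun a => ?_) fun i => ?_
    · have h2 : φ.toRingHom (MvPolynomial.C a) = structMap f U a := φ.commutes a
      have h3 : ∀ (z : ResiduePoint f) (hz : z.pt ∈ U),
          z.sectionEv hz (structMap f U a) = residue _ a := fun z hz => by
        rw [ResiduePoint.sectionEv, RingHom.comp_apply, germ_structMap, z.ev_stalkStruct]
      rw [RingHom.comp_apply, RingHom.comp_apply, h2, h3, h3]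
    · have h2 := congrFun hxy i
      simp only [dif_pos hx', dif_pos hy'] at h2
      exact h2
  have h2 : x.sectionEv hx' = y.sectionEv hy' := RingHom.ext fun g => by
    obtain ⟨P, rfl⟩ := hφ g
    exact DFunLike.congr_fun h1 P
  have h3 : idealAt U hx' = idealAt U hy' := by
    rw [← x.ker_sectionEv, ← y.ker_sectionEv, h2]
  exact ResiduePoint.pt_injective ((specializes_of_idealAt_le hU hy' hx' h3.le).antisymm
    (specializes_of_idealAt_le hU hx' hy' h3.ge)).eq

theorem finite_residuePoint [QuasiCompact f] : Finite (ResiduePoint f) := by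
  have : CompactSpace X := QuasiCompact.compactSpace_of_compactSpace f
  choose U hU hxU using fun x : X => exists_affine_mem x
  obtain ⟨t, ht⟩ := CompactSpace.elim_nhds_subcover (fun x => (U x : Set X))
    fun x => (U x).2.mem_nhds (hxU x)
  refine Set.finite_univ_iff.1 ((t.finite_toSet.biUnion fun x _ =>
    finite_residuePoint_mem (f := f) (hU x)).subset fun r _ => ?_)
  have h1 : r.pt ∈ ⋃ x ∈ t, (U x : Set X) := ht ▸ Set.mem_univ _
  obtain ⟨x, hx, h2⟩ := Set.mem_iUnion₂.1 h1
  exact Set.mem_biUnion hx h2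

theorem disjoint_disc {x y : ResiduePoint f} (h : x ≠ y) : Disjoint (disc x) (disc y) :=
  Set.disjoint_left.2 fun p hp hp' => h (ResiduePoint.pt_injective
    ((show p.special = x.pt from hp).symm.trans hp'))

variable (hreg : IsRegularScheme X)
  (e : ∀ x : {x : ResiduePoint f // x.pt ∈ f.smoothLocus}, LocalCoordinates D d x.1)

theorem chart_measure_le_sum (ch : Chart f D d) :
    ch.measure ≤ Measure.sum fun x => ((e x).chart hreg).measure := by
  refine ch.measure_le_of_forall_exists fun p hp => ?_
  have hx : p.reduction.pt ∈ f.smoothLocus := by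
    rw [p.reduction_pt]
    exact p.special_mem_smoothLocus hreg
  obtain ⟨O, hO, hpO, h⟩ := (e ⟨p.reduction, hx⟩).exists_nhd_measure_le ch hreg
    ⟨p, p.reduction_pt.symm⟩ hp
  exact ⟨O, hO, hpO, fun S hS hSm => (h S hS hSm).trans
    (Measure.le_sum (fun x => ((e x).chart hreg).measure) ⟨p.reduction, hx⟩ S)⟩

/-- Every chart is dominated by the sum of the disc charts. Conversely each disc chart is one of the
charts in the supremum and is carried by its disc, and the discs are disjoint. -/
theorem logMeasure_apply [QuasiCompact f] {S : Set (IntegralPoint f)} (hS : MeasurableSet S) :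
    logMeasure f D d S = ∑' x, ((e x).chart hreg).measure S := by
  have := finite_residuePoint (f := f)
  refine le_antisymm ?_ ?_
  · rw [← Measure.sum_apply _ hS]
    exact (iSup_le fun ch => chart_measure_le_sum hreg e ch : logMeasure f D d ≤ _) S
  · have hdm : ∀ x : {x : ResiduePoint f // x.pt ∈ f.smoothLocus}, MeasurableSet (S ∩ disc x.1) :=
      fun x => hS.inter (isOpen_disc x.1).measurableSet
    have h1 : ∀ x, ((e x).chart hreg).measure S ≤ logMeasure f D d (S ∩ disc x.1) := by
      intro x
      have h2 : ((e x).chart hreg).measure S ≤ ((e x).chart hreg).measure (S ∩ disc x.1) := by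
        calc _ ≤ ((e x).chart hreg).measure (S ∩ disc x.1 ∪ (disc x.1)ᶜ) :=
              measure_mono fun p hp => by
                by_cases h : p ∈ disc x.1
                exacts [Or.inl ⟨hp, h⟩, Or.inr h]
          _ ≤ _ := measure_union_le _ _
          _ = _ := by
              rw [show ((e x).chart hreg).measure (disc x.1)ᶜ = 0 from
                ((e x).chart hreg).measure_compl_W, add_zero]
      exact h2.trans (le_iSup (fun ch : Chart f D d => ch.measure) _ _)
    calc _ ≤ ∑' x : {x : ResiduePoint f // x.pt ∈ f.smoothLocus},
          logMeasure f D d (S ∩ disc x.1) := ENNReal.tsum_le_tsum h1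
      _ = logMeasure f D d (⋃ x : {x : ResiduePoint f // x.pt ∈ f.smoothLocus}, S ∩ disc x.1) :=
          (measure_iUnion (fun x y hxy => (disjoint_disc fun h => hxy (Subtype.ext h)).mono
            Set.inter_subset_right Set.inter_subset_right) hdm).symm
      _ ≤ _ := measure_mono (Set.iUnion_subset fun _ => Set.inter_subset_left)

/-- The contribution of a smooth `k`-point. -/
theorem stringyCount_eq_tsum [QuasiCompact f] (C : Set X) :
    stringyCount f D d C = ∑' x : {x : ResiduePoint f // x.pt ∈ f.smoothLocus},
      Set.indicator {x : {x : ResiduePoint f // x.pt ∈ f.smoothLocus} | x.1.pt ∈ C} (fun x =>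
        ENNReal.ofReal ((residueCard K : ℝ) ^ ((e x).coeff hreg 0 : ℝ)) *
          ∏ i : Fin d, poleFactor K ((e x).coeff hreg i.succ : ℝ)) x := by
  have h1 : {p : IntegralPoint f | p.special ∈ C} =
      ⋃ x ∈ {x : ResiduePoint f | x.pt ∈ C}, disc x := by
    ext p
    simp only [Set.mem_ofPred_eq, Set.mem_iUnion, exists_prop]
    refine ⟨fun hp => ⟨p.reduction, ?_, p.reduction_pt.symm⟩, ?_⟩
    · rwa [p.reduction_pt]
    · rintro ⟨x, hx, hp⟩
      rwa [show p.special = x.pt from hp]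
  have hm : MeasurableSet {p : IntegralPoint f | p.special ∈ C} := by
    rw [h1]
    exact (isOpen_biUnion fun x _ => isOpen_disc x).measurableSet
  rw [stringyCount, logMeasure_apply hreg e hm, ← ENNReal.tsum_mul_left]
  congr 1
  funext x
  by_cases hx : x.1.pt ∈ C
  · rw [Set.indicator_of_mem (s := {x : {x : ResiduePoint f // x.pt ∈ f.smoothLocus} | x.1.pt ∈ C})
      hx, ← (e x).measure_chart_univ hreg]
    congr 1
    refine le_antisymm (measure_mono (Set.subset_univ _)) ?_
    calc _ ≤ ((e x).chart hreg).measure ({p | p.special ∈ C} ∪ (disc x.1)ᶜ) :=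
          measure_mono fun p _ => by
            by_cases h : p ∈ disc x.1
            · exact Or.inl (by rw [Set.mem_ofPred_eq, show p.special = x.1.pt from h]; exact hx)
            · exact Or.inr h
      _ ≤ _ := measure_union_le _ _
      _ = _ := by
          rw [show ((e x).chart hreg).measure (disc x.1)ᶜ = 0 from
            ((e x).chart hreg).measure_compl_W, add_zero]
  · rw [Set.indicator_of_notMem
      (s := {x : {x : ResiduePoint f // x.pt ∈ f.smoothLocus} | x.1.pt ∈ C}) hx]
    refine mul_eq_zero_of_right _ (measure_mono_null ?_
      (show ((e x).chart hreg).measure (disc x.1)ᶜ = 0 from ((e x).chart hreg).measure_compl_W))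
    intro p hp hpx
    exact hx (by rw [← show p.special = x.1.pt from hpx]; exact hp)

end LogMeasure

/-! ### Grouping the smooth `k`-points by strata. -/

section Strata

open IsLocalRing

variable {K : Type u} [Field K] [ValuativeRel K] [TopologicalSpace K]
  [IsNonarchimedeanLocalField K] {X : Scheme.{u}} {f : X ⟶ base K} {D : QDivisor X} {d : ℕ}

theorem poleFactor_zero : poleFactor K 0 = 1 := by
  have hq := one_lt_residueCard' (K := K)
  rw [poleFactor, if_pos zero_lt_one, sub_zero, Real.rpow_one, div_self (by linarith),
    ENNReal.ofReal_one]

theorem poleFactor_ne_zero (c : ℝ) : poleFactor K c ≠ 0 := by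
  have hq := one_lt_residueCard' (K := K)
  rw [poleFactor]
  split_ifs with h
  · have h1 : 1 < (residueCard K : ℝ) ^ (1 - c) := Real.one_lt_rpow hq (by linarith)
    rw [Ne, ENNReal.ofReal_eq_zero, not_le]
    exact div_pos (by linarith) (by linarith)
  · exact ENNReal.top_ne_zero

theorem poleFactor_lt_top_iff {c : ℝ} : poleFactor K c < ⊤ ↔ c < 1 := by
  rw [poleFactor]
  split_ifs with h <;> simp [h]

theorem toReal_poleFactor {c : ℝ} (h : c < 1) : (poleFactor K c).toReal =
    ((residueCard K : ℝ) - 1) / ((residueCard K : ℝ) ^ (1 - c) - 1) := by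
  have hq := one_lt_residueCard' (K := K)
  have h1 : 1 < (residueCard K : ℝ) ^ (1 - c) := Real.one_lt_rpow hq (by linarith)
  rw [poleFactor, if_pos h, ENNReal.toReal_ofReal]
  exact (div_pos (by linarith) (by linarith)).le

theorem PrimeDivisor.mem_support_iff {y : PrimeDivisor X} {x : X} : x ∈ y.support ↔ y.1 ⤳ x :=
  specializes_iff_mem_closure.symm

theorem mem_horizontal {y : PrimeDivisor X} :
    y ∈ horizontal f D ↔ D y ≠ 0 ∧ ¬ IsVertical f y := by
  classical
  rw [horizontal, Finset.mem_filter, Finsupp.mem_support_iff]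

open Classical in
/-- The horizontal components of `D` through a point. -/
noncomputable def horizontalAt (f : X ⟶ base K) (D : QDivisor X) (x : X) :
    Finset (PrimeDivisor X) :=
  (horizontal f D).filter fun y => x ∈ y.support

theorem mem_horizontalAt {x : X} {y : PrimeDivisor X} :
    y ∈ horizontalAt f D x ↔ y ∈ horizontal f D ∧ x ∈ y.support := by
  classical
  rw [horizontalAt, Finset.mem_filter]

theorem mem_stratum_iff {J : Finset (PrimeDivisor X)} (hJ : J ⊆ horizontal f D) {x : X} :
    x ∈ stratum f D J ↔ horizontalAt f D x = J := by
  simp only [stratum, Set.mem_sdiff, Set.mem_iInter, Set.mem_iUnion, Finset.mem_coe, exists_prop,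
    not_exists, not_and, and_imp]
  constructor
  · rintro ⟨h1, h2⟩
    ext y
    rw [mem_horizontalAt]
    refine ⟨fun h => ?_, fun h => ⟨hJ h, h1 y h⟩⟩
    by_contra hy
    exact h2 y h.1 hy h.2
  · rintro rfl
    exact ⟨fun y hy => (mem_horizontalAt.1 hy).2,
      fun y hy hy' h => hy' (mem_horizontalAt.2 ⟨hy, h⟩)⟩

namespace LocalCoordinates

variable {x : ResiduePoint f} (e : LocalCoordinates D d x) (hreg : IsRegularScheme X)
  [LocallyOfFinitePresentation f]

/-- The horizontal components of `D` through `x` are the hyperplanes `t_i = 0`, `i ≥ 1`, with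
nonzero coefficient; the other coordinates contribute the factor `1`. -/
theorem prod_poleFactor : ∏ i : Fin d, poleFactor K (e.coeff hreg i.succ : ℝ) =
    ∏ j ∈ horizontalAt f D x.pt, poleFactor K (D j : ℝ) := by
  classical
  have h1 : horizontalAt f D x.pt = (Finset.univ.filter fun i : Fin d =>
      e.coeff hreg i.succ ≠ 0).image fun i => e.divisor hreg i.succ := by
    ext y
    simp only [mem_horizontalAt, mem_horizontal, PrimeDivisor.mem_support_iff, Finset.mem_image,
      Finset.mem_filter, Finset.mem_univ, true_and]
    constructor
    · rintro ⟨⟨hD, hv⟩, hyx⟩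
      obtain ⟨i, rfl⟩ := e.exists_eq_divisor hreg (mem_of_specializes e.mem hyx) hD
      rw [e.isVertical_divisor_iff] at hv
      obtain ⟨i, rfl⟩ := Fin.exists_succ_eq.2 hv
      exact ⟨i, hD, rfl⟩
    · rintro ⟨i, hi, rfl⟩
      refine ⟨⟨hi, ?_⟩, e.divisor_specializes hreg _⟩
      rw [e.isVertical_divisor_iff]
      exact Fin.succ_ne_zero i
  rw [h1, Finset.prod_image fun i _ j _ h => Fin.succ_injective _ (e.divisor_injective hreg h)]
  refine (Finset.prod_subset (Finset.filter_subset _ _) fun i _ hi => ?_).symm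
  have h2 : e.coeff hreg i.succ = 0 := by simpa using hi
  change poleFactor K ((e.coeff hreg i.succ : ℚ) : ℝ) = 1
  rw [h2, Rat.cast_zero, poleFactor_zero]

/-- The component of the special fibre through a smooth `k`-point. -/
noncomputable def fibre (hx : x.pt ∈ f.smoothLocus) : SmoothVertical f :=
  ⟨e.divisor hreg 0, (e.isVertical_divisor_iff hreg 0).2 rfl,
    mem_of_specializes hx (e.divisor_specializes hreg 0)⟩

theorem mem_support_iff (hx : x.pt ∈ f.smoothLocus) (h : SmoothVertical f) :
    x.pt ∈ h.1.support ↔ e.fibre hreg hx = h := by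
  rw [PrimeDivisor.mem_support_iff]
  constructor
  · exact fun hs => Subtype.ext (e.eq_divisor_zero hreg h.2.1 hs).symm
  · rintro rfl
    exact e.divisor_specializes hreg 0

end LocalCoordinates

/-- Summation over the fibres of a map into a product. -/
theorem sum_eq_finsum_sum {κ α β : Type*} [DecidableEq α] [DecidableEq β] (T : Finset κ)
    (a : κ → α) (b : κ → β) (S : Finset β) (hb : ∀ x ∈ T, b x ∈ S) (F : α → ℝ) (G : β → ℝ) :
    ∑ x ∈ T, F (a x) * G (b x) = ∑ᶠ h, F h * ∑ J ∈ S,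
      ((T.filter fun x => a x = h ∧ b x = J).card : ℝ) * G J := by
  have h1 : ∀ h, F h * ∑ J ∈ S, ((T.filter fun x => a x = h ∧ b x = J).card : ℝ) * G J =
      ∑ x ∈ T.filter (fun x => a x = h), F (a x) * G (b x) := by
    intro h
    rw [← Finset.sum_fiberwise_of_maps_to (g := b) (t := S)
      fun x hx => hb x (Finset.mem_of_mem_filter x hx), Finset.mul_sum]
    refine Finset.sum_congr rfl fun J _ => ?_
    rw [Finset.filter_filter, Finset.sum_congr rfl (g := fun _ => F h * G J), Finset.sum_const,
      nsmul_eq_mul]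
    · ring
    · intro x hx
      obtain ⟨-, rfl, rfl⟩ := Finset.mem_filter.1 hx
      rfl
  simp only [h1]
  -- Only the indices hit by `a` contribute, so the `finsum` has finite support and does not fall
  -- back to its default value.
  rw [finsum_eq_sum_of_support_subset (s := T.image a)]
  · exact (Finset.sum_fiberwise_of_maps_to (fun x hx => Finset.mem_image_of_mem a hx) _).symm
  · intro h hh
    obtain ⟨x, hx, -⟩ := Finset.exists_ne_zero_of_sum_ne_zero hh
    obtain ⟨hxT, rfl⟩ := Finset.mem_filter.1 hx
    exact Finset.mem_coe.2 (Finset.mem_image_of_mem a hxT)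

variable [LocallyOfFinitePresentation f]

theorem stringyCount_eq_sum (hX : IsVariety f d) (hreg : IsRegularScheme X) (hD : IsSNC f d D)
    (C : Set X) : ∃ (T : Finset {x : ResiduePoint f // x.pt ∈ f.smoothLocus})
      (a : {x : ResiduePoint f // x.pt ∈ f.smoothLocus} → SmoothVertical f),
      (∀ x, x ∈ T ↔ x.1.pt ∈ C) ∧ (∀ x h, x.1.pt ∈ h.1.support ↔ a x = h) ∧
      stringyCount f D d C = ∑ x ∈ T, ENNReal.ofReal ((residueCard K : ℝ) ^ (D (a x).1 : ℝ)) *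
        ∏ j ∈ horizontalAt f D x.1.pt, poleFactor K (D j : ℝ) := by
  classical
  have := hX.quasiCompact
  have := finite_residuePoint (f := f)
  let _ := Fintype.ofFinite {x : ResiduePoint f // x.pt ∈ f.smoothLocus}
  let e : ∀ x : {x : ResiduePoint f // x.pt ∈ f.smoothLocus}, LocalCoordinates D d x.1 :=
    fun x => (exists_localCoordinates hX hreg hD x.1 x.2).some
  refine ⟨Finset.univ.filter fun x => x.1.pt ∈ C, fun x => (e x).fibre hreg x.2, fun x => by simp,
    fun x h => (e x).mem_support_iff hreg x.2 h, ?_⟩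
  rw [stringyCount_eq_tsum hreg e C, tsum_fintype, Finset.sum_filter]
  refine Finset.sum_congr rfl fun x _ => ?_
  rw [Set.indicator_apply, (e x).prod_poleFactor hreg]
  rfl

end Strata

end StringyCount

/-! ### The stringy point count formula. -/

open StringyCount
theorem mainTheorem8 {K : Type u} [Field K] [ValuativeRel K] [TopologicalSpace K]
    [IsNonarchimedeanLocalField K] {X : Scheme.{u}} (f : X ⟶ base K)
    [LocallyOfFinitePresentation f] (d : ℕ) (hX : IsVariety f d) (hreg : IsRegularScheme X)
    (D : QDivisor X) (hD : IsSNC f d D)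
    (C : Set X) (hCk : C ⊆ {x | f x = closedPt K}) (hC : Topology.IsConstructible C) :
    (stringyCount f D d C < ⊤ ↔
      ∀ j ∈ horizontal f D,
        (residuePoints f (j.support ∩ C ∩ f.smoothLocus)).Nonempty → D j < 1) ∧
    (stringyCount f D d C < ⊤ →
      (stringyCount f D d C).toReal =
        ∑ᶠ h : SmoothVertical f, (residueCard K : ℝ) ^ ((D h.1 : ℚ) : ℝ) *
          ∑ J ∈ (horizontal f D).powerset,
            ((residuePoints f
              (C ∩ (h.1.support ∩ f.smoothLocus) ∩ stratum f D J)).ncard : ℝ) *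
              ∏ j ∈ J, ((residueCard K : ℝ) - 1) /
                ((residueCard K : ℝ) ^ (1 - ((D j : ℚ) : ℝ)) - 1)) := by
  classical
  obtain ⟨T, a, hT, ha, hcount⟩ := stringyCount_eq_sum hX hreg hD C
  have hq := one_lt_residueCard' (K := K)
  have hfin : stringyCount f D d C < ⊤ ↔
      ∀ x ∈ T, ∀ j ∈ horizontalAt f D x.1.pt, D j < 1 := by
    rw [hcount, ENNReal.sum_lt_top]
    refine forall₂_congr fun x _ => ?_
    have h0 : ENNReal.ofReal ((residueCard K : ℝ) ^ (D (a x).1 : ℝ)) ≠ 0 := by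
      rw [Ne, ENNReal.ofReal_eq_zero, not_le]
      positivity
    constructor
    · intro h j hj
      have h1 : ∏ j ∈ horizontalAt f D x.1.pt, poleFactor K (D j : ℝ) ≠ ⊤ := fun h1 =>
        h.ne (by rw [h1, ENNReal.mul_top h0])
      have h2 : poleFactor K (D j : ℝ) < ⊤ := by
        rw [lt_top_iff_ne_top]
        intro h2
        refine h1 ?_
        -- An infinite factor is not absorbed, since no `poleFactor` vanishes.
        rw [← Finset.mul_prod_erase _ _ hj, h2, ENNReal.top_mul]
        exact Finset.prod_ne_zero_iff.2 fun _ _ => poleFactor_ne_zero _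
      exact_mod_cast poleFactor_lt_top_iff.1 h2
    · intro h
      exact ENNReal.mul_lt_top ENNReal.ofReal_lt_top (ENNReal.prod_lt_top fun j hj =>
        poleFactor_lt_top_iff.2 (by exact_mod_cast h j hj))
  refine ⟨hfin.trans ⟨?_, ?_⟩, fun h => ?_⟩
  · rintro h j hj ⟨x, ⟨hxj, hxC⟩, hxs⟩
    exact h ⟨x, hxs⟩ ((hT _).2 hxC) j (mem_horizontalAt.2 ⟨hj, hxj⟩)
  · intro h x hx j hj
    obtain ⟨hj, hxj⟩ := mem_horizontalAt.1 hj
    exact h j hj ⟨x.1, ⟨hxj, (hT x).1 hx⟩, x.2⟩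
  · have hlt := hfin.1 h
    have hterm : ∀ x ∈ T, (ENNReal.ofReal ((residueCard K : ℝ) ^ (D (a x).1 : ℝ)) *
        ∏ j ∈ horizontalAt f D x.1.pt, poleFactor K (D j : ℝ)).toReal =
          (residueCard K : ℝ) ^ ((D (a x).1 : ℚ) : ℝ) * ∏ j ∈ horizontalAt f D x.1.pt,
            ((residueCard K : ℝ) - 1) / ((residueCard K : ℝ) ^ (1 - ((D j : ℚ) : ℝ)) - 1) := by
      intro x hx
      rw [ENNReal.toReal_mul, ENNReal.toReal_ofReal (by positivity), ENNReal.toReal_prod]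
      congr 1
      exact Finset.prod_congr rfl fun j hj => toReal_poleFactor (by exact_mod_cast hlt x hx j hj)
    have hne : ∀ x ∈ T, ENNReal.ofReal ((residueCard K : ℝ) ^ (D (a x).1 : ℝ)) *
        ∏ j ∈ horizontalAt f D x.1.pt, poleFactor K (D j : ℝ) ≠ ⊤ := by
      rw [hcount, ENNReal.sum_lt_top] at h
      exact fun x hx => (h x hx).ne
    rw [hcount, ENNReal.toReal_sum hne, Finset.sum_congr rfl hterm,
      sum_eq_finsum_sum T a (fun x => horizontalAt f D x.1.pt) (horizontal f D).powerset
        (fun x _ => Finset.mem_powerset.2 (Finset.filter_subset _ _))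
        (fun h => (residueCard K : ℝ) ^ ((D h.1 : ℚ) : ℝ))
        (fun J => ∏ j ∈ J, ((residueCard K : ℝ) - 1) /
          ((residueCard K : ℝ) ^ (1 - ((D j : ℚ) : ℝ)) - 1))]
    refine finsum_congr fun h => ?_
    congr 1
    refine Finset.sum_congr rfl fun J hJ => ?_
    congr 2
    have hset : residuePoints f (C ∩ (h.1.support ∩ f.smoothLocus) ∩ stratum f D J) =
        Subtype.val '' (T.filter fun x => a x = h ∧ horizontalAt f D x.1.pt = J :
          Set {x : ResiduePoint f // x.pt ∈ f.smoothLocus}) := by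
      ext x
      constructor
      · rintro ⟨⟨hxC, hxh, hxs⟩, hxJ⟩
        exact ⟨⟨x, hxs⟩, Finset.mem_coe.2 (Finset.mem_filter.2 ⟨(hT _).2 hxC,
          (ha ⟨x, hxs⟩ h).1 hxh, (mem_stratum_iff (Finset.mem_powerset.1 hJ)).1 hxJ⟩), rfl⟩
      · rintro ⟨y, hy, rfl⟩
        obtain ⟨hyT, hyh, hyJ⟩ := Finset.mem_filter.1 (Finset.mem_coe.1 hy)
        exact ⟨⟨(hT y).1 hyT, (ha y h).2 hyh, y.2⟩,
          (mem_stratum_iff (Finset.mem_powerset.1 hJ)).2 hyJ⟩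
    rw [hset, Set.ncard_image_of_injective _ Subtype.val_injective, Set.ncard_coe_finset]
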